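/- Let $n\ge 0$, $m\ge1$, $r\ge 1$ be integers, $Y=\mathbb R^n$, $P=\mathbb R^m$, and let $f:Y\to Y$, $g:Y\to P$ be $C^r$ maps whose derivatives of orders $1,\dots,r$ are bounded and uniformly continuous. Let $\Lambda\subset Y$ be a bounded invariant set of the flow of $y'=f(y)$ that is - uniformly hyperbolic: for $x\in\Lambda$ there is a splitting $Y=N^s(x)\oplus N^u(x)\oplus\operatorname{span}\{f(x)\}$, where $N^s$, $N^u$ depend continuously on $x\in\Lambda$ and are invariant under the flow linearized along the orbits in $\Lambda$, and the linearized flow contracts $N^s$ exponentially as $t\to+\infty$ and $N^u$ exponentially as $t\to-\infty$, with constants that are uniform on $\Lambda$; - transitive: $\Lambda$ contains an orbit whose forward half is dense in $\Lambda$; - locally maximal: there is $\delta>0$ such that every orbit staying for all $t\in\mathbb R$ in the $\delta$-neighbourhood of $\Lambda$ lies in $\Lambda$. Let $z_1,\dots,z_{m+1}$ be periodic orbits in $\Lambda$ with periods $T_1,\dots,T_{m+1}>0$, and put $$b_i:=\frac1{T_i}\int_0^{T_i}g(z_i(t))\,dt\in P,\qquad I_b:=\operatorname{int}\,\operatorname{conv}\{b_1,\dots,b_{m+1}\}.$$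 Assume $I_b\neq\varnothing$. Let $\mathbb Y=l_\infty(\mathbb Z,Y)$ and $\mathbb P=l_\infty(\mathbb Z,P)$, with supremum norms, and let $F_\varepsilon:\mathbb Y\times\mathbb P\to\mathbb Y$, $G_\varepsilon:\mathbb Y\times\mathbb P\to\mathbb P$ ($|\varepsilon|\le\varepsilon_1$, $\varepsilon_1>0$) be $C^r$ maps that are, together with their derivatives up to order $r$, uniformly continuous and bounded by a constant independent of $\varepsilon$. Consider the lattice dynamical system $$y_k'=f(y_k)+\varepsilon F_{\varepsilon,k}(\mathbf y,\mathbf p),\qquad p_k'=g(y_k)+\varepsilon G_{\varepsilon,k}(\mathbf y,\mathbf p),\qquad k\in\mathbb Z,\tag{1}$$ for $\mathbf y(t)=\{y_k(t)\}\in\mathbb Y$, $\mathbf p(t)=\{p_k(t)\}\in\mathbb P$. Then for every $\vec p\in I_b$ there exist $\varepsilon_0>0$ and $R_0<\infty$ such that for every $\varepsilon$ with $|\varepsilon|<\varepsilon_0$ there is a set $\mathcal K_{\vec p}$ of solutions $(\mathbf y(t),\mathbf p(t))$, $t\in\mathbb R$, of (1) that has strictly positive space-time entropy and all of whose elements satisfy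 $$\|\mathbf y(t)\|_{\mathbb Y}+\|\mathbf p(t)-\vec p\,t\|_{\mathbb P}\le R_0\qquad\text{for all }t\in\mathbb R,$$ where $\vec p\,t$ denotes the constant sequence with all entries $\vec p\,t$. Here the space-time entropy of a set $\mathcal K$ of functions of $(t,k)\in\mathbb R\times\mathbb Z$ is $$h(\mathcal K)=\lim_{\delta\to0}\ \limsup_{(T,N)\to\infty}\ \frac1{4TN}\log \mathcal N_\delta\big(\mathcal K|_{|t|\le T,\,|k|\le N}\big),$$ where $\mathcal N_\delta$ is the minimal number of balls of radius $\delta$ in the supremum norm on the window $\{|t|\le T,\ |k|\le N\}$ that cover the set of restrictions. -/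

import Mathlib

open scoped ENNReal

namespace LDS

/-- The Euclidean space `ℝⁿ`. -/
abbrev Vec (n : ℕ) : Type := EuclideanSpace ℝ (Fin n)

/-- The Banach space `l_∞(E)` of bounded two-sided sequences in `E`, with the supremum norm. -/
abbrev LInf (E : Type) [NormedAddCommGroup E] : Type := lp (fun _ : ℤ => E) ∞

/-- The constant sequence with value `v`. -/
def constSeq {E : Type} [NormedAddCommGroup E] (v : E) : LInf E :=
  ⟨fun _ => v, memℓp_infty ⟨‖v‖, by rintro _ ⟨k, rfl⟩; exact le_rfl⟩⟩

section Smoothness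

variable {E E' : Type} [NormedAddCommGroup E] [NormedSpace ℝ E]
  [NormedAddCommGroup E'] [NormedSpace ℝ E']

/-- `h` is of class `C^r`, and its derivatives of the orders `1, …, r` are bounded and uniformly
continuous. -/
def HasBoundedDerivs (r : ℕ) (h : E → E') : Prop :=
  ContDiff ℝ r h ∧ ∀ i : ℕ, 1 ≤ i → i ≤ r →
    UniformContinuous (iteratedFDeriv ℝ i h) ∧ ∃ C : ℝ, ∀ x, ‖iteratedFDeriv ℝ i h x‖ ≤ C

/-- `h` is of class `C^r`; `h` and its derivatives up to the order `r` are uniformly continuous and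
bounded in norm by `C`. -/
def IsCrBoundedBy (r : ℕ) (C : ℝ) (h : E → E') : Prop :=
  ContDiff ℝ r h ∧ ∀ i : ℕ, i ≤ r →
    UniformContinuous (iteratedFDeriv ℝ i h) ∧ ∀ x, ‖iteratedFDeriv ℝ i h x‖ ≤ C

end Smoothness

section Hyperbolicity

variable {n : ℕ}

/-- `y` is a solution, defined for all times, of `y' = f(y)`. -/
def IsOrbit (f : Vec n → Vec n) (y : ℝ → Vec n) : Prop :=
  ∀ t, HasDerivAt y (f (y t)) t

/-- `v` is a solution, defined for all times, of the system `v' = f'(y(t)) v` linearized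
about `y`. -/
def IsLinearizedSolution (f : Vec n → Vec n) (y v : ℝ → Vec n) : Prop :=
  ∀ t, HasDerivAt v (fderiv ℝ f (y t) (v t)) t

/-- Through every point of `Λ` there passes an orbit that stays in `Λ` for all times. -/
def IsFlowInvariant (f : Vec n → Vec n) (Λ : Set (Vec n)) : Prop :=
  ∀ x ∈ Λ, ∃ y, IsOrbit f y ∧ y 0 = x ∧ ∀ t, y t ∈ Λ

/-- Uniform hyperbolicity of the flow of `y' = f(y)` on `Λ`: the space splits at every `x ∈ Λ` as
`N^s(x) ⊕ N^u(x) ⊕ span {f(x)}`, where `N^s` and `N^u` depend continuously on `x ∈ Λ` (as points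
of the Grassmannian, that is, through their orthogonal projections), are invariant with
respect to the linearized flow, and this flow contracts `N^s` exponentially in forward time
and `N^u` exponentially in backward time, with constants that are uniform on `Λ`. -/
def IsUniformlyHyperbolic (f : Vec n → Vec n) (Λ : Set (Vec n)) : Prop :=
  ∃ Ns Nu : Vec n → Submodule ℝ (Vec n), ∃ C lam : ℝ, 0 < lam ∧
    ContinuousOn (fun x => (Ns x).starProjection) Λ ∧
    ContinuousOn (fun x => (Nu x).starProjection) Λ ∧
    (∀ x ∈ Λ, DirectSum.IsInternal ![Ns x, Nu x, Submodule.span ℝ {f x}]) ∧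
    ∀ y v, IsOrbit f y → (∀ t, y t ∈ Λ) → IsLinearizedSolution f y v →
      (v 0 ∈ Ns (y 0) →
        (∀ t, v t ∈ Ns (y t)) ∧ ∀ t, 0 ≤ t → ‖v t‖ ≤ C * Real.exp (-lam * t) * ‖v 0‖) ∧
      (v 0 ∈ Nu (y 0) →
        (∀ t, v t ∈ Nu (y t)) ∧ ∀ t, t ≤ 0 → ‖v t‖ ≤ C * Real.exp (lam * t) * ‖v 0‖)

/-- `Λ` contains an orbit whose positive half is dense in `Λ`. -/
def IsFlowTransitive (f : Vec n → Vec n) (Λ : Set (Vec n)) : Prop :=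
  ∃ y, IsOrbit f y ∧ (∀ t, y t ∈ Λ) ∧ Λ ⊆ closure (y '' Set.Ici 0)

/-- Every orbit that stays for all times in a certain neighbourhood of `Λ` lies in `Λ`. -/
def IsLocallyMaximal (f : Vec n → Vec n) (Λ : Set (Vec n)) : Prop :=
  ∃ δ > 0, ∀ y, IsOrbit f y → (∀ t, y t ∈ Metric.thickening δ Λ) → ∀ t, y t ∈ Λ

/-- `z` is a periodic orbit in `Λ`, of period `T`. -/
def IsPeriodicOrbitIn (f : Vec n → Vec n) (Λ : Set (Vec n)) (z : ℝ → Vec n) (T : ℝ) : Prop :=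
  IsOrbit f z ∧ (∀ t, z t ∈ Λ) ∧ 0 < T ∧ Function.Periodic z T

/-- The mean of `g` over a periodic orbit `z` of period `T`. -/
noncomputable def orbitMean {m : ℕ} (g : Vec n → Vec m) (z : ℝ → Vec n) (T : ℝ) : Vec m :=
  (1 / T) • ∫ t in (0 : ℝ)..T, g (z t)

end Hyperbolicity

/-- `(y(t), p(t))` is a solution, defined for all times and with values in `l_∞ × l_∞`, of the
coupled lattice system `y_k' = f(y_k) + ε F_k(y, p)`, `p_k' = g(y_k) + ε G_k(y, p)`, `k ∈ ℤ`. -/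
def IsLatticeSolution {n m : ℕ} (f : Vec n → Vec n) (g : Vec n → Vec m) (ε : ℝ)
    (F : LInf (Vec n) × LInf (Vec m) → LInf (Vec n))
    (G : LInf (Vec n) × LInf (Vec m) → LInf (Vec m))
    (y : ℝ → LInf (Vec n)) (p : ℝ → LInf (Vec m)) : Prop :=
  Differentiable ℝ y ∧ Differentiable ℝ p ∧
    ∀ (t : ℝ) (k : ℤ),
      deriv y t k = f (y t k) + ε • F (y t, p t) k ∧
      deriv p t k = g (y t k) + ε • G (y t, p t) k

section Entropy

variable {E : Type} [NormedAddCommGroup E]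

/-- The minimal number of balls of radius `δ`, with respect to the supremum norm on the space-time
window `|t| ≤ T`, `|k| ≤ N`, that cover the restrictions of the functions from `K` to this
window. -/
noncomputable def coveringNumber (K : Set (ℝ → ℤ → E)) (δ T : ℝ) (N : ℕ) : ℕ∞ :=
  sInf {c : ℕ∞ | ∃ S : Set (ℝ → ℤ → E), S.encard = c ∧
    ∀ u ∈ K, ∃ w ∈ S, ∀ t : ℝ, |t| ≤ T → ∀ k : ℤ, |k| ≤ (N : ℤ) → ‖u t k - w t k‖ ≤ δ}

/-- The space-time topological entropy
`lim_{δ → 0} limsup_{(T, N) → ∞} (4 T N)⁻¹ log (coveringNumber K δ T N)`. The limit is a supremum,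
because the covering numbers do not increase with `δ`. -/
noncomputable def spaceTimeEntropy (K : Set (ℝ → ℤ → E)) : EReal :=
  ⨆ (δ : ℝ) (_ : 0 < δ), Filter.limsup
    (fun q : ℝ × ℕ =>
      ENNReal.log (coveringNumber K δ q.1 q.2 : ℝ≥0∞) / ((4 * q.1 * (q.2 : ℝ) : ℝ) : EReal))
    (Filter.atTop ×ˢ Filter.atTop)

end Entropy

/-- A pair of curves in `l_∞`, read as a function of the time and of the lattice site. -/
def toField {n m : ℕ} (u : (ℝ → LInf (Vec n)) × (ℝ → LInf (Vec m))) :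
    ℝ → ℤ → Vec n × Vec m :=
  fun t k => (u.1 t k, u.2 t k)

end LDS

/-! At each site the base equation `y' = f(y)` has a hyperbolic set, so its pseudo-orbits are
shadowed, also in the weakly coupled lattice. While `y_k` stays near a periodic orbit `z_i`, `p_k`
drifts with mean velocity `b_i`. Since `v` is interior to the convex hull of the `b_i`, for every
deviation `d = p_k - t v` some `b_i - v` has inner product at most `-c ‖d‖` with `d`
(`exists_inner_le_of_mem_interior_convexHull`). Time is therefore divided into long blocks. In each
block and at each site the pseudo-orbit first visits one of two disjoint periodic orbits, as
prescribed by a free symbol, and then settles on a periodic orbit chosen by feedback to push the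
current deviation back. A block gains a multiple of its length, while the transients cost a fixed
amount, so long blocks keep all deviations bounded (`norm_add_smul_add_le`). The free symbols can be
read off at fixed times, one per block and site, which gives positive entropy
(`spaceTimeEntropy_pos`).

The difficulty is circular: the pseudo-orbit depends discontinuously on `p`, and `p` is known only
once the shadowing orbit is found; moreover `p` is a neutral direction. The orbit is therefore built
on growing time windows (`WindowSol.exists_extension`). A window solution is an orbit for the steps
`-J, …, J` with `p = 0` at time `0` and hyperbolic boundary conditions at both ends. To enlarge the
window, the next base points are chosen from the present value of `p` at the ends, and a boundary
value problem is solved by contraction in a norm with weight `μ^|j|`. This weight absorbs the growth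
of neutral components carried outwards, whereas the components carried inwards are hyperbolically
contracted by more than the weight loses. The correction decays geometrically away from the ends, so
the value of `p` on which a choice was based later changes by at most `ρ / κ`. The base points are
never revised, and the limit is an orbit of the lattice controlled up to this bounded error
(`exists_controlled_orbit`).

The flow direction of `f` is neutral too. Its component of the error is removed at every new base
point by a small time shift along the pseudo-path (`create` in `ShadowStep`). Small `ε` is needed at
three places: to keep the time-`τ` maps close to those of `f` (`exists_shadowStep`), to prevent a
large difference in `p` from influencing `y` (`lattice_diff`), and to make the drift error per step
small compared with the control. -/

namespace LDS

/-! ### Fixed points, Gronwall estimates and global solutions of Lipschitz equations. -/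

/-- A fixed point lemma for maps on families `ι → Z` that contract with respect to a weighted
supremum of a norm-like function `N`. -/
theorem exists_fixedPoint_weighted {ι Z : Type*} [NormedAddCommGroup Z] [CompleteSpace Z]
    (N : Z → ℝ) (hNadd : ∀ a b, N (a + b) ≤ N a + N b) (hNc : Continuous N)
    (c : ℝ) (hc : 0 < c) (hcN : ∀ z, c * ‖z‖ ≤ N z) (hN0 : N 0 = 0) (hNneg : ∀ a, N (-a) = N a)
    (w : ι → ℝ) (hw : ∀ i, 0 ≤ w i) (P : (ι → Z) → Prop) (T : (ι → Z) → ι → Z)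
    (u₀ : ι → Z) (D : ℝ) (hD : 0 ≤ D) (hP₀ : P u₀) (hPT : ∀ u, P u → P (T u))
    (hPlim : ∀ (s : ℕ → ι → Z) (u : ι → Z), (∀ n, P (s n)) →
      (∀ n i, ‖s n i - u i‖ ≤ (2 * D / c) * (1 / 2) ^ n * w i) → P u)
    (h0 : ∀ i, N (T u₀ i - u₀ i) ≤ D * w i)
    (hT : ∀ u v, P u → P v → (∀ i, N (u i - u₀ i) ≤ 2 * D * w i) →
      (∀ i, N (v i - u₀ i) ≤ 2 * D * w i) → ∀ d, 0 ≤ d → (∀ i, N (u i - v i) ≤ d * w i) →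
      ∀ i, N (T u i - T v i) ≤ d / 2 * w i) :
    ∃ u, P u ∧ T u = u ∧ ∀ i, N (u i - u₀ i) ≤ 2 * D * w i := by
  set s : ℕ → ι → Z := fun n => T^[n] u₀ with hs
  have hs0 : s 0 = u₀ := rfl
  have hsS : ∀ n, s (n + 1) = T (s n) := fun n => Function.iterate_succ_apply' T n u₀
  have hPs : ∀ n, P (s n) := by
    intro n
    induction n with
    | zero => exact hP₀
    | succ n ih => rw [hsS]; exact hPT _ ih
  -- The factor `1 - 2⁻ⁿ` keeps all iterates within `2 D w` of `u₀`, the only region where `hT`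
  -- provides a contraction.
  have key : ∀ n, (∀ i, N (s n i - u₀ i) ≤ 2 * D * (1 - (1 / 2) ^ n) * w i) ∧
      (∀ i, N (s (n + 1) i - s n i) ≤ D * (1 / 2) ^ n * w i) := by
    intro n
    induction n with
    | zero =>
      refine ⟨fun i => by simp [hs0, hN0], fun i => ?_⟩
      rw [hsS, hs0]; simpa using h0 i
    | succ n ih =>
      have h1 : ∀ i, N (s (n + 1) i - u₀ i) ≤ 2 * D * (1 - (1 / 2) ^ (n + 1)) * w i := by
        intro i
        have := hNadd (s (n + 1) i - s n i) (s n i - u₀ i)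
        rw [sub_add_sub_cancel] at this
        have h2 := ih.1 i
        have h3 := ih.2 i
        have : N (s (n + 1) i - u₀ i) ≤ (D * (1 / 2) ^ n + 2 * D * (1 - (1 / 2) ^ n)) * w i := by
          linarith
        refine this.trans (le_of_eq ?_)
        rw [pow_succ]; ring
      refine ⟨h1, fun i => ?_⟩
      have reg : ∀ m, (∀ i, N (s m i - u₀ i) ≤ 2 * D * (1 - (1 / 2) ^ m) * w i) →
          ∀ i, N (s m i - u₀ i) ≤ 2 * D * w i := by
        intro m hm i
        refine (hm i).trans (mul_le_mul_of_nonneg_right ?_ (hw i))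
        have : (0 : ℝ) ≤ (1 / 2) ^ m := by positivity
        nlinarith
      have := hT (s (n + 1)) (s n) (hPs _) (hPs _) (reg _ h1) (reg _ ih.1) (D * (1 / 2) ^ n)
        (by positivity) ih.2 i
      rw [hsS (n + 1), hsS n] at *
      refine this.trans (le_of_eq ?_)
      rw [pow_succ]; ring
  have hstep : ∀ i n, dist (s n i) (s (n + 1) i) ≤ (D / c * w i) * (1 / 2) ^ n := by
    intro i n
    have h1 := (hcN (s (n + 1) i - s n i)).trans ((key n).2 i)
    rw [dist_comm, dist_eq_norm]
    rw [show D / c * w i * (1 / 2 : ℝ) ^ n = (D * (1 / 2) ^ n * w i) / c by ring,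
      le_div_iff₀ hc, mul_comm]
    exact h1
  have hcau : ∀ i, CauchySeq fun n => s n i := fun i =>
    cauchySeq_of_le_geometric (1 / 2) _ (by norm_num) (hstep i)
  choose u hu using fun i => cauchySeq_tendsto_of_complete (hcau i)
  have hdist : ∀ n i, ‖s n i - u i‖ ≤ (2 * D / c) * (1 / 2) ^ n * w i := by
    intro n i
    have := dist_le_of_le_geometric_of_tendsto (1 / 2) _ (by norm_num) (hstep i) (hu i) n
    rw [dist_eq_norm] at this
    refine this.trans (le_of_eq ?_)
    ring
  have hPu : P u := hPlim s u hPs hdist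
  have hreg : ∀ i, N (u i - u₀ i) ≤ 2 * D * w i := by
    intro i
    refine le_of_tendsto ((hNc.tendsto _).comp ((hu i).sub_const (u₀ i)))
      (Filter.Eventually.of_forall fun n => ((key n).1 i).trans
        (mul_le_mul_of_nonneg_right ?_ (hw i)))
    have : (0 : ℝ) ≤ (1 / 2) ^ n := by positivity
    nlinarith
  have hregs : ∀ n i, N (s n i - u₀ i) ≤ 2 * D * w i := by
    intro n i
    refine ((key n).1 i).trans (mul_le_mul_of_nonneg_right ?_ (hw i))
    have : (0 : ℝ) ≤ (1 / 2) ^ n := by positivity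
    nlinarith
  -- The distance to the limit is measured in `N` and not merely in the norm, because `hT` is to be
  -- applied to the pair `s n`, `u`.
  have hNsn : ∀ n i, N (s n i - u i) ≤ 2 * D * (1 / 2) ^ n * w i := by
    intro n i
    have h2 : ∀ m, N (s (n + m) i - s n i) ≤ 2 * D * (1 / 2) ^ n * (1 - (1 / 2) ^ m) * w i := by
      intro m
      induction m with
      | zero => simp [hN0]
      | succ m ih =>
        have h3 := hNadd (s (n + m + 1) i - s (n + m) i) (s (n + m) i - s n i)
        rw [sub_add_sub_cancel] at h3
        have h4 := (key (n + m)).2 i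
        rw [← add_assoc]
        have : N (s (n + m + 1) i - s n i) ≤
          (D * (1 / 2) ^ (n + m) + 2 * D * (1 / 2) ^ n * (1 - (1 / 2) ^ m)) * w i := by linarith
        refine this.trans (le_of_eq ?_)
        rw [pow_add, pow_succ]; ring
    have h5 : Filter.Tendsto (fun m => s (n + m) i) Filter.atTop (nhds (u i)) := by
      simpa [add_comm, Function.comp_def] using (hu i).comp (Filter.tendsto_add_atTop_nat n)
    refine le_of_tendsto ((hNc.tendsto _).comp (h5.const_sub (s n i)))
      (Filter.Eventually.of_forall fun m => ?_)
    have h6 := h2 m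
    rw [← hNneg, neg_sub] at h6
    refine h6.trans (mul_le_mul_of_nonneg_right ?_ (hw i))
    have h7 : (0 : ℝ) ≤ (1 / 2) ^ m := by positivity
    have h8 : (0 : ℝ) ≤ 2 * D * (1 / 2) ^ n := by positivity
    nlinarith
  refine ⟨u, hPu, ?_, hreg⟩
  funext i
  have h1 : Filter.Tendsto (fun n => T (s n) i) Filter.atTop (nhds (u i)) := by
    have := (hu i).comp (Filter.tendsto_add_atTop_nat 1)
    refine this.congr fun n => ?_
    simp [hsS]
  have h2 : Filter.Tendsto (fun n => T (s n) i) Filter.atTop (nhds (T u i)) := by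
    rw [tendsto_iff_norm_sub_tendsto_zero]
    refine squeeze_zero (fun _ => norm_nonneg _) (g := fun n => (D / c * w i) * (1 / 2) ^ n) ?_ ?_
    · intro n
      have := hT (s n) u (hPs _) hPu (hregs n) hreg _ (by positivity) (hNsn n) i
      have h3 := (hcN _).trans this
      rw [show D / c * w i * (1 / 2 : ℝ) ^ n = (D * (1 / 2) ^ n * w i) / c by ring,
        le_div_iff₀ hc, mul_comm]
      refine h3.trans (le_of_eq ?_)
      ring
    · have := (tendsto_pow_atTop_nhds_zero_of_lt_one (r := (1 / 2 : ℝ)) (by norm_num)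
        (by norm_num)).const_mul (D / c * w i)
      simpa using this
  exact tendsto_nhds_unique h2 h1

/-- A two-sided Gronwall inequality. -/
theorem norm_le_exp_mul_of_norm_deriv_le {E : Type*} [NormedAddCommGroup E] [NormedSpace ℝ E]
    {w w' : ℝ → E} {K η τ : ℝ} (hK : 0 ≤ K) (hη : 0 ≤ η)
    (hw : ∀ t, |t| ≤ τ → HasDerivAt w (w' t) t)
    (hb : ∀ t, |t| ≤ τ → ‖w' t‖ ≤ K * ‖w t‖ + η) {t : ℝ} (ht : |t| ≤ τ) :
    ‖w t‖ ≤ Real.exp (K * |t|) * (‖w 0‖ + η * |t|) := by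
  have main : ∀ (w w' : ℝ → E), (∀ t, 0 ≤ t → t ≤ τ → HasDerivAt w (w' t) t) →
      (∀ t, 0 ≤ t → t ≤ τ → ‖w' t‖ ≤ K * ‖w t‖ + η) → ∀ t, 0 ≤ t → t ≤ τ →
      ‖w t‖ ≤ Real.exp (K * t) * (‖w 0‖ + η * t) := by
    intro w w' hw hb t ht0 htτ
    -- `K` may vanish, and the closed form of `gronwallBound` divides by the rate. So the bound is
    -- proved for all `K' > K`, and then `K'` tends to `K`.
    have hK1 : ∀ K', K < K' → ‖w t‖ ≤ gronwallBound ‖w 0‖ K' η (t - 0) := fun K' hK' =>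
      norm_le_gronwallBound_of_norm_deriv_right_le (f := w) (f' := w') (a := 0) (b := τ)
        (fun x hx => (hw x hx.1 hx.2).continuousAt.continuousWithinAt)
        (fun x hx => (hw x hx.1 hx.2.le).hasDerivWithinAt) le_rfl
        (fun x hx => (hb x hx.1 hx.2.le).trans
          (by have := norm_nonneg (w x); nlinarith)) t ⟨ht0, htτ⟩
    have hK2 : ∀ K', K < K' → ‖w t‖ ≤ Real.exp (K' * t) * (‖w 0‖ + η * t) := by
      intro K' hK'
      have hK'0 : 0 < K' := by linarith
      refine (hK1 K' hK').trans ?_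
      rw [gronwallBound_of_K_ne_0 hK'0.ne']
      simp only [sub_zero]
      have h1 : η / K' * (Real.exp (K' * t) - 1) ≤ Real.exp (K' * t) * (η * t) := by
        have h2 : Real.exp (K' * t) - 1 ≤ K' * t * Real.exp (K' * t) := by
          have h3 := Real.add_one_le_exp (-(K' * t))
          have h4 : Real.exp (-(K' * t)) * Real.exp (K' * t) = 1 := by
            rw [← Real.exp_add]; simp
          have h5 := Real.exp_pos (K' * t)
          nlinarith
        calc η / K' * (Real.exp (K' * t) - 1) ≤ η / K' * (K' * t * Real.exp (K' * t)) :=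
              mul_le_mul_of_nonneg_left h2 (by positivity)
          _ = Real.exp (K' * t) * (η * t) := by field_simp
      linarith
    have hlim : Filter.Tendsto (fun K' => Real.exp (K' * t) * (‖w 0‖ + η * t))
        (nhdsWithin K (Set.Ioi K)) (nhds (Real.exp (K * t) * (‖w 0‖ + η * t))) := by
      refine Filter.Tendsto.mono_left ?_ nhdsWithin_le_nhds
      exact Continuous.tendsto (by fun_prop) K
    exact ge_of_tendsto hlim (Filter.eventually_of_mem self_mem_nhdsWithin fun K' h => hK2 K' h)
  rcases le_total 0 t with h | h
  · rw [abs_of_nonneg h] at ht ⊢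
    exact main w w' (fun s h0 h1 => hw s (by rwa [abs_of_nonneg h0]))
      (fun s h0 h1 => hb s (by rwa [abs_of_nonneg h0])) t h ht
  · rw [abs_of_nonpos h] at ht ⊢
    have := main (fun s => w (-s)) (fun s => -w' (-s)) (fun s h0 h1 => ?_) (fun s h0 h1 => ?_)
      (-t) (by linarith) ht
    · simpa using this
    · have := (hw (-s) (by rwa [abs_neg, abs_of_nonneg h0])).scomp s (hasDerivAt_neg s)
      simpa [Function.comp_def] using this
    · simpa using hb (-s) (by rwa [abs_neg, abs_of_nonneg h0])

/-- Integration of `exp (K |s|)` gains the factor `1 / K`. With the rate `2 K` this beats a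
Lipschitz constant `K`, so the Picard map halves distances in the exponentially weighted norm, on
the whole time axis at once. -/
theorem norm_intervalIntegral_le_of_norm_le_exp {E : Type*} [NormedAddCommGroup E]
    [NormedSpace ℝ E] {h : ℝ → E} {a K : ℝ} (hK : 0 < K) (ha : 0 ≤ a)
    (hh : ∀ s, ‖h s‖ ≤ a * Real.exp (K * |s|)) (t : ℝ) :
    ‖∫ s in (0 : ℝ)..t, h s‖ ≤ a / K * Real.exp (K * |t|) := by
  have main : ∀ h : ℝ → E, (∀ s, ‖h s‖ ≤ a * Real.exp (K * |s|)) → ∀ t, 0 ≤ t →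
      ‖∫ s in (0 : ℝ)..t, h s‖ ≤ a / K * Real.exp (K * t) := by
    intro h hh t ht
    have h1 : ‖∫ s in (0 : ℝ)..t, h s‖ ≤ ∫ s in (0 : ℝ)..t, a * Real.exp (K * s) := by
      refine intervalIntegral.norm_integral_le_of_norm_le ht ?_ ?_
      · filter_upwards with s hs
        simpa [abs_of_pos hs.1] using hh s
      · exact Continuous.intervalIntegrable (by fun_prop) _ _
    refine h1.trans ?_
    have h2 : ∀ s ∈ Set.uIcc 0 t, HasDerivAt (fun s => a / K * Real.exp (K * s))
        (a * Real.exp (K * s)) s := by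
      intro s _
      have := (((hasDerivAt_id s).const_mul K).exp).const_mul (a / K)
      refine this.congr_deriv ?_
      simp only [id]
      field_simp
    rw [intervalIntegral.integral_eq_sub_of_hasDerivAt h2
      (Continuous.intervalIntegrable (by fun_prop) _ _)]
    have : 0 ≤ a / K * Real.exp (K * 0) := by positivity
    linarith
  rcases le_total 0 t with ht | ht
  · rw [abs_of_nonneg ht]; exact main h hh t ht
  · rw [abs_of_nonpos ht]
    have := main (fun s => h (-s)) (fun s => by simpa using hh (-s)) (-t) (by linarith)
    rw [intervalIntegral.integral_comp_neg] at this
    rw [intervalIntegral.integral_symm, norm_neg]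
    simpa using this

/-- Global existence for ordinary differential equations with a Lipschitz right hand side. -/
theorem exists_hasDerivAt_of_lipschitz {E : Type*} [NormedAddCommGroup E] [NormedSpace ℝ E]
    [CompleteSpace E] (V : ℝ → E → E) (K M : ℝ) (hK : 0 < K) (x₀ : E)
    (hlip : ∀ t x y, ‖V t x - V t y‖ ≤ K * ‖x - y‖) (hcont : Continuous (Function.uncurry V))
    (hM : ∀ t, ‖V t x₀‖ ≤ M) :
    ∃ u : ℝ → E, u 0 = x₀ ∧ ∀ t, HasDerivAt u (V t (u t)) t := by
  have hM0 : 0 ≤ M := (norm_nonneg _).trans (hM 0)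
  suffices hex : ∃ u : ℝ → E, Continuous u ∧
      (fun t => x₀ + ∫ s in (0 : ℝ)..t, V s (u s)) = u ∧
      ∀ t, ‖u t - x₀‖ ≤ 2 * (M / (2 * K)) * Real.exp (2 * K * |t|) by
    obtain ⟨u, hu, hfix, -⟩ := hex
    refine ⟨u, ?_, fun t => ?_⟩
    · rw [← hfix]; simp
    · have h1 : Continuous fun s => V s (u s) := hcont.comp (continuous_id.prodMk hu)
      have h2 := (h1.integral_hasStrictDerivAt 0 t).hasDerivAt.const_add x₀
      have h3 : u = fun t => x₀ + ∫ s in (0 : ℝ)..t, V s (u s) := hfix.symm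
      rw [← h3] at h2
      exact h2
  -- The weight `exp (2 K |t|)` turns the Lipschitz constant `K` into the contraction factor `K / (2
  -- K)`. The closed property carried along is continuity, which makes the integrals meaningful and
  -- survives locally uniform limits.
  refine exists_fixedPoint_weighted (ι := ℝ) (Z := E) (fun z => ‖z‖)
    norm_add_le continuous_norm 1 one_pos (fun z => by simp) norm_zero norm_neg
    (fun t => Real.exp (2 * K * |t|)) (fun t => (Real.exp_pos _).le) Continuous
    (fun u t => x₀ + ∫ s in (0 : ℝ)..t, V s (u s)) (fun _ => x₀) (M / (2 * K)) (by positivity)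
    continuous_const ?_ ?_ ?_ ?_
  · intro u hu
    have h1 : Continuous fun s => V s (u s) := hcont.comp (continuous_id.prodMk hu)
    exact continuous_const.add
      (intervalIntegral.continuous_primitive (fun a b => h1.intervalIntegrable a b) 0)
  · intro s u hs hsu
    have : TendstoLocallyUniformly s u Filter.atTop := by
      rw [Metric.tendstoLocallyUniformly_iff]
      intro ε hε x
      refine ⟨Metric.ball x 1, Metric.ball_mem_nhds x one_pos, ?_⟩
      have h1 : Filter.Tendsto (fun n : ℕ => (2 * (M / (2 * K)) / 1) * (1 / 2 : ℝ) ^ n *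
          Real.exp (2 * K * (|x| + 1))) Filter.atTop (nhds 0) := by
        have := ((tendsto_pow_atTop_nhds_zero_of_lt_one (r := (1 / 2 : ℝ)) (by norm_num)
          (by norm_num)).const_mul (2 * (M / (2 * K)) / 1)).mul_const
            (Real.exp (2 * K * (|x| + 1)))
        simpa using this
      filter_upwards [h1.eventually (gt_mem_nhds hε)] with n hn y hy
      rw [dist_comm, dist_eq_norm]
      refine ((hsu n y).trans ?_).trans_lt hn
      refine mul_le_mul_of_nonneg_left (Real.exp_le_exp.mpr ?_) (by positivity)
      refine mul_le_mul_of_nonneg_left ?_ (by positivity)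
      have h2 : |y - x| < 1 := by simpa [Real.dist_eq] using hy
      have h3 := abs_sub_abs_le_abs_sub y x
      linarith
    exact this.continuous (Filter.Frequently.of_forall hs)
  · intro t
    have := norm_intervalIntegral_le_of_norm_le_exp (h := fun s => V s x₀) (a := M)
      (K := 2 * K) (by positivity) hM0 (fun s => (hM s).trans (le_mul_of_one_le_right hM0
        (Real.one_le_exp (by positivity)))) t
    simpa using this
  · intro u v hu hv _ _ d hd huv t
    have h1 : Continuous fun s => V s (u s) := hcont.comp (continuous_id.prodMk hu)
    have h2 : Continuous fun s => V s (v s) := hcont.comp (continuous_id.prodMk hv)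
    have := norm_intervalIntegral_le_of_norm_le_exp (h := fun s => V s (u s) - V s (v s))
      (a := K * d) (K := 2 * K) (by positivity) (by positivity) (fun s => (hlip s _ _).trans
        (by rw [mul_assoc]; exact mul_le_mul_of_nonneg_left (huv s) hK.le)) t
    rw [intervalIntegral.integral_sub (h1.intervalIntegrable _ _) (h2.intervalIntegrable _ _)]
      at this
    simp only [add_sub_add_left_eq_sub]
    refine this.trans (le_of_eq ?_)
    field_simp

theorem hasDerivAt_unique_of_lipschitz {E : Type*} [NormedAddCommGroup E] [NormedSpace ℝ E]
    {V : ℝ → E → E} {K : ℝ} (hK : 0 ≤ K) (hlip : ∀ t x y, ‖V t x - V t y‖ ≤ K * ‖x - y‖)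
    {u v : ℝ → E} (hu : ∀ t, HasDerivAt u (V t (u t)) t) (hv : ∀ t, HasDerivAt v (V t (v t)) t)
    (h0 : u 0 = v 0) : u = v := by
  funext t
  have := norm_le_exp_mul_of_norm_deriv_le (w := fun t => u t - v t) (K := K) (η := 0) (τ := |t|)
    hK le_rfl (fun t _ => (hu t).sub (hv t)) (fun t _ => by simpa using hlip t _ _) le_rfl
  simpa [h0, sub_eq_zero] using this

end LDS


/-! ### Global flows, and the lattice equation as a Lipschitz equation on a Banach space. -/

namespace LDS

/-- `φ` is the flow of the Lipschitz vector field `V`. -/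
structure IsGlobalFlow {E : Type*} [NormedAddCommGroup E] [NormedSpace ℝ E] (V : E → E) (K : ℝ)
    (φ : ℝ → E → E) : Prop where
  zero : ∀ x, φ 0 x = x
  deriv : ∀ x t, HasDerivAt (fun t => φ t x) (V (φ t x)) t
  add : ∀ s t x, φ (s + t) x = φ s (φ t x)
  lip : ∀ t x y, ‖φ t x - φ t y‖ ≤ Real.exp (K * |t|) * ‖x - y‖
  unique : ∀ u : ℝ → E, (∀ t, HasDerivAt u (V (u t)) t) → ∀ t, u t = φ t (u 0)

theorem exists_isGlobalFlow {E : Type*} [NormedAddCommGroup E] [NormedSpace ℝ E]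
    [CompleteSpace E] (V : E → E) (K : ℝ) (hK : 0 < K)
    (hlip : ∀ x y, ‖V x - V y‖ ≤ K * ‖x - y‖) : ∃ φ : ℝ → E → E, IsGlobalFlow V K φ := by
  have hVc : Continuous V :=
    (LipschitzWith.of_dist_le_mul (K := ⟨K, hK.le⟩) fun x y => by
      rw [dist_eq_norm, dist_eq_norm]; exact hlip x y).continuous
  choose u hu0 hu using fun x₀ => exists_hasDerivAt_of_lipschitz (fun _ => V) K ‖V x₀‖ hK x₀
    (fun _ => hlip) (hVc.comp continuous_snd) (fun _ => le_rfl)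
  have huniq : ∀ w : ℝ → E, (∀ t, HasDerivAt w (V (w t)) t) → ∀ t, w t = u (w 0) t := by
    intro w hw t
    exact congrFun (hasDerivAt_unique_of_lipschitz (V := fun _ => V) hK.le (fun _ => hlip) hw
      (hu (w 0)) (hu0 _).symm) t
  refine ⟨fun t x => u x t, fun x => hu0 x, hu, fun s t x => ?_, fun t x y => ?_, huniq⟩
  · have h1 : ∀ r, HasDerivAt (fun r => u x (r + t)) (V (u x (r + t))) r := fun r => by
      have := (hu x (r + t)).scomp r ((hasDerivAt_id r).add_const t)
      simpa [Function.comp_def] using this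
    have := huniq _ h1 s
    simpa using this
  · have := norm_le_exp_mul_of_norm_deriv_le (w := fun t => u x t - u y t) (K := K) (η := 0)
      (τ := |t|) hK.le le_rfl (fun t _ => (hu x t).sub (hu y t))
      (fun t _ => by simpa using hlip _ _) le_rfl
    simpa [hu0] using this

namespace IsGlobalFlow

variable {E : Type*} [NormedAddCommGroup E] [NormedSpace ℝ E] {V : E → E} {K : ℝ}
  {φ : ℝ → E → E}

theorem neg_apply (h : IsGlobalFlow V K φ) (t : ℝ) (x : E) : φ (-t) (φ t x) = x := by
  rw [← h.add, neg_add_cancel, h.zero]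

theorem apply_neg (h : IsGlobalFlow V K φ) (t : ℝ) (x : E) : φ t (φ (-t) x) = x := by
  rw [← h.add, add_neg_cancel, h.zero]

theorem continuous_right (h : IsGlobalFlow V K φ) (t : ℝ) : Continuous (φ t) :=
  (LipschitzWith.of_dist_le_mul (K := ⟨Real.exp (K * |t|), (Real.exp_pos _).le⟩) fun x y => by
      rw [dist_eq_norm, dist_eq_norm]; exact h.lip t x y).continuous

theorem continuous_left (h : IsGlobalFlow V K φ) (x : E) : Continuous fun t => φ t x :=
  continuous_iff_continuousAt.mpr fun t => (h.deriv x t).continuousAt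

end IsGlobalFlow

/-- Continuously differentiable, with a derivative that is bounded by `L` and uniformly
continuous. -/
structure IsC1Lip {E E' : Type*} [NormedAddCommGroup E] [NormedSpace ℝ E]
    [NormedAddCommGroup E'] [NormedSpace ℝ E'] (f : E → E') (L : ℝ) : Prop where
  diff : Differentiable ℝ f
  bound : ∀ x, ‖fderiv ℝ f x‖ ≤ L
  uc : UniformContinuous (fderiv ℝ f)

theorem IsC1Lip.lip {E E' : Type*} [NormedAddCommGroup E] [NormedSpace ℝ E]
    [NormedAddCommGroup E'] [NormedSpace ℝ E'] {f : E → E'} {L : ℝ} (h : IsC1Lip f L) (x y : E) :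
    ‖f x - f y‖ ≤ L * ‖x - y‖ :=
  convex_univ.norm_image_sub_le_of_norm_fderiv_le (fun x _ => h.diff x) (fun x _ => h.bound x)
    (Set.mem_univ y) (Set.mem_univ x)

theorem IsC1Lip.mono {E E' : Type*} [NormedAddCommGroup E] [NormedSpace ℝ E]
    [NormedAddCommGroup E'] [NormedSpace ℝ E'] {f : E → E'} {L L' : ℝ} (h : IsC1Lip f L)
    (hL : L ≤ L') : IsC1Lip f L' :=
  ⟨h.diff, fun x => (h.bound x).trans hL, h.uc⟩

/-- Only first derivatives enter the proof: of `f` and `g` a Lipschitz bound and a uniformly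
continuous derivative, of the coupling terms a Lipschitz bound and boundedness. -/
theorem HasBoundedDerivs.exists_isC1Lip {E E' : Type} [NormedAddCommGroup E] [NormedSpace ℝ E]
    [NormedAddCommGroup E'] [NormedSpace ℝ E'] {f : E → E'} {r : ℕ} (hr : 1 ≤ r)
    (hf : HasBoundedDerivs r f) : ∃ L, IsC1Lip f L := by
  obtain ⟨hc, hd⟩ := hf
  obtain ⟨huc, C, hC⟩ := hd 1 le_rfl hr
  refine ⟨C, hc.differentiable (by positivity), fun x => by simpa using hC x, ?_⟩
  rw [Metric.uniformContinuous_iff] at huc ⊢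
  intro ε hε
  obtain ⟨δ, hδ, h⟩ := huc (ε / 2) (half_pos hε)
  refine ⟨δ, hδ, fun {a b} hab => ?_⟩
  have h1 := h hab
  rw [dist_eq_norm] at h1 ⊢
  refine (ContinuousLinearMap.opNorm_le_bound _ (half_pos hε).le fun v => ?_).trans_lt
    (half_lt_self hε)
  have h2 := (iteratedFDeriv ℝ 1 f a - iteratedFDeriv ℝ 1 f b).le_opNorm (fun _ => v)
  simp only [sub_apply, iteratedFDeriv_one_apply, Finset.univ_unique,
    Finset.prod_const, Finset.card_singleton, pow_one] at h2
  rw [sub_apply]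
  exact h2.trans (mul_le_mul_of_nonneg_right h1.le (norm_nonneg _))

theorem IsCrBoundedBy.lip {E E' : Type} [NormedAddCommGroup E] [NormedSpace ℝ E]
    [NormedAddCommGroup E'] [NormedSpace ℝ E'] {f : E → E'} {r : ℕ} {C : ℝ} (hr : 1 ≤ r)
    (hf : IsCrBoundedBy r C f) (x y : E) : ‖f x - f y‖ ≤ C * ‖x - y‖ :=
  convex_univ.norm_image_sub_le_of_norm_fderiv_le
    (fun x _ => (hf.1.differentiable (by positivity)) x)
    (fun x _ => by simpa using (hf.2 1 hr).2 x) (Set.mem_univ y) (Set.mem_univ x)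

theorem IsCrBoundedBy.norm_le {E E' : Type} [NormedAddCommGroup E] [NormedSpace ℝ E]
    [NormedAddCommGroup E'] [NormedSpace ℝ E'] {f : E → E'} {r : ℕ} {C : ℝ}
    (hf : IsCrBoundedBy r C f) (x : E) : ‖f x‖ ≤ C := by
  simpa using (hf.2 0 (Nat.zero_le _)).2 x

section Sequences

variable {E E' : Type} [NormedAddCommGroup E] [NormedAddCommGroup E']

open Classical in
/-- The bounded sequence with the given entries (`0` for an unbounded family). -/
noncomputable def seqOf (h : ℤ → E) : LInf E :=
  if hb : BddAbove (Set.range fun k => ‖h k‖) then ⟨h, memℓp_infty hb⟩ else 0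

theorem seqOf_apply {h : ℤ → E} {C : ℝ} (hC : ∀ k, ‖h k‖ ≤ C) (k : ℤ) : seqOf h k = h k := by
  have hb : BddAbove (Set.range fun k => ‖h k‖) := ⟨C, by rintro _ ⟨k, rfl⟩; exact hC k⟩
  rw [seqOf, dif_pos hb]

theorem LInf.norm_le {a : LInf E} {C : ℝ} (h : ∀ k, ‖a k‖ ≤ C) : ‖a‖ ≤ C :=
  lp.norm_le_of_forall_le' C h

theorem LInf.apply_le (a : LInf E) (k : ℤ) : ‖a k‖ ≤ ‖a‖ :=
  lp.norm_apply_le_norm (by simp) a k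

/-- The Nemytskii operator of `f`. -/
noncomputable def nemytskii (f : E → E') (y : LInf E) : LInf E' := seqOf fun k => f (y k)

/-- A Lipschitz map grows at most linearly, so it sends bounded sequences to bounded ones and the
default value in `seqOf` does not occur. -/
theorem nemytskii_apply {f : E → E'} {L : ℝ} (hL : 0 ≤ L)
    (hf : ∀ x y, ‖f x - f y‖ ≤ L * ‖x - y‖) (y : LInf E) (k : ℤ) :
    nemytskii f y k = f (y k) := by
  refine seqOf_apply (C := ‖f 0‖ + L * ‖y‖) (fun k => ?_) k
  have h1 := hf (y k) 0
  have h2 := norm_le_norm_add_norm_sub' (f (y k)) (f 0)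
  rw [sub_zero] at h1
  have := mul_le_mul_of_nonneg_left (LInf.apply_le y k) hL
  linarith

end Sequences

section Lattice

variable {n m : ℕ}

/-- The vector field of the coupled lattice system. -/
noncomputable def latticeField (f : Vec n → Vec n) (g : Vec n → Vec m) (ε : ℝ)
    (F : LInf (Vec n) × LInf (Vec m) → LInf (Vec n))
    (G : LInf (Vec n) × LInf (Vec m) → LInf (Vec m))
    (z : LInf (Vec n) × LInf (Vec m)) : LInf (Vec n) × LInf (Vec m) :=
  (nemytskii f z.1 + ε • F z, nemytskii g z.1 + ε • G z)

/-- `Φ` is the flow of a coupled lattice system with data bounded by `L`. -/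
structure IsLatticeFlow (f : Vec n → Vec n) (g : Vec n → Vec m) (L ε : ℝ)
    (F : LInf (Vec n) × LInf (Vec m) → LInf (Vec n))
    (G : LInf (Vec n) × LInf (Vec m) → LInf (Vec m))
    (Φ : ℝ → LInf (Vec n) × LInf (Vec m) → LInf (Vec n) × LInf (Vec m)) : Prop where
  one_le : 1 ≤ L
  hf : IsC1Lip f L
  hg : IsC1Lip g L
  Flip : ∀ z z', ‖F z - F z'‖ ≤ L * ‖z - z'‖
  Glip : ∀ z z', ‖G z - G z'‖ ≤ L * ‖z - z'‖
  Fbd : ∀ z, ‖F z‖ ≤ L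
  Gbd : ∀ z, ‖G z‖ ≤ L
  flow : IsGlobalFlow (latticeField f g ε F G) (2 * L) Φ

/-- The Lipschitz constant `2 * L` consists of `L` for the uncoupled part and `|ε| L ≤ L` for the
coupling. -/
theorem exists_isLatticeFlow {f : Vec n → Vec n} {g : Vec n → Vec m} {L ε : ℝ}
    {F : LInf (Vec n) × LInf (Vec m) → LInf (Vec n)}
    {G : LInf (Vec n) × LInf (Vec m) → LInf (Vec m)} (hL : 1 ≤ L) (hf : IsC1Lip f L)
    (hg : IsC1Lip g L) (hε : |ε| ≤ 1)
    (Flip : ∀ z z', ‖F z - F z'‖ ≤ L * ‖z - z'‖)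
    (Glip : ∀ z z', ‖G z - G z'‖ ≤ L * ‖z - z'‖)
    (Fbd : ∀ z, ‖F z‖ ≤ L) (Gbd : ∀ z, ‖G z‖ ≤ L) : ∃ Φ, IsLatticeFlow f g L ε F G Φ := by
  have hL0 : 0 ≤ L := by linarith
  have key : ∀ {l : ℕ} (h : Vec n → Vec l) (H : LInf (Vec n) × LInf (Vec m) → LInf (Vec l)),
      IsC1Lip h L → (∀ z z', ‖H z - H z'‖ ≤ L * ‖z - z'‖) →
      ∀ z z', ‖(nemytskii h z.1 + ε • H z) - (nemytskii h z'.1 + ε • H z')‖ ≤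
        2 * L * ‖z - z'‖ := by
    intro l h H hh hH z z'
    have h1 : ‖nemytskii h z.1 - nemytskii h z'.1‖ ≤ L * ‖z - z'‖ := by
      refine LInf.norm_le fun k => ?_
      rw [lp.coeFn_sub, Pi.sub_apply, nemytskii_apply hL0 hh.lip, nemytskii_apply hL0 hh.lip]
      refine (hh.lip _ _).trans (mul_le_mul_of_nonneg_left ?_ hL0)
      exact (LInf.apply_le (z.1 - z'.1) k).trans (norm_fst_le (z - z'))
    have h2 : ‖ε • (H z - H z')‖ ≤ L * ‖z - z'‖ := by
      rw [norm_smul, Real.norm_eq_abs]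
      exact (mul_le_of_le_one_left (norm_nonneg _) hε).trans (hH z z')
    calc _ = ‖(nemytskii h z.1 - nemytskii h z'.1) + ε • (H z - H z')‖ := by
            congr 1; rw [smul_sub]; abel
      _ ≤ _ := (norm_add_le _ _).trans (by linarith)
  obtain ⟨Φ, hΦ⟩ := exists_isGlobalFlow (latticeField f g ε F G) (2 * L) (by positivity)
    (fun z z' => by
      rw [Prod.norm_def]
      exact max_le (key f F hf Flip z z') (key g G hg Glip z z'))
  exact ⟨Φ, hL, hf, hg, Flip, Glip, Fbd, Gbd, hΦ⟩

namespace IsLatticeFlow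

variable {f : Vec n → Vec n} {g : Vec n → Vec m} {L ε : ℝ}
    {F : LInf (Vec n) × LInf (Vec m) → LInf (Vec n)}
    {G : LInf (Vec n) × LInf (Vec m) → LInf (Vec m)}
    {Φ : ℝ → LInf (Vec n) × LInf (Vec m) → LInf (Vec n) × LInf (Vec m)}

theorem hasDerivAt_fst (h : IsLatticeFlow f g L ε F G Φ) (z : LInf (Vec n) × LInf (Vec m)) (k : ℤ)
    (t : ℝ) :
    HasDerivAt (fun t => (Φ t z).1 k) (f ((Φ t z).1 k) + ε • F (Φ t z) k) t := by
  have h1 := ((lp.evalCLM ℝ (fun _ : ℤ => Vec n) ∞ k).comp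
    (ContinuousLinearMap.fst ℝ (LInf (Vec n)) (LInf (Vec m)))).hasFDerivAt.comp_hasDerivAt t
      (h.flow.deriv z t)
  refine h1.congr_deriv ?_
  change (nemytskii f (Φ t z).1 + ε • F (Φ t z)) k = _
  rw [lp.coeFn_add, Pi.add_apply, nemytskii_apply (by linarith [h.one_le]) h.hf.lip]
  rfl

theorem hasDerivAt_snd (h : IsLatticeFlow f g L ε F G Φ) (z : LInf (Vec n) × LInf (Vec m)) (k : ℤ)
    (t : ℝ) :
    HasDerivAt (fun t => (Φ t z).2 k) (g ((Φ t z).1 k) + ε • G (Φ t z) k) t := by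
  have h1 := ((lp.evalCLM ℝ (fun _ : ℤ => Vec m) ∞ k).comp
    (ContinuousLinearMap.snd ℝ (LInf (Vec n)) (LInf (Vec m)))).hasFDerivAt.comp_hasDerivAt t
      (h.flow.deriv z t)
  refine h1.congr_deriv ?_
  change (nemytskii g (Φ t z).1 + ε • G (Φ t z)) k = _
  rw [lp.coeFn_add, Pi.add_apply, nemytskii_apply (by linarith [h.one_le]) h.hg.lip]
  rfl

theorem isLatticeSolution (h : IsLatticeFlow f g L ε F G Φ) (z : LInf (Vec n) × LInf (Vec m)) :
    IsLatticeSolution f g ε F G (fun t => (Φ t z).1) (fun t => (Φ t z).2) := by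
  have h1 : ∀ t, HasDerivAt (fun t => (Φ t z).1) (latticeField f g ε F G (Φ t z)).1 t := fun t =>
    (ContinuousLinearMap.fst ℝ (LInf (Vec n)) (LInf (Vec m))).hasFDerivAt.comp_hasDerivAt t
      (h.flow.deriv z t)
  have h2 : ∀ t, HasDerivAt (fun t => (Φ t z).2) (latticeField f g ε F G (Φ t z)).2 t := fun t =>
    (ContinuousLinearMap.snd ℝ (LInf (Vec n)) (LInf (Vec m))).hasFDerivAt.comp_hasDerivAt t
      (h.flow.deriv z t)
  refine ⟨fun t => (h1 t).differentiableAt, fun t => (h2 t).differentiableAt, fun t k => ?_⟩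
  rw [(h1 t).deriv, (h2 t).deriv]
  have hL0 : 0 ≤ L := by linarith [h.one_le]
  constructor
  · change (nemytskii f (Φ t z).1 + ε • F (Φ t z)) k = _
    rw [lp.coeFn_add, Pi.add_apply, nemytskii_apply hL0 h.hf.lip]
    rfl
  · change (nemytskii g (Φ t z).1 + ε • G (Φ t z)) k = _
    rw [lp.coeFn_add, Pi.add_apply, nemytskii_apply hL0 h.hg.lip]
    rfl

end IsLatticeFlow

end Lattice

end LDS


/-! ### The linearized equation, and finite-time estimates for the coupled flow. -/

namespace LDS

section Linearized

variable {n : ℕ} {f : Vec n → Vec n} {L : ℝ} {y : ℝ → Vec n}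

theorem exists_isLinearizedSolution (hf : IsC1Lip f L) (hL : 0 < L) (hy : Continuous y)
    (v₀ : Vec n) : ∃ v, v 0 = v₀ ∧ IsLinearizedSolution f y v := by
  refine exists_hasDerivAt_of_lipschitz (fun t v => fderiv ℝ f (y t) v) L (L * ‖v₀‖) hL v₀
    (fun t v w => ?_) ?_ (fun t => ?_)
  · rw [← map_sub]
    exact (ContinuousLinearMap.le_opNorm _ _).trans
      (mul_le_mul_of_nonneg_right (hf.bound _) (norm_nonneg _))
  · exact ((hf.uc.continuous.comp hy).comp continuous_fst).clm_apply continuous_snd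
  · exact (ContinuousLinearMap.le_opNorm _ _).trans
      (mul_le_mul_of_nonneg_right (hf.bound _) (norm_nonneg _))

namespace IsLinearizedSolution

variable {v : ℝ → Vec n}

theorem norm_le (hf : IsC1Lip f L) (hL : 0 ≤ L) (hv : IsLinearizedSolution f y v) (t : ℝ) :
    ‖v t‖ ≤ Real.exp (L * |t|) * ‖v 0‖ := by
  have := norm_le_exp_mul_of_norm_deriv_le (w := v) (K := L) (η := 0) (τ := |t|) hL le_rfl
    (fun t _ => hv t) (fun t _ => by
      simpa using (ContinuousLinearMap.le_opNorm _ _).trans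
        (mul_le_mul_of_nonneg_right (hf.bound (y t)) (norm_nonneg (v t)))) le_rfl
  simpa using this

theorem shift (hv : IsLinearizedSolution f y v) (s : ℝ) :
    IsLinearizedSolution f (fun t => y (t + s)) (fun t => v (t + s)) := fun t => by
  have := (hv (t + s)).scomp t ((hasDerivAt_id t).add_const s)
  simpa [Function.comp_def] using this

theorem norm_zero_le (hf : IsC1Lip f L) (hL : 0 ≤ L) (hv : IsLinearizedSolution f y v) (t : ℝ) :
    ‖v 0‖ ≤ Real.exp (L * |t|) * ‖v t‖ := by
  simpa using (hv.shift t).norm_le hf hL (-t)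

theorem add {v' : ℝ → Vec n} (hv : IsLinearizedSolution f y v)
    (hv' : IsLinearizedSolution f y v') :
    IsLinearizedSolution f y (fun t => v t + v' t) := fun t => by
  exact ((hv t).add (hv' t)).congr_deriv (map_add _ _ _).symm

theorem unique {v' : ℝ → Vec n} (hf : IsC1Lip f L) (hL : 0 ≤ L)
    (hv : IsLinearizedSolution f y v)
    (hv' : IsLinearizedSolution f y v') (h0 : v 0 = v' 0) : v = v' :=
  hasDerivAt_unique_of_lipschitz (V := fun t v => fderiv ℝ f (y t) v) hL (fun t v w => by
    rw [← map_sub]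
    exact (ContinuousLinearMap.le_opNorm _ _).trans
      (mul_le_mul_of_nonneg_right (hf.bound _) (norm_nonneg _))) hv hv' h0

end IsLinearizedSolution

/-- The vector field solves the equation linearized about an orbit. -/
theorem isLinearizedSolution_field (hf : IsC1Lip f L) (hy : IsOrbit f y) (a : ℝ) :
    IsLinearizedSolution f y (fun t => a • f (y t)) := fun t => by
  have := ((hf.diff (y t)).hasFDerivAt.comp_hasDerivAt t (hy t)).const_smul a
  exact this.congr_deriv (map_smul _ _ _).symm

/-- Mean value inequality for `f - f'(x)` on a ball around `x`. Uniform continuity of the derivative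
makes the radius independent of `x`. -/
theorem IsC1Lip.linear_approx {E E' : Type*} [NormedAddCommGroup E] [NormedSpace ℝ E]
    [NormedAddCommGroup E'] [NormedSpace ℝ E'] {f : E → E'} {L : ℝ} (hf : IsC1Lip f L) {ω : ℝ}
    (hω : 0 < ω) :
    ∃ r > 0, ∀ x y y', ‖y - x‖ ≤ r → ‖y' - x‖ ≤ r →
      ‖f y - f y' - fderiv ℝ f x (y - y')‖ ≤ ω * ‖y - y'‖ := by
  obtain ⟨r, hr, h⟩ := Metric.uniformContinuous_iff.mp hf.uc ω hω
  refine ⟨r / 2, half_pos hr, fun x y y' hy hy' => ?_⟩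
  refine (convex_closedBall x (r / 2)).norm_image_sub_le_of_norm_fderiv_le'
    (fun z _ => hf.diff z) (fun z hz => ?_) (by simpa [dist_eq_norm] using hy')
    (by simpa [dist_eq_norm] using hy)
  have : dist z x < r := by
    have := Metric.mem_closedBall.mp hz
    linarith
  simpa [dist_eq_norm] using (h this).le

end Linearized

section StepEstimates

variable {n m : ℕ} {f : Vec n → Vec n} {g : Vec n → Vec m} {L : ℝ} {ψ : ℝ → Vec n → Vec n}

/-- For a single site the coupling is a forcing term of size at most `|ε| L`, whatever the other
sites do; Gronwall's inequality does the rest. -/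
theorem IsLatticeFlow.dist_base_le {ε : ℝ}
    {F : LInf (Vec n) × LInf (Vec m) → LInf (Vec n)}
    {G : LInf (Vec n) × LInf (Vec m) → LInf (Vec m)}
    {Φ : ℝ → LInf (Vec n) × LInf (Vec m) → LInf (Vec n) × LInf (Vec m)}
    (h : IsLatticeFlow f g L ε F G Φ) (hψ : IsGlobalFlow f L ψ)
    (z : LInf (Vec n) × LInf (Vec m)) (k : ℤ) (x : Vec n) (t : ℝ) :
    ‖(Φ t z).1 k - ψ t x‖ ≤ Real.exp (L * |t|) * (‖z.1 k - x‖ + |ε| * L * |t|) := by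
  have hL := h.one_le
  have := norm_le_exp_mul_of_norm_deriv_le (w := fun t => (Φ t z).1 k - ψ t x) (K := L)
    (η := |ε| * L) (τ := |t|) (by linarith) (by positivity)
    (fun t _ => (h.hasDerivAt_fst z k t).sub (hψ.deriv x t)) (fun t _ => ?_) le_rfl
  · simpa [h.flow.zero, hψ.zero] using this
  · have h1 := h.hf.lip ((Φ t z).1 k) (ψ t x)
    have h2 : ‖ε • F (Φ t z) k‖ ≤ |ε| * L := by
      rw [norm_smul, Real.norm_eq_abs]
      exact mul_le_mul_of_nonneg_left ((LInf.apply_le _ k).trans (h.Fbd _)) (abs_nonneg _)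
    rw [add_sub_right_comm]
    exact (norm_add_le _ _).trans (by linarith)

/-- The difference of two lattice orbits is compared, site by site, with the linearized flow along
an uncoupled orbit. Differences of `p` may be as large as `D / κ`, but they act on `y` only through
the coupling, so `ε` small relative to `κ` makes their effect negligible compared with `D`.
Conversely `p` is driven by `y`, and the difference of its increments is bounded by a fixed multiple
of `D`. -/
theorem lattice_diff (hL : 1 ≤ L) (hf : IsC1Lip f L) (hψ : IsGlobalFlow f L ψ)
    {τ κ η : ℝ} (hτ : 0 < τ) (hκ : 0 < κ) (hκ1 : κ ≤ 1) (hη : 0 < η) :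
    ∃ ρ > 0, ∃ ε₀ > 0, ∀ ε F G Φ, |ε| ≤ ε₀ → IsLatticeFlow f g L ε F G Φ →
      ∀ (D : ℝ) (z z' : LInf (Vec n) × LInf (Vec m)) (x : ℤ → Vec n), 0 ≤ D →
      (∀ k, ‖z.1 k - x k‖ ≤ ρ) → (∀ k, ‖z'.1 k - x k‖ ≤ ρ) →
      (∀ k, ‖z.1 k - z'.1 k‖ ≤ D) → (∀ k, ‖z.2 k - z'.2 k‖ ≤ D / κ) →
      ∀ k t, |t| ≤ τ →
        (∀ v, IsLinearizedSolution f (fun t => ψ t (x k)) v → v 0 = z.1 k - z'.1 k →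
          ‖(Φ t z).1 k - (Φ t z').1 k - v t‖ ≤ η * D) ∧
        ‖((Φ t z).2 k - (Φ t z').2 k) - (z.2 k - z'.2 k)‖ ≤
          3 * L * Real.exp (L * τ) * τ * D := by
  have hL0 : 0 < L := by linarith
  set e := Real.exp (L * τ) with he
  have he1 : 1 ≤ e := Real.one_le_exp (by positivity)
  set ω := η / (4 * e * e * τ) with hω
  obtain ⟨r, hr, happ⟩ := hf.linear_approx (ω := ω) (by positivity)
  set M := L * Real.exp (2 * L * τ) / κ with hM
  have hMpos : 0 < M := by positivity
  have hMκ : L ≤ M := by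
    rw [hM, le_div_iff₀ hκ]
    have : 1 ≤ Real.exp (2 * L * τ) := Real.one_le_exp (by positivity)
    nlinarith
  -- With the four bounds on `ε`, in this order: the `y`-differences stay below `2 e D`; the
  -- coupling term in `p` is dominated by the term coming from `g`; both orbits stay in the ball
  -- where the linear approximation holds; the coupling uses at most half of the error `η D`. The
  -- other half is left to nonlinearity by the choice of `ω`.
  refine ⟨r / (2 * e), by positivity,
    min (min (1 / (M * τ)) (1 / M)) (min (r / (2 * e * L * τ)) (η / (2 * e * τ * M))),
    by positivity, ?_⟩
  intro ε F G Φ hε h D z z' x hD hz hz' hy hp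
  have hε1 : |ε| * (M * τ) ≤ 1 := by
    rw [← le_div_iff₀ (by positivity)]; exact hε.trans ((min_le_left _ _).trans (min_le_left _ _))
  have hε2 : |ε| * M ≤ 1 := by
    rw [← le_div_iff₀ (by positivity)]; exact hε.trans ((min_le_left _ _).trans (min_le_right _ _))
  have hε3 : |ε| * (2 * e * L * τ) ≤ r := by
    rw [← le_div_iff₀ (by positivity)]; exact hε.trans ((min_le_right _ _).trans (min_le_left _ _))
  have hε4 : |ε| * (2 * e * τ * M) ≤ η := by
    rw [← le_div_iff₀ (by positivity)]
    exact hε.trans ((min_le_right _ _).trans (min_le_right _ _))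
  have hexp : ∀ t, |t| ≤ τ → Real.exp (L * |t|) ≤ e := fun t ht =>
    Real.exp_le_exp.mpr (mul_le_mul_of_nonneg_left ht hL0.le)
  have hzz : ‖z - z'‖ ≤ D / κ := by
    rw [Prod.norm_def]
    refine max_le (LInf.norm_le fun k => (hy k).trans ?_) (LInf.norm_le hp)
    rw [le_div_iff₀ hκ]; nlinarith
  have hΦ : ∀ t, |t| ≤ τ → L * ‖Φ t z - Φ t z'‖ ≤ M * D := by
    intro t ht
    have h1 := h.flow.lip t z z'
    have h2 : Real.exp (2 * L * |t|) ≤ Real.exp (2 * L * τ) :=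
      Real.exp_le_exp.mpr (mul_le_mul_of_nonneg_left ht (by positivity))
    have h3 : ‖Φ t z - Φ t z'‖ ≤ Real.exp (2 * L * τ) * (D / κ) :=
      h1.trans (mul_le_mul h2 hzz (norm_nonneg _) (Real.exp_pos _).le)
    calc L * ‖Φ t z - Φ t z'‖ ≤ L * (Real.exp (2 * L * τ) * (D / κ)) :=
          mul_le_mul_of_nonneg_left h3 hL0.le
      _ = M * D := by rw [hM]; ring
  have hF : ∀ k t, |t| ≤ τ → ‖ε • F (Φ t z) k - ε • F (Φ t z') k‖ ≤ |ε| * (M * D) := by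
    intro k t ht
    rw [← smul_sub, norm_smul, Real.norm_eq_abs]
    refine mul_le_mul_of_nonneg_left ?_ (abs_nonneg _)
    exact (LInf.apply_le (F (Φ t z) - F (Φ t z')) k).trans ((h.Flip _ _).trans (hΦ t ht))
  have hG : ∀ k t, |t| ≤ τ → ‖ε • G (Φ t z) k - ε • G (Φ t z') k‖ ≤ |ε| * (M * D) := by
    intro k t ht
    rw [← smul_sub, norm_smul, Real.norm_eq_abs]
    refine mul_le_mul_of_nonneg_left ?_ (abs_nonneg _)
    exact (LInf.apply_le (G (Φ t z) - G (Φ t z')) k).trans ((h.Glip _ _).trans (hΦ t ht))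
  have hδ : ∀ k t, |t| ≤ τ → ‖(Φ t z).1 k - (Φ t z').1 k‖ ≤ 2 * e * D := by
    intro k t ht
    have := norm_le_exp_mul_of_norm_deriv_le (w := fun t => (Φ t z).1 k - (Φ t z').1 k) (K := L)
      (η := |ε| * (M * D)) (τ := τ) hL0.le (by positivity)
      (fun t _ => (h.hasDerivAt_fst z k t).sub (h.hasDerivAt_fst z' k t)) (fun t ht => ?_) ht
    · simp only [h.flow.zero] at this
      refine this.trans ?_
      have h1 : |ε| * (M * D) * |t| ≤ D := by
        have : |ε| * (M * D) * |t| ≤ |ε| * (M * D) * τ :=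
          mul_le_mul_of_nonneg_left ht (by positivity)
        nlinarith
      have h2 := hy k
      calc _ ≤ e * (D + D) := mul_le_mul (hexp t ht) (by linarith) (by positivity) (by positivity)
        _ = _ := by ring
    · rw [add_sub_add_comm]
      refine (norm_add_le _ _).trans ?_
      have := hf.lip ((Φ t z).1 k) ((Φ t z').1 k)
      have := hF k t ht
      linarith
  have hball : ∀ z : LInf (Vec n) × LInf (Vec m), (∀ k, ‖z.1 k - x k‖ ≤ r / (2 * e)) →
      ∀ k t, |t| ≤ τ → ‖(Φ t z).1 k - ψ t (x k)‖ ≤ r := by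
    intro z hz k t ht
    refine (h.dist_base_le hψ z k (x k) t).trans ?_
    have h1 : |ε| * L * |t| ≤ |ε| * L * τ := mul_le_mul_of_nonneg_left ht (by positivity)
    have h2 : |ε| * L * τ ≤ r / (2 * e) := by
      rw [le_div_iff₀ (by positivity)]
      calc _ = |ε| * (2 * e * L * τ) := by ring
        _ ≤ r := hε3
    calc _ ≤ e * (r / (2 * e) + r / (2 * e)) :=
          mul_le_mul (hexp t ht) (add_le_add (hz k) (h1.trans h2)) (by positivity) (by positivity)
      _ = r := by field_simp; norm_num
  intro k t ht
  constructor
  · intro v hv hv0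
    have := norm_le_exp_mul_of_norm_deriv_le
      (w := fun t => (Φ t z).1 k - (Φ t z').1 k - v t) (K := L)
      (η := ω * (2 * e * D) + |ε| * (M * D)) (τ := τ) hL0.le (by positivity)
      (fun t _ => ((h.hasDerivAt_fst z k t).sub (h.hasDerivAt_fst z' k t)).sub (hv t))
      (fun t ht => ?_) ht
    · simp only [h.flow.zero, hv0, sub_self, norm_zero, zero_add] at this
      refine this.trans ?_
      calc _ ≤ e * ((ω * (2 * e * D) + |ε| * (M * D)) * τ) :=
            mul_le_mul (hexp t ht) (mul_le_mul_of_nonneg_left ht (by positivity)) (by positivity)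
              (by positivity)
        _ = η / 2 * D + |ε| * (2 * e * τ * M) / 2 * D := by
            rw [hω]; field_simp; ring
        _ ≤ η / 2 * D + η / 2 * D := by
            have := mul_le_mul_of_nonneg_right hε4 hD
            linarith
        _ = η * D := by ring
    · set a := (Φ t z).1 k
      set b := (Φ t z').1 k
      have h1 := happ (ψ t (x k)) a b (hball z hz k t ht) (hball z' hz' k t ht)
      have h2 := hF k t ht
      have h3 : ‖fderiv ℝ f (ψ t (x k)) (a - b - v t)‖ ≤ L * ‖a - b - v t‖ :=
        (ContinuousLinearMap.le_opNorm _ _).trans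
          (mul_le_mul_of_nonneg_right (hf.bound _) (norm_nonneg _))
      have h4 : ω * ‖a - b‖ ≤ ω * (2 * e * D) :=
        mul_le_mul_of_nonneg_left (hδ k t ht) (by positivity)
      calc _ = ‖(f a - f b - fderiv ℝ f (ψ t (x k)) (a - b)) +
            fderiv ℝ f (ψ t (x k)) (a - b - v t) + (ε • F (Φ t z) k - ε • F (Φ t z') k)‖ := by
              congr 1
              rw [map_sub _ (a - b) (v t)]
              abel
        _ ≤ _ := norm_add₃_le
        _ ≤ _ := by linarith
  · have := norm_le_exp_mul_of_norm_deriv_le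
      (w := fun t => ((Φ t z).2 k - (Φ t z').2 k) - (z.2 k - z'.2 k)) (K := 0)
      (η := 3 * L * e * D) (τ := τ) le_rfl (by positivity)
      (fun t _ => ((h.hasDerivAt_snd z k t).sub (h.hasDerivAt_snd z' k t)).sub_const _)
      (fun t ht => ?_) ht
    · simp only [h.flow.zero, sub_self, norm_zero, zero_add, zero_mul, Real.exp_zero,
        one_mul] at this
      refine this.trans ?_
      calc _ ≤ 3 * L * e * D * τ := mul_le_mul_of_nonneg_left ht (by positivity)
        _ = _ := by ring
    · rw [add_sub_add_comm, zero_mul, zero_add]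
      refine (norm_add_le _ _).trans ?_
      have h1 := h.hg.lip ((Φ t z).1 k) ((Φ t z').1 k)
      have h2 := hG k t ht
      have h3 := mul_le_mul_of_nonneg_left (hδ k t ht) hL0.le
      have h4 : |ε| * (M * D) ≤ L * e * D := by
        have : 1 ≤ L * e := by nlinarith
        nlinarith
      calc _ ≤ 2 * L * e * D + |ε| * (M * D) := by linarith
        _ ≤ _ := by linarith

/-- The same comparison between a lattice orbit and an orbit of `f`. Here the coupling is not
multiplied by a difference of states, so the bound on `ε` has to depend on the scale `ρ`. -/
theorem lattice_base (hL : 1 ≤ L) (hf : IsC1Lip f L) (hψ : IsGlobalFlow f L ψ)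
    {τ η : ℝ} (hτ : 0 < τ) (hη : 0 < η) :
    ∃ ρ₀ > 0, ∀ ρ, 0 < ρ → ρ ≤ ρ₀ → ∃ ε₀ > 0, ∀ ε F G Φ, |ε| ≤ ε₀ →
      IsLatticeFlow f g L ε F G Φ →
      ∀ (z : LInf (Vec n) × LInf (Vec m)) (k : ℤ) (x : Vec n), ‖z.1 k - x‖ ≤ ρ →
      ∀ t, |t| ≤ τ → ‖(Φ t z).1 k - ψ t x‖ ≤ 2 * Real.exp (L * τ) * ρ ∧
        ∀ v, IsLinearizedSolution f (fun t => ψ t x) v → v 0 = z.1 k - x →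
          ‖(Φ t z).1 k - ψ t x - v t‖ ≤ η * ρ := by
  have hL0 : 0 < L := by linarith
  set e := Real.exp (L * τ) with he
  have he1 : 1 ≤ e := Real.one_le_exp (by positivity)
  set ω := η / (4 * e * e * τ) with hω
  obtain ⟨r, hr, happ⟩ := hf.linear_approx (ω := ω) (by positivity)
  refine ⟨r / (2 * e), by positivity, fun ρ hρ hρr => ⟨min (ρ / (L * τ))
    (η * ρ / (2 * e * τ * L)), by positivity, ?_⟩⟩
  intro ε F G Φ hε h z k x hz
  have hε1 : |ε| * (L * τ) ≤ ρ := by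
    rw [← le_div_iff₀ (by positivity)]; exact hε.trans (min_le_left _ _)
  have hε2 : |ε| * (2 * e * τ * L) ≤ η * ρ := by
    rw [← le_div_iff₀ (by positivity)]; exact hε.trans (min_le_right _ _)
  have hexp : ∀ t, |t| ≤ τ → Real.exp (L * |t|) ≤ e := fun t ht =>
    Real.exp_le_exp.mpr (mul_le_mul_of_nonneg_left ht hL0.le)
  have hball : ∀ t, |t| ≤ τ → ‖(Φ t z).1 k - ψ t x‖ ≤ 2 * e * ρ := by
    intro t ht
    refine (h.dist_base_le hψ z k x t).trans ?_
    have h1 : |ε| * L * |t| ≤ |ε| * L * τ := mul_le_mul_of_nonneg_left ht (by positivity)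
    calc _ ≤ e * (ρ + ρ) :=
          mul_le_mul (hexp t ht) (add_le_add hz (by linarith)) (by positivity) (by positivity)
      _ = _ := by ring
  have hρr' : 2 * e * ρ ≤ r := by
    have := (le_div_iff₀ (by positivity)).mp hρr
    linarith
  intro t ht
  refine ⟨hball t ht, fun v hv hv0 => ?_⟩
  have := norm_le_exp_mul_of_norm_deriv_le
    (w := fun t => (Φ t z).1 k - ψ t x - v t) (K := L)
    (η := ω * (2 * e * ρ) + |ε| * L) (τ := τ) hL0.le (by positivity)
    (fun t _ => ((h.hasDerivAt_fst z k t).sub (hψ.deriv x t)).sub (hv t))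
    (fun t ht => ?_) ht
  · simp only [h.flow.zero, hψ.zero, hv0, sub_self, norm_zero, zero_add] at this
    refine this.trans ?_
    calc _ ≤ e * ((ω * (2 * e * ρ) + |ε| * L) * τ) :=
          mul_le_mul (hexp t ht) (mul_le_mul_of_nonneg_left ht (by positivity)) (by positivity)
            (by positivity)
      _ = η / 2 * ρ + |ε| * (2 * e * τ * L) / 2 := by
          rw [hω]; field_simp; ring
      _ ≤ η * ρ := by linarith
  · set a := (Φ t z).1 k
    set b := ψ t x
    have h1 := happ b a b ((hball t ht).trans hρr') (by simpa using hr.le)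
    have h2 : ‖ε • F (Φ t z) k‖ ≤ |ε| * L := by
      rw [norm_smul, Real.norm_eq_abs]
      exact mul_le_mul_of_nonneg_left ((LInf.apply_le _ k).trans (h.Fbd _)) (abs_nonneg _)
    have h3 : ‖fderiv ℝ f b (a - b - v t)‖ ≤ L * ‖a - b - v t‖ :=
      (ContinuousLinearMap.le_opNorm _ _).trans
        (mul_le_mul_of_nonneg_right (hf.bound _) (norm_nonneg _))
    have h4 : ω * ‖a - b‖ ≤ ω * (2 * e * ρ) :=
      mul_le_mul_of_nonneg_left (hball t ht) (by positivity)
    calc _ = ‖(f a - f b - fderiv ℝ f b (a - b)) +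
          fderiv ℝ f b (a - b - v t) + ε • F (Φ t z) k‖ := by
            congr 1
            rw [map_sub _ (a - b) (v t)]
            abel
      _ ≤ _ := norm_add₃_le
      _ ≤ _ := by linarith

end StepEstimates

end LDS


/-! ### The hyperbolic splitting: continuous projections, compactness, uniform constants. -/

namespace LDS

theorem exists_projections_of_isInternal {V : Type*} [NormedAddCommGroup V] [NormedSpace ℝ V]
    [FiniteDimensional ℝ V] {A B C : Submodule ℝ V} (h : DirectSum.IsInternal ![A, B, C]) :
    ∃ p q r : V →L[ℝ] V, (∀ v, p v ∈ A ∧ q v ∈ B ∧ r v ∈ C ∧ p v + q v + r v = v) ∧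
      (∀ a ∈ A, p a = a ∧ q a = 0 ∧ r a = 0) ∧ (∀ b ∈ B, p b = 0 ∧ q b = b ∧ r b = 0) ∧
      (∀ c ∈ C, p c = 0 ∧ q c = 0 ∧ r c = c) := by
  set S : Fin 3 → Submodule ℝ V := ![A, B, C] with hS
  set e := LinearEquiv.ofBijective (DirectSum.coeLinearMap S) h with he
  set π : Fin 3 → V →ₗ[ℝ] V := fun i =>
    (S i).subtype ∘ₗ DirectSum.component ℝ (Fin 3) (fun i => S i) i ∘ₗ e.symm.toLinearMap with hπ
  have hmem : ∀ i v, π i v ∈ S i := fun i v => Subtype.coe_prop _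
  have hself : ∀ i, ∀ v ∈ S i, π i v = v := by
    intro i v hv
    change ((e.symm v i : S i) : V) = v
    rw [he, h.ofBijective_coeLinearMap_of_mem hv]
  have hne : ∀ i j, i ≠ j → ∀ v ∈ S i, π j v = 0 := by
    intro i j hij v hv
    change ((e.symm v j : S j) : V) = 0
    rw [he, h.ofBijective_coeLinearMap_of_mem_ne hij hv]; rfl
  have hsum : ∀ v, π 0 v + π 1 v + π 2 v = v := by
    intro v
    have hv : v ∈ iSup S := by rw [h.submodule_iSup_eq_top]; trivial
    refine Submodule.iSup_induction S (motive := fun v => π 0 v + π 1 v + π 2 v = v) hv ?_ ?_ ?_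
    · intro i x hx
      fin_cases i
      · have h1 := hself 0 x hx; have h2 := hne 0 1 (by decide) x hx
        have h3 := hne 0 2 (by decide) x hx
        rw [h1, h2, h3]; simp
      · have h1 := hself 1 x hx; have h2 := hne 1 0 (by decide) x hx
        have h3 := hne 1 2 (by decide) x hx
        rw [h1, h2, h3]; simp
      · have h1 := hself 2 x hx; have h2 := hne 2 0 (by decide) x hx
        have h3 := hne 2 1 (by decide) x hx
        rw [h1, h2, h3]; simp
    · simp
    · intro x y hx hy
      calc _ = (π 0 x + π 1 x + π 2 x) + (π 0 y + π 1 y + π 2 y) := by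
            simp only [map_add]; abel
        _ = x + y := by rw [hx, hy]
  refine ⟨LinearMap.toContinuousLinearMap (π 0), LinearMap.toContinuousLinearMap (π 1),
    LinearMap.toContinuousLinearMap (π 2),
    fun v => ⟨hmem 0 v, hmem 1 v, hmem 2 v, hsum v⟩, fun v hv => ⟨hself 0 v hv,
      hne 0 1 (by decide) v hv, hne 0 2 (by decide) v hv⟩, fun v hv => ⟨hne 1 0 (by decide) v hv,
      hself 1 v hv, hne 1 2 (by decide) v hv⟩, fun v hv => ⟨hne 2 0 (by decide) v hv,
      hne 2 1 (by decide) v hv, hself 2 v hv⟩⟩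

/-- The sign of a direction of time. -/
def sg (s : Bool) : ℝ := if s then 1 else -1

@[simp] theorem sg_true : sg true = 1 := rfl
@[simp] theorem sg_false : sg false = -1 := rfl

theorem sg_not (s : Bool) : sg (!s) = -sg s := by cases s <;> simp

theorem abs_sg (s : Bool) : |sg s| = 1 := by cases s <;> simp

theorem sg_mul_sg (s : Bool) : sg s * sg s = 1 := by cases s <;> simp

variable {n : ℕ}

/-- The oblique projections `P s x` (`s = true`: stable, `s = false`: unstable) and `P₀ x` (flow
direction) of a hyperbolic set, with the estimates for the linearized flow. -/
structure HypData (f : Vec n → Vec n) (ψ : ℝ → Vec n → Vec n) (Λ : Set (Vec n))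
    (P : Bool → Vec n → (Vec n →L[ℝ] Vec n)) (P₀ : Vec n → (Vec n →L[ℝ] Vec n))
    (K lam : ℝ) : Prop where
  one_le : 1 ≤ K
  lam_pos : 0 < lam
  compact : IsCompact Λ
  inv : ∀ x ∈ Λ, ∀ t, ψ t x ∈ Λ
  sum : ∀ s, ∀ x ∈ Λ, ∀ v, P s x v + P (!s) x v + P₀ x v = v
  idem : ∀ s, ∀ x ∈ Λ, ∀ v, P s x (P s x v) = P s x v
  cross : ∀ s, ∀ x ∈ Λ, ∀ v, P s x (P (!s) x v) = 0
  cross₀ : ∀ s, ∀ x ∈ Λ, ∀ v, P s x (P₀ x v) = 0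
  range : ∀ x ∈ Λ, ∀ v, ∃ a : ℝ, P₀ x v = a • f x ∧ |a| ≤ K * ‖v‖
  norm : ∀ s, ∀ x ∈ Λ, ‖P s x‖ ≤ K
  norm₀ : ∀ x ∈ Λ, ‖P₀ x‖ ≤ K
  fnorm : ∀ x ∈ Λ, ‖f x‖ ≤ K
  uc : ∀ η > 0, ∃ δ > 0, ∀ x ∈ Λ, ∀ x' ∈ Λ, ‖x - x'‖ ≤ δ →
    (∀ s, ‖P s x - P s x'‖ ≤ η) ∧ ‖P₀ x - P₀ x'‖ ≤ η
  contract : ∀ x ∈ Λ, ∀ v, IsLinearizedSolution f (fun t => ψ t x) v → ∀ s t, 0 ≤ t →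
    ‖P s (ψ (sg s * t) x) (v (sg s * t))‖ ≤ K * Real.exp (-lam * t) * ‖v 0‖
  neutral : ∀ x ∈ Λ, ∀ v, IsLinearizedSolution f (fun t => ψ t x) v → ∀ t,
    ‖P₀ (ψ t x) (v t)‖ ≤ K * ‖v 0‖
  ker : ∀ x ∈ Λ, ∀ v, IsLinearizedSolution f (fun t => ψ t x) v → ∀ s t,
    P s x (v 0) = 0 → P s (ψ t x) (v t) = 0
  fix : ∀ x ∈ Λ, ∀ v, IsLinearizedSolution f (fun t => ψ t x) v → ∀ s t,
    P s x (v 0) = v 0 → P s (ψ t x) (v t) = v t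

section Projections

/-- Continuity of oblique projections onto subspaces that depend continuously on a point. -/
theorem continuousOn_projections {Λ : Set (Vec n)} {f : Vec n → Vec n} (hf : Continuous f)
    {Ns Nu : Vec n → Submodule ℝ (Vec n)}
    (hNs : ContinuousOn (fun x => (Ns x).starProjection) Λ)
    (hNu : ContinuousOn (fun x => (Nu x).starProjection) Λ)
    {p q r : Vec n → Vec n →L[ℝ] Vec n}
    (hmem : ∀ x ∈ Λ, ∀ v, p x v ∈ Ns x ∧ q x v ∈ Nu x ∧ r x v ∈ Submodule.span ℝ {f x} ∧
      p x v + q x v + r x v = v)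
    (hp : ∀ x ∈ Λ, ∀ v ∈ Ns x, p x v = v ∧ q x v = 0 ∧ r x v = 0)
    (hq : ∀ x ∈ Λ, ∀ v ∈ Nu x, p x v = 0 ∧ q x v = v ∧ r x v = 0)
    (hr : ∀ x ∈ Λ, ∀ v ∈ Submodule.span ℝ {f x}, p x v = 0 ∧ q x v = 0 ∧ r x v = v) :
    ContinuousOn p Λ ∧ ContinuousOn q Λ ∧ ContinuousOn r Λ ∧
      ∀ x ∈ Λ, f x = 0 → ∀ᶠ x' in nhdsWithin x Λ, f x' = 0 := by
  -- `M x'` maps the splitting at `x` into that at `x'`: orthogonal projection on the stable and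
  -- unstable parts, and `f x ↦ f x'` on the flow direction, with `φ` the coefficient of `f x`.
  -- Hence it intertwines the oblique projections at the two points. It is continuous with `M x =
  -- 1`, thus invertible near `x`, and conjugation by it gives the continuity of the projections.
  have main : ∀ x ∈ Λ, ∃ M : Vec n → Vec n →L[ℝ] Vec n, ContinuousWithinAt M Λ x ∧ M x = 1 ∧
      ∀ x' ∈ Λ, p x' * M x' = M x' * p x ∧ q x' * M x' = M x' * q x ∧
        r x' * M x' = M x' * r x := by
    intro x hx
    set φ : Vec n →L[ℝ] ℝ := (1 / ‖f x‖ ^ 2) • ((innerSL ℝ (f x)).comp (r x)) with hφ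
    have hφr : ∀ v, φ v • f x = r x v := by
      intro v
      obtain ⟨c, hc⟩ := Submodule.mem_span_singleton.mp (hmem x hx v).2.2.1
      by_cases hfx : f x = 0
      · rw [← hc, hfx]; simp
      · have hn : ‖f x‖ ≠ 0 := norm_ne_zero_iff.mpr hfx
        have : φ v = c := by
          simp only [hφ, smul_apply, ContinuousLinearMap.comp_apply,
            innerSL_apply_apply, ← hc, inner_smul_right, real_inner_self_eq_norm_sq, smul_eq_mul]
          field_simp
        rw [this, hc]
    set M : Vec n → Vec n →L[ℝ] Vec n := fun x' =>
      (Ns x').starProjection * p x + (Nu x').starProjection * q x + φ.smulRight (f x') with hM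
    have hMapply : ∀ x' v, M x' v = (Ns x').starProjection (p x v) +
      (Nu x').starProjection (q x v) + φ v • f x' := fun x' v => rfl
    refine ⟨M, ?_, ?_, fun x' hx' => ?_⟩
    · have h1 : Continuous fun w : Vec n => φ.smulRight w :=
        (ContinuousLinearMap.smulRightL ℝ (Vec n) (Vec n) φ).continuous
      exact (((hNs x hx).mul continuousWithinAt_const).add
        ((hNu x hx).mul continuousWithinAt_const)).add
          (h1.comp hf).continuousWithinAt
    · ext1 v
      rw [hMapply, hφr, Submodule.starProjection_eq_self_iff.mpr (hmem x hx v).1,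
        Submodule.starProjection_eq_self_iff.mpr (hmem x hx v).2.1, (hmem x hx v).2.2.2]
      rfl
    · have h1 : ∀ v, p x' (M x' v) = (Ns x').starProjection (p x v) ∧
          q x' (M x' v) = (Nu x').starProjection (q x v) ∧ r x' (M x' v) = φ v • f x' := by
        intro v
        have ha := hp x' hx' _ (Submodule.starProjection_apply_mem (Ns x') (p x v))
        have hb := hq x' hx' _ (Submodule.starProjection_apply_mem (Nu x') (q x v))
        have hc := hr x' hx' (φ v • f x')
          (Submodule.smul_mem _ _ (Submodule.mem_span_singleton_self _))
        rw [hMapply]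
        simp only [map_add, ha.1, ha.2.1, ha.2.2, hb.1, hb.2.1, hb.2.2, hc.1, hc.2.1, hc.2.2]
        simp
      have hφ' : ∀ v, φ v = φ (r x v) := by
        intro v
        simp only [hφ, smul_apply, ContinuousLinearMap.comp_apply]
        rw [(hr x hx _ (hmem x hx v).2.2.1).2.2]
      have hφ0 : ∀ v, r x v = 0 → φ v = 0 := fun v hv => by rw [hφ', hv, map_zero]
      refine ⟨?_, ?_, ?_⟩
      · ext1 v
        change p x' (M x' v) = M x' (p x v)
        have h2 := hp x hx _ (hmem x hx v).1
        rw [(h1 v).1, hMapply, h2.1, h2.2.1, hφ0 _ h2.2.2]; simp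
      · ext1 v
        change q x' (M x' v) = M x' (q x v)
        have h2 := hq x hx _ (hmem x hx v).2.1
        rw [(h1 v).2.1, hMapply, h2.1, h2.2.1, hφ0 _ h2.2.2]; simp
      · ext1 v
        change r x' (M x' v) = M x' (r x v)
        have h2 := hr x hx _ (hmem x hx v).2.2.1
        rw [(h1 v).2.2, hMapply, h2.1, h2.2.1, ← hφ' v]; simp
  have hunit : ∀ x ∈ Λ, ∀ M : Vec n → Vec n →L[ℝ] Vec n, ContinuousWithinAt M Λ x → M x = 1 →
      ∀ᶠ x' in nhdsWithin x Λ, IsUnit (M x') := by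
    intro x hx M hM hM1
    have : {u : Vec n →L[ℝ] Vec n | IsUnit u} ∈ nhds (M x) := by
      rw [hM1]; exact Units.isOpen.mem_nhds isUnit_one
    exact hM this
  have hcont : ∀ a : Vec n → Vec n →L[ℝ] Vec n, (∀ x ∈ Λ, ∀ M : Vec n → Vec n →L[ℝ] Vec n,
      ContinuousWithinAt M Λ x → M x = 1 → (∀ x' ∈ Λ, a x' * M x' = M x' * a x) →
      ContinuousWithinAt a Λ x) := by
    intro a x hx M hM hM1 ha
    have h1 : ContinuousWithinAt (fun x' => M x' * a x * Ring.inverse (M x')) Λ x := by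
      refine (hM.mul continuousWithinAt_const).mul ?_
      have := NormedRing.inverse_continuousAt (1 : (Vec n →L[ℝ] Vec n)ˣ)
      rw [Units.val_one, ← hM1] at this
      exact this.comp_continuousWithinAt hM
    refine h1.congr_of_eventuallyEq ?_ ?_
    · filter_upwards [hunit x hx M hM hM1, self_mem_nhdsWithin] with x' hu hx'
      rw [← ha x' hx', Ring.mul_inverse_cancel_right _ _ hu]
    · rw [hM1]; simp
  refine ⟨fun x hx => ?_, fun x hx => ?_, fun x hx => ?_, fun x hx hfx => ?_⟩
  · obtain ⟨M, h1, h2, h3⟩ := main x hx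
    exact hcont p x hx M h1 h2 fun x' hx' => (h3 x' hx').1
  · obtain ⟨M, h1, h2, h3⟩ := main x hx
    exact hcont q x hx M h1 h2 fun x' hx' => (h3 x' hx').2.1
  · obtain ⟨M, h1, h2, h3⟩ := main x hx
    exact hcont r x hx M h1 h2 fun x' hx' => (h3 x' hx').2.2
  · obtain ⟨M, h1, h2, h3⟩ := main x hx
    filter_upwards [hunit x hx M h1 h2, self_mem_nhdsWithin] with x' hu hx'
    -- At an equilibrium the third summand is trivial. By conjugation it is trivial at nearby points
    -- of `Λ` as well, and these are again equilibria: the equilibria form a relatively open subset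
    -- of `Λ`.
    have hr0 : r x = 0 := by
      ext1 v
      have := (hmem x hx v).2.2.1
      rw [hfx] at this
      simpa using this
    have h4 := (h3 x' hx').2.2
    rw [hr0, mul_zero] at h4
    have h5 : r x' = 0 := by
      rw [← Ring.mul_inverse_cancel_right (M x') (r x') hu, h4, zero_mul]
    have h6 := (hr x' hx' (f x') (Submodule.mem_span_singleton_self _)).2.2
    rw [h5] at h6
    simpa using h6.symm

end Projections

section Hyperbolic

variable {f : Vec n → Vec n} {L : ℝ} {ψ : ℝ → Vec n → Vec n} {Λ : Set (Vec n)}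

theorem IsGlobalFlow.isOrbit (hψ : IsGlobalFlow f L ψ) (x : Vec n) :
    IsOrbit f (fun t => ψ t x) := fun t => hψ.deriv x t

theorem IsFlowInvariant.mem (hinv : IsFlowInvariant f Λ) (hψ : IsGlobalFlow f L ψ) {x : Vec n}
    (hx : x ∈ Λ) (t : ℝ) : ψ t x ∈ Λ := by
  obtain ⟨y, hy, hy0, hyΛ⟩ := hinv x hx
  have := hψ.unique y hy t
  rw [hy0] at this
  exact this ▸ hyΛ t

/-- By continuity of the flow, the orbit of a limit point of `Λ` stays in the closure of `Λ`, hence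
in every neighbourhood of `Λ`. Local maximality puts it into `Λ`. -/
theorem isCompact_of_isLocallyMaximal (hψ : IsGlobalFlow f L ψ) (hbdd : Bornology.IsBounded Λ)
    (hinv : IsFlowInvariant f Λ) (hmax : IsLocallyMaximal f Λ) : IsCompact Λ := by
  refine Metric.isCompact_of_isClosed_isBounded ?_ hbdd
  refine isClosed_of_closure_subset fun x hx => ?_
  obtain ⟨δ, hδ, hmax⟩ := hmax
  have := hmax (fun t => ψ t x) (hψ.isOrbit x) (fun t => ?_) 0
  · simpa [hψ.zero] using this
  · exact Metric.closure_subset_thickening hδ Λ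
      (map_mem_closure (hψ.continuous_right t) hx fun y hy => hinv.mem hψ hy t)

/-- If there were an equilibrium, the points of `Λ` around it would all be equilibria. The dense
orbit meets them, so it is constant and `Λ` is a single point. -/
theorem ne_zero_of_isFlowTransitive (hψ : IsGlobalFlow f L ψ) (htrans : IsFlowTransitive f Λ)
    (hopen : ∀ x ∈ Λ, f x = 0 → ∀ᶠ x' in nhdsWithin x Λ, f x' = 0) (hΛ : Λ.Nontrivial)
    {x : Vec n} (hx : x ∈ Λ) : f x ≠ 0 := by
  intro hfx
  obtain ⟨y, hy, hyΛ, hyd⟩ := htrans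
  obtain ⟨U, hU, hxU, hUf⟩ := mem_nhdsWithin.mp (hopen x hx hfx)
  obtain ⟨_, hzU, t₀, -, rfl⟩ := mem_closure_iff.mp (hyd hx) U hU hxU
  have hf0 : f (y t₀) = 0 := hUf ⟨hzU, hyΛ t₀⟩
  have hconst : ∀ t, y (t + t₀) = y t₀ := by
    intro t
    have h1 : ∀ t, HasDerivAt (fun t => y (t + t₀)) (f (y (t + t₀))) t := fun t => by
      have := (hy (t + t₀)).scomp t ((hasDerivAt_id t).add_const t₀)
      simpa [Function.comp_def] using this
    have h2 : ∀ t, HasDerivAt (fun _ : ℝ => y t₀) (f (y t₀)) t := fun t => by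
      rw [hf0]; exact hasDerivAt_const _ _
    have h3 := hψ.unique _ h1 t
    have h4 := hψ.unique _ h2 t
    simp only [zero_add] at h3
    rw [h3, ← h4]
  have hsub : Λ ⊆ {y t₀} := by
    refine hyd.trans ((closure_mono ?_).trans (closure_singleton).subset)
    rintro _ ⟨t, -, rfl⟩
    have := hconst (t - t₀)
    rw [sub_add_cancel] at this
    exact this
  exact Set.not_subsingleton_iff.mpr hΛ ((Set.subsingleton_singleton).anti hsub)

/-- A linearized solution splits at time `0` into a stable and an unstable solution and a multiple
of the solution `f(y(t))`. By invariance of the bundles and uniqueness, its oblique projections at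
later times are these three solutions, which gives all dynamical estimates. Compactness of `Λ` makes
the constants uniform. `Λ.Nontrivial` excludes equilibria, so that `‖f‖` is bounded below and the
neutral component is controlled by its coefficient. -/
theorem exists_hypData (hL : 1 ≤ L) (hf : IsC1Lip f L) (hψ : IsGlobalFlow f L ψ)
    (hbdd : Bornology.IsBounded Λ) (hinv : IsFlowInvariant f Λ) (hhyp : IsUniformlyHyperbolic f Λ)
    (htrans : IsFlowTransitive f Λ) (hmax : IsLocallyMaximal f Λ) (hΛ : Λ.Nontrivial) :
    ∃ P P₀ K lam, HypData f ψ Λ P P₀ K lam := by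
  obtain ⟨Ns, Nu, C, lam, hlam, hNs, hNu, hint, hlin⟩ := hhyp
  have hcpt := isCompact_of_isLocallyMaximal hψ hbdd hinv hmax
  have hΛinv : ∀ x ∈ Λ, ∀ t, ψ t x ∈ Λ := fun x hx t => hinv.mem hψ hx t
  have hex : ∀ x, ∃ p q r : Vec n →L[ℝ] Vec n, x ∈ Λ → (∀ v, p v ∈ Ns x ∧ q v ∈ Nu x ∧
      r v ∈ Submodule.span ℝ {f x} ∧ p v + q v + r v = v) ∧
      (∀ a ∈ Ns x, p a = a ∧ q a = 0 ∧ r a = 0) ∧ (∀ b ∈ Nu x, p b = 0 ∧ q b = b ∧ r b = 0) ∧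
      (∀ c ∈ Submodule.span ℝ {f x}, p c = 0 ∧ q c = 0 ∧ r c = c) := by
    intro x
    by_cases hx : x ∈ Λ
    · obtain ⟨p, q, r, h⟩ := exists_projections_of_isInternal (hint x hx)
      exact ⟨p, q, r, fun _ => h⟩
    · exact ⟨0, 0, 0, fun h => absurd h hx⟩
  choose p q r hpqr using hex
  have hmem := fun x hx => (hpqr x hx).1
  have hp := fun x hx => (hpqr x hx).2.1
  have hq := fun x hx => (hpqr x hx).2.2.1
  have hr := fun x hx => (hpqr x hx).2.2.2
  have hfc : Continuous f := hf.diff.continuous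
  obtain ⟨cp, cq, cr, hopen⟩ := continuousOn_projections hfc hNs hNu hmem hp hq hr
  have hf0 : ∀ x ∈ Λ, f x ≠ 0 := fun x hx =>
    ne_zero_of_isFlowTransitive hψ htrans hopen hΛ hx
  obtain ⟨Kp, hKp⟩ := hcpt.exists_bound_of_continuousOn cp
  obtain ⟨Kq, hKq⟩ := hcpt.exists_bound_of_continuousOn cq
  obtain ⟨Kr, hKr⟩ := hcpt.exists_bound_of_continuousOn cr
  obtain ⟨Kf, hKf⟩ := hcpt.exists_bound_of_continuousOn hfc.continuousOn
  obtain ⟨Ki, hKi⟩ := hcpt.exists_bound_of_continuousOn (f := fun x => ‖f x‖⁻¹)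
    (hfc.norm.continuousOn.inv₀ fun x hx => norm_ne_zero_iff.mpr (hf0 x hx))
  set K₀ := max (max (max Kp Kq) (max Kr Kf)) (max (max Ki |C|) 1) with hK₀
  have k1 : Kp ≤ K₀ := (le_max_left _ _).trans ((le_max_left _ _).trans (le_max_left _ _))
  have k2 : Kq ≤ K₀ := (le_max_right _ _).trans ((le_max_left _ _).trans (le_max_left _ _))
  have k3 : Kr ≤ K₀ := (le_max_left _ _).trans ((le_max_right _ _).trans (le_max_left _ _))
  have k4 : Kf ≤ K₀ := (le_max_right _ _).trans ((le_max_right _ _).trans (le_max_left _ _))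
  have k5 : Ki ≤ K₀ := (le_max_left _ _).trans ((le_max_left _ _).trans (le_max_right _ _))
  have k6 : |C| ≤ K₀ := (le_max_right _ _).trans ((le_max_left _ _).trans (le_max_right _ _))
  have k7 : 1 ≤ K₀ := (le_max_right _ _).trans (le_max_right _ _)
  have hK₀2 : K₀ ≤ K₀ ^ 2 := by nlinarith
  have hK₀3 : K₀ ^ 2 ≤ K₀ ^ 3 := by
    have : 0 ≤ K₀ ^ 2 := by positivity
    nlinarith
  set P : Bool → Vec n → Vec n →L[ℝ] Vec n := fun s => if s then p else q with hP
  have hPt : P true = p := rfl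
  have hPf : P false = q := rfl
  -- splitting of a linearized solution
  have hsplit : ∀ x ∈ Λ, ∀ v, IsLinearizedSolution f (fun t => ψ t x) v → ∃ vs vu : ℝ → Vec n,
      ∃ a : ℝ, IsLinearizedSolution f (fun t => ψ t x) vs ∧
        IsLinearizedSolution f (fun t => ψ t x) vu ∧
        vs 0 = p x (v 0) ∧ vu 0 = q x (v 0) ∧ a • f x = r x (v 0) ∧
        (∀ t, p (ψ t x) (v t) = vs t) ∧ (∀ t, q (ψ t x) (v t) = vu t) ∧
        (∀ t, r (ψ t x) (v t) = a • f (ψ t x)) := by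
    intro x hx v hv
    have hyc := hψ.continuous_left x
    obtain ⟨vs, hvs0, hvs⟩ := exists_isLinearizedSolution hf (by linarith) hyc (p x (v 0))
    obtain ⟨vu, hvu0, hvu⟩ := exists_isLinearizedSolution hf (by linarith) hyc (q x (v 0))
    obtain ⟨a, ha⟩ := Submodule.mem_span_singleton.mp (hmem x hx (v 0)).2.2.1
    have hsum := (hvs.add hvu).add (isLinearizedSolution_field hf (hψ.isOrbit x) a)
    have heq := hv.unique hf (by linarith) hsum (by
      simp only [hvs0, hvu0, hψ.zero, ha, (hmem x hx (v 0)).2.2.2])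
    have h1 := ((hlin _ vs (hψ.isOrbit x) (hΛinv x hx) hvs).1 (by
      simp only [hψ.zero, hvs0]; exact (hmem x hx (v 0)).1)).1
    have h2 := ((hlin _ vu (hψ.isOrbit x) (hΛinv x hx) hvu).2 (by
      simp only [hψ.zero, hvu0]; exact (hmem x hx (v 0)).2.1)).1
    have h3 : ∀ t, p (ψ t x) (v t) = vs t ∧ q (ψ t x) (v t) = vu t ∧
        r (ψ t x) (v t) = a • f (ψ t x) := by
      intro t
      have ea := hp _ (hΛinv x hx t) _ (h1 t)
      have eb := hq _ (hΛinv x hx t) _ (h2 t)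
      have ec := hr _ (hΛinv x hx t) (a • f (ψ t x))
        (Submodule.smul_mem _ _ (Submodule.mem_span_singleton_self _))
      rw [congrFun heq t]
      simp only [map_add, ea.1, ea.2.1, ea.2.2, eb.1, eb.2.1, eb.2.2, ec.1, ec.2.1, ec.2.2]
      simp
    exact ⟨vs, vu, a, hvs, hvu, hvs0, hvu0, ha, fun t => (h3 t).1, fun t => (h3 t).2.1,
      fun t => (h3 t).2.2⟩
  have hzero : ∀ x v, IsLinearizedSolution f (fun t => ψ t x) v → v 0 = 0 → ∀ t, v t = 0 := by
    intro x v hv h0 t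
    have := hv.norm_le hf (by linarith) t
    rw [h0, norm_zero, mul_zero] at this
    exact norm_le_zero_iff.mp this
  have hrange : ∀ x ∈ Λ, ∀ (a : ℝ) v, a • f x = r x v → |a| ≤ K₀ ^ 2 * ‖v‖ := by
    intro x hx a v ha
    have h1 : |a| * ‖f x‖ ≤ K₀ * ‖v‖ := by
      rw [← Real.norm_eq_abs, ← norm_smul, ha]
      exact (ContinuousLinearMap.le_opNorm _ _).trans
        (mul_le_mul_of_nonneg_right ((hKr x hx).trans k3) (norm_nonneg _))
    have h2 : ‖f x‖⁻¹ ≤ K₀ := by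
      have := hKi x hx
      rw [norm_inv, norm_norm] at this
      exact this.trans k5
    have h3 : 0 < ‖f x‖ := norm_pos_iff.mpr (hf0 x hx)
    calc |a| = |a| * ‖f x‖ * ‖f x‖⁻¹ := by field_simp
      _ ≤ K₀ * ‖v‖ * K₀ := mul_le_mul h1 h2 (by positivity) (by positivity)
      _ = _ := by ring
  have huc : ∀ a : Vec n → Vec n →L[ℝ] Vec n, ContinuousOn a Λ → ∀ η > 0, ∃ δ > 0, ∀ x ∈ Λ,
      ∀ x' ∈ Λ, ‖x - x'‖ ≤ δ → ‖a x - a x'‖ ≤ η := by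
    intro a ha η hη
    obtain ⟨δ, hδ, h⟩ := Metric.uniformContinuousOn_iff.mp
      (hcpt.uniformContinuousOn_of_continuous ha) η hη
    refine ⟨δ / 2, half_pos hδ, fun x hx x' hx' hxx' => ?_⟩
    rw [← dist_eq_norm]
    exact (h x hx x' hx' (by rw [dist_eq_norm]; linarith)).le
  -- The exponent `3` is needed for `neutral`: the coefficient of `f x` costs `K₀ ^ 2`, and `‖f‖`
  -- along the orbit one more factor.
  refine ⟨P, r, K₀ ^ 3, lam, ?_⟩
  refine
    { one_le := by linarith
      lam_pos := hlam
      compact := hcpt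
      inv := hΛinv
      sum := ?_
      idem := ?_
      cross := ?_
      cross₀ := ?_
      range := ?_
      norm := ?_
      norm₀ := fun x hx => (hKr x hx).trans (by linarith)
      fnorm := fun x hx => (hKf x hx).trans (by linarith)
      uc := ?_
      contract := ?_
      neutral := ?_
      ker := ?_
      fix := ?_ }
  · intro s x hx v
    cases s
    · simp only [hPf, Bool.not_false, hPt]
      rw [add_comm (q x v)]
      exact (hmem x hx v).2.2.2
    · exact (hmem x hx v).2.2.2
  · intro s x hx v
    cases s
    · exact (hq x hx _ (hmem x hx v).2.1).2.1
    · exact (hp x hx _ (hmem x hx v).1).1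
  · intro s x hx v
    cases s
    · exact (hp x hx _ (hmem x hx v).1).2.1
    · exact (hq x hx _ (hmem x hx v).2.1).1
  · intro s x hx v
    cases s
    · exact (hr x hx _ (hmem x hx v).2.2.1).2.1
    · exact (hr x hx _ (hmem x hx v).2.2.1).1
  · intro x hx v
    obtain ⟨a, ha⟩ := Submodule.mem_span_singleton.mp (hmem x hx v).2.2.1
    exact ⟨a, ha.symm, (hrange x hx a v ha).trans
      (mul_le_mul_of_nonneg_right hK₀3 (norm_nonneg _))⟩
  · intro s x hx
    cases s
    · exact (hKq x hx).trans (by linarith)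
    · exact (hKp x hx).trans (by linarith)
  · intro η hη
    obtain ⟨δ₁, h₁, H₁⟩ := huc p cp η hη
    obtain ⟨δ₂, h₂, H₂⟩ := huc q cq η hη
    obtain ⟨δ₃, h₃, H₃⟩ := huc r cr η hη
    refine ⟨min δ₁ (min δ₂ δ₃), by positivity, fun x hx x' hx' h => ⟨fun s => ?_, ?_⟩⟩
    · cases s
      · exact H₂ x hx x' hx' (h.trans ((min_le_right _ _).trans (min_le_left _ _)))
      · exact H₁ x hx x' hx' (h.trans (min_le_left _ _))
    · exact H₃ x hx x' hx' (h.trans ((min_le_right _ _).trans (min_le_right _ _)))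
  · intro x hx v hv s t ht
    obtain ⟨vs, vu, a, hvs, hvu, hvs0, hvu0, ha, es, eu, ec⟩ := hsplit x hx v hv
    have hfin : ∀ w₀ w : Vec n, ‖w₀‖ ≤ K₀ * ‖v 0‖ → ‖w‖ ≤ C * Real.exp (-lam * t) * ‖w₀‖ →
        ‖w‖ ≤ K₀ ^ 3 * Real.exp (-lam * t) * ‖v 0‖ := by
      intro w₀ w h1 h2
      have h3 : C * Real.exp (-lam * t) ≤ K₀ * Real.exp (-lam * t) :=
        mul_le_mul_of_nonneg_right ((le_abs_self C).trans k6) (Real.exp_pos _).le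
      calc ‖w‖ ≤ K₀ * Real.exp (-lam * t) * (K₀ * ‖v 0‖) :=
            h2.trans (mul_le_mul h3 h1 (norm_nonneg _) (by positivity))
        _ = K₀ ^ 2 * (Real.exp (-lam * t) * ‖v 0‖) := by ring
        _ ≤ K₀ ^ 3 * (Real.exp (-lam * t) * ‖v 0‖) :=
            mul_le_mul_of_nonneg_right hK₀3 (by positivity)
        _ = _ := by ring
    cases s
    · rw [hPf, eu]
      have h1 := ((hlin _ vu (hψ.isOrbit x) (hΛinv x hx) hvu).2 (by
        simp only [hψ.zero, hvu0]; exact (hmem x hx (v 0)).2.1)).2 (sg false * t) (by simpa using ht)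
      rw [show lam * (sg false * t) = -lam * t by simp] at h1
      refine hfin (vu 0) _ ?_ h1
      rw [hvu0]
      exact (ContinuousLinearMap.le_opNorm _ _).trans
        (mul_le_mul_of_nonneg_right ((hKq x hx).trans k2) (norm_nonneg _))
    · rw [hPt, es]
      have h1 := ((hlin _ vs (hψ.isOrbit x) (hΛinv x hx) hvs).1 (by
        simp only [hψ.zero, hvs0]; exact (hmem x hx (v 0)).1)).2 (sg true * t) (by simpa using ht)
      rw [show -lam * (sg true * t) = -lam * t by simp] at h1
      refine hfin (vs 0) _ ?_ h1
      rw [hvs0]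
      exact (ContinuousLinearMap.le_opNorm _ _).trans
        (mul_le_mul_of_nonneg_right ((hKp x hx).trans k1) (norm_nonneg _))
  · intro x hx v hv t
    obtain ⟨vs, vu, a, hvs, hvu, hvs0, hvu0, ha, es, eu, ec⟩ := hsplit x hx v hv
    rw [ec, norm_smul, Real.norm_eq_abs]
    calc |a| * ‖f (ψ t x)‖ ≤ (K₀ ^ 2 * ‖v 0‖) * K₀ :=
          mul_le_mul (hrange x hx a _ ha) ((hKf _ (hΛinv x hx t)).trans k4) (norm_nonneg _)
            (by positivity)
      _ = _ := by ring
  · intro x hx v hv s t h0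
    obtain ⟨vs, vu, a, hvs, hvu, hvs0, hvu0, ha, es, eu, ec⟩ := hsplit x hx v hv
    cases s
    · rw [hPf, eu]; exact hzero x vu hvu (hvu0.trans h0) t
    · rw [hPt, es]; exact hzero x vs hvs (hvs0.trans h0) t
  · intro x hx v hv s t h0
    obtain ⟨vs, vu, a, hvs, hvu, hvs0, hvu0, ha, es, eu, ec⟩ := hsplit x hx v hv
    cases s
    · rw [hPf, eu]
      exact congrFun (hvu.unique hf (by linarith) hv (hvu0.trans h0)) t
    · rw [hPt, es]
      exact congrFun (hvs.unique hf (by linarith) hv (hvs0.trans h0)) t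

end Hyperbolic

end LDS


/-! ### The time-`τ` maps near the hyperbolic set. -/

namespace LDS

variable {n m : ℕ}

/-- The state space of the lattice system. -/
abbrev LState (n m : ℕ) : Type := LInf (Vec n) × LInf (Vec m)

/-- The properties of the time-`τ` maps `Ψ s` (`s`: direction of time) of the lattice system that
are needed for shadowing. -/
structure ShadowStep (ψ : ℝ → Vec n → Vec n) (τ : ℝ) (Λ : Set (Vec n))
    (P : Bool → Vec n → (Vec n →L[ℝ] Vec n)) (P₀ : Vec n → (Vec n →L[ℝ] Vec n))
    (near : Bool → Vec n → Vec n → Prop) (Ψ : Bool → LState n m → LState n m)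
    (K κ R ρ γ α : ℝ) : Prop where
  κ_pos : 0 < κ
  κ_le : κ ≤ 1
  ρ_pos : 0 < ρ
  ρ_le : ρ ≤ R
  inv : ∀ s z, Ψ (!s) (Ψ s z) = z
  cont : ∀ s, Continuous (Ψ s)
  near_symm : ∀ s x x', near s x x' → near (!s) x' x
  lip : ∀ (s : Bool) (D : ℝ) (z z' : LState n m) (x x' : ℤ → Vec n), 0 ≤ D →
    (∀ k, x k ∈ Λ) → (∀ k, x' k ∈ Λ) → (∀ k, near s (x k) (x' k)) →
    (∀ k, ‖z.1 k - x k‖ ≤ R) → (∀ k, ‖z'.1 k - x k‖ ≤ R) →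
    (∀ k, ‖z.1 k - z'.1 k‖ ≤ D) → (∀ k, ‖z.2 k - z'.2 k‖ ≤ D / κ) → ∀ k,
    ‖P s (x' k) ((Ψ s z).1 k - (Ψ s z').1 k)‖ ≤ D / (128 * (K + 3)) ∧
    ‖P₀ (x' k) ((Ψ s z).1 k - (Ψ s z').1 k)‖ ≤ (K + 1) * D ∧
    ‖(Ψ s z).2 k - (Ψ s z').2 k‖ ≤ 2 * D / κ
  unique : ∀ (s : Bool) (z z' : LState n m) (x x' : ℤ → Vec n),
    (∀ k, x k ∈ Λ) → (∀ k, x' k ∈ Λ) → (∀ k, near s (x k) (x' k)) →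
    (∀ k, ‖z.1 k - x k‖ ≤ R) → (∀ k, ‖z'.1 k - x k‖ ≤ R) →
    (∀ k, P s (x k) (z.1 k - z'.1 k) = z.1 k - z'.1 k) → z.2 = z'.2 →
    (∀ k, P s (x' k) ((Ψ s z).1 k - (Ψ s z').1 k) = 0) → z = z'
  crude : ∀ (s : Bool) (z : LState n m) (k : ℤ) (x x' : Vec n), near s x x' →
    ‖z.1 k - x‖ ≤ ρ → ‖(Ψ s z).1 k - x'‖ ≤ R
  create : ∀ (s : Bool) (z : LState n m) (k : ℤ) (x : Vec n) (X : ℝ → Vec n), x ∈ Λ →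
    (∀ a, |a| ≤ τ → X a ∈ Λ ∧ ‖ψ (sg s * (τ + a)) x - X a‖ ≤ γ) → ‖z.1 k - x‖ ≤ ρ →
    ∃ a, |a| ≤ α ∧ near s x (X a) ∧ ‖P₀ (X a) ((Ψ s z).1 k - X a)‖ ≤ ρ / 100 ∧
      ‖P s (X a) ((Ψ s z).1 k - X a)‖ ≤ ρ / 100 ∧
      (P (!s) x (z.1 k - x) = 0 → ‖P (!s) (X a) ((Ψ s z).1 k - X a)‖ ≤ ρ / 100)

/-- The quadratic Taylor error of the flow. It allows a displacement along `f x` to be exchanged for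
a time shift. -/
theorem IsGlobalFlow.norm_sub_sub_smul_le {f : Vec n → Vec n} {L : ℝ} {ψ : ℝ → Vec n → Vec n}
    (hψ : IsGlobalFlow f L ψ) (hf : IsC1Lip f L) (hL : 0 ≤ L) (x : Vec n) (t : ℝ) :
    ‖ψ t x - x - t • f x‖ ≤ Real.exp (L * |t|) * (L * ‖f x‖ * |t| * |t|) := by
  have := norm_le_exp_mul_of_norm_deriv_le (w := fun t => ψ t x - x - t • f x) (K := L)
    (η := L * ‖f x‖ * |t|) (τ := |t|) hL (by positivity)
    (fun t _ => ((hψ.deriv x t).sub_const x).sub ((hasDerivAt_id t).smul_const (f x)))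
    (fun u hu => ?_) le_rfl
  · simpa [hψ.zero] using this
  · have h1 := hf.lip (ψ u x) x
    have h2 : ‖ψ u x - x‖ ≤ ‖ψ u x - x - u • f x‖ + |u| * ‖f x‖ := by
      rw [← Real.norm_eq_abs, ← norm_smul]
      have := norm_add_le (ψ u x - x - u • f x) (u • f x)
      rwa [sub_add_cancel] at this
    have h3 : |u| * ‖f x‖ ≤ ‖f x‖ * |t| := by
      rw [mul_comm]; exact mul_le_mul_of_nonneg_left hu (norm_nonneg _)
    have h4 : L * ‖ψ u x - x‖ ≤ L * (‖ψ u x - x - u • f x‖ + ‖f x‖ * |t|) :=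
      mul_le_mul_of_nonneg_left (h2.trans (by linarith)) hL
    rw [one_smul]
    linarith

-- All clauses are perturbations of statements on the linearized flow. `lip` is the contraction of
-- the component `P s`, with `P₀` and `p` growing moderately. `unique` holds because a difference
-- that lies in the range of `P s` is mapped nearly into the range of `P s` at the image, so it
-- vanishes if its image has no such component. `create` moves the next base point along the path
-- until the flow component of the error is negligible; the component `P s` is then small by
-- contraction, and the complementary one if it was absent before. The scales `τ`, `κ`, `R` and the
-- relation `near` are fixed before the accuracy `ρ₁`, so that `ρ`, `γ`, `α` and `ε₀` can be made
-- small afterwards.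
set_option maxHeartbeats 1000000 in
theorem exists_shadowStep {f : Vec n → Vec n} {g : Vec n → Vec m} {L : ℝ}
    {ψ : ℝ → Vec n → Vec n} {Λ : Set (Vec n)} {P : Bool → Vec n → (Vec n →L[ℝ] Vec n)}
    {P₀ : Vec n → (Vec n →L[ℝ] Vec n)} {K lam : ℝ} (hL : 1 ≤ L) (hf : IsC1Lip f L)
    (hψ : IsGlobalFlow f L ψ) (hyp : HypData f ψ Λ P P₀ K lam) :
    ∃ τ, 1 ≤ τ ∧ ∃ κ > 0, ∃ near : Bool → Vec n → Vec n → Prop, ∃ R, ∀ ρ₁ > 0, ∃ ρ > 0, ∃ γ > 0,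
      ∃ α > 0, ρ ≤ ρ₁ ∧ α ≤ ρ₁ ∧ γ ≤ ρ₁ ∧ α ≤ τ / 2 ∧ ∃ ε₀ > 0, ∀ ε F G Φ, |ε| ≤ ε₀ →
        IsLatticeFlow f g L ε F G Φ →
        ShadowStep (m := m) ψ τ Λ P P₀ near (fun s => Φ (sg s * τ)) K κ R ρ γ α := by
  have hK := hyp.one_le
  have hL0 : 0 < L := by linarith
  have hK0 : 0 < K := by linarith
  set μ : ℝ := 8 * (K + 3) with hμ
  have hμ32 : 32 ≤ μ := by rw [hμ]; linarith
  have hμ0 : 0 < μ := by linarith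
  -- `μ` will be the ratio of the weights at consecutive times of a window. The step `τ` is so long
  -- that hyperbolic contraction overcomes this factor, with a margin.
  obtain ⟨τ, hτ1, hτ⟩ : ∃ τ, 1 ≤ τ ∧ K * Real.exp (-lam * τ) ≤ 1 / (64 * μ) := by
    have h1 : Filter.Tendsto (fun τ => K * Real.exp (-lam * τ)) Filter.atTop (nhds (K * 0)) := by
      refine Filter.Tendsto.const_mul K (Real.tendsto_exp_atBot.comp ?_)
      exact Filter.tendsto_id.const_mul_atTop_of_neg (neg_lt_zero.mpr hyp.lam_pos)
    rw [mul_zero] at h1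
    obtain ⟨τ, h2, h3⟩ := ((h1.eventually (gt_mem_nhds (show (0 : ℝ) < 1 / (64 * μ) by
      positivity))).and (Filter.eventually_ge_atTop 1)).exists
    exact ⟨τ, h3, h2.le⟩
  have hτ0 : 0 < τ := by linarith
  set e := Real.exp (L * τ) with he
  have he1 : 1 ≤ e := Real.one_le_exp (by positivity)
  have he0 : 0 < e := by linarith
  -- With this `κ`, a difference `D` in `y` changes the difference in `p` by at most `D / κ` during
  -- one step, so the bound `D / κ` at most doubles.
  set κ := 1 / (3 * L * e * τ) with hκ
  have hκ0 : 0 < κ := by positivity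
  have hκ1 : κ ≤ 1 := by
    rw [hκ, div_le_one (by positivity)]
    have h1 : 1 ≤ L * e := by nlinarith
    have h2 : 1 ≤ L * e * τ := by nlinarith
    linarith
  set η₁ := 1 / (128 * μ * K * e) with hη₁
  have hη₁0 : 0 < η₁ := by positivity
  have hKη₁ : K * η₁ ≤ 1 / (128 * μ) := by
    have h1 : K * η₁ = 1 / (128 * μ) / e := by rw [hη₁]; field_simp
    rw [h1]
    exact div_le_self (by positivity) he1
  set η₂ := 1 / (128 * μ * e) with hη₂
  have hη₂0 : 0 < η₂ := by positivity
  have hη₂e : η₂ * e = 1 / (128 * μ) := by rw [hη₂]; field_simp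
  have hsmall : 1 / (128 * μ) ≤ 1 / 4096 :=
    one_div_le_one_div_of_le (by norm_num) (by linarith)
  have h64 : 1 / (64 * μ) = 2 * (1 / (128 * μ)) := by field_simp; norm_num
  obtain ⟨R, hR, ε₁, hε₁, hdiff⟩ :=
    lattice_diff (g := g) hL hf hψ hτ0 hκ0 hκ1 hη₁0
  obtain ⟨γ₁, hγ₁, huc₁⟩ := hyp.uc η₂ hη₂0
  set γ₂ := min γ₁ (R / 2) with hγ₂
  have hγ₂0 : 0 < γ₂ := by positivity
  -- Both directions of time are included because the boundary value problem uses the steps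
  -- backwards as well. The tolerance makes the projections at `x'` and at the image of `x` agree up
  -- to `η₂`.
  set near : Bool → Vec n → Vec n → Prop := fun s x x' =>
    ‖ψ (sg s * τ) x - x'‖ ≤ γ₂ ∧ ‖ψ (-(sg s * τ)) x' - x‖ ≤ γ₂ with hnear
  refine ⟨τ, hτ1, κ, hκ0, near, R, fun ρ₁ hρ₁ => ?_⟩
  obtain ⟨ρ₀, hρ₀, hbase⟩ := lattice_base (g := g) hL hf hψ hτ0 hη₁0
  set η₃ := 1 / (1000 * K) with hη₃
  have hη₃0 : 0 < η₃ := by positivity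
  have hKη₃ : K * η₃ = 1 / 1000 := by rw [hη₃]; field_simp
  have hη₃1 : η₃ ≤ 1 := by
    rw [hη₃, div_le_one (by positivity)]; linarith
  set η₄ := 1 / (1000 * (2 * e * (1 + K))) with hη₄
  have hη₄0 : 0 < η₄ := by positivity
  have hη₄' : η₄ * (2 * e * (1 + K)) = 1 / 1000 := by rw [hη₄]; field_simp
  obtain ⟨δ₄, hδ₄, huc₄⟩ := hyp.uc η₄ hη₄0
  set B := 1 + 2 * K ^ 2 * e with hB
  have hB1 : 1 ≤ B := by rw [hB]; have : 0 < 2 * K ^ 2 * e := by positivity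
                         linarith
  set c := e * (L * K * (2 * K * e) ^ 2) with hc
  have hc0 : 0 < c := by positivity
  -- The entries serve, in this order: the base estimate, the prescribed accuracy, `crude`, `α ≤
  -- ρ₁`, the quadratic error of the time shift, the variation of the projections between the
  -- shifted and the unshifted point, `near` in both directions, and `α ≤ τ / 2`.
  set ρ := min (min (min ρ₀ ρ₁) (min (R / (4 * e)) (ρ₁ / (2 * K * e))))
    (min (min (η₃ / (2 * c)) (δ₄ / B)) (min (γ₂ / (B * e)) (τ / (4 * K * e)))) with hρ
  have hρ0 : 0 < ρ := by positivity
  have r1 : ρ ≤ ρ₀ := (min_le_left _ _).trans ((min_le_left _ _).trans (min_le_left _ _))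
  have r2 : ρ ≤ ρ₁ := (min_le_left _ _).trans ((min_le_left _ _).trans (min_le_right _ _))
  have r3 : ρ * (4 * e) ≤ R := by
    rw [← le_div_iff₀ (by positivity)]
    exact (min_le_left _ _).trans ((min_le_right _ _).trans (min_le_left _ _))
  have r4 : ρ * (2 * K * e) ≤ ρ₁ := by
    rw [← le_div_iff₀ (by positivity)]
    exact (min_le_left _ _).trans ((min_le_right _ _).trans (min_le_right _ _))
  have r5 : ρ * (2 * c) ≤ η₃ := by
    rw [← le_div_iff₀ (by positivity)]
    exact (min_le_right _ _).trans ((min_le_left _ _).trans (min_le_left _ _))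
  have r6 : ρ * B ≤ δ₄ := by
    rw [← le_div_iff₀ (by positivity)]
    exact (min_le_right _ _).trans ((min_le_left _ _).trans (min_le_right _ _))
  have r7 : ρ * (B * e) ≤ γ₂ := by
    rw [← le_div_iff₀ (by positivity)]
    exact (min_le_right _ _).trans ((min_le_right _ _).trans (min_le_left _ _))
  have r8 : ρ * (4 * K * e) ≤ τ := by
    rw [← le_div_iff₀ (by positivity)]
    exact (min_le_right _ _).trans ((min_le_right _ _).trans (min_le_right _ _))
  obtain ⟨ε₂, hε₂, hbase⟩ := hbase ρ hρ0 r1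
  have hρR : ρ ≤ R := by nlinarith
  refine ⟨ρ, hρ0, η₃ * ρ / 2, by positivity, 2 * K * e * ρ, by positivity, r2, by linarith, ?_,
    by linarith, min ε₁ ε₂, by positivity, ?_⟩
  · have : η₃ * ρ ≤ ρ := mul_le_of_le_one_left hρ0.le hη₃1
    linarith
  intro ε F G Φ hε h
  have hd := hdiff ε F G Φ (hε.trans (min_le_left _ _)) h
  have hb := hbase ε F G Φ (hε.trans (min_le_right _ _)) h
  have hsτ : ∀ s : Bool, |sg s * τ| = τ := fun s => by
    rw [abs_mul, abs_sg, one_mul, abs_of_pos hτ0]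
  have hvle : ∀ (x : Vec n) v, IsLinearizedSolution f (fun t => ψ t x) v → ∀ s : Bool,
      ‖v (sg s * τ)‖ ≤ e * ‖v 0‖ ∧ ‖v 0‖ ≤ e * ‖v (sg s * τ)‖ := fun x v hv s => by
    have h1 := hv.norm_le hf hL0.le (sg s * τ)
    have h2 := hv.norm_zero_le hf hL0.le (sg s * τ)
    rw [hsτ] at h1 h2
    exact ⟨h1, h2⟩
  have hlinex : ∀ (x v₀ : Vec n), ∃ v, v 0 = v₀ ∧ IsLinearizedSolution f (fun t => ψ t x) v :=
    fun x v₀ => exists_isLinearizedSolution hf hL0 (hψ.continuous_left x) v₀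
  have hop : ∀ (A : Vec n →L[ℝ] Vec n) (a : ℝ) (v : Vec n), ‖A‖ ≤ a → ‖A v‖ ≤ a * ‖v‖ :=
    fun A a v hA => (A.le_opNorm v).trans (mul_le_mul_of_nonneg_right hA (norm_nonneg _))
  refine
    { κ_pos := hκ0
      κ_le := hκ1
      ρ_pos := hρ0
      ρ_le := hρR
      inv := ?_
      cont := fun s => h.flow.continuous_right _
      near_symm := ?_
      lip := ?_
      unique := ?_
      crude := ?_
      create := ?_ }
  · intro s z
    have := h.flow.neg_apply (sg s * τ) z
    rw [sg_not, neg_mul]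
    exact this
  · intro s x x' hx
    simp only [hnear, sg_not, neg_mul, neg_neg]
    exact ⟨hx.2, hx.1⟩
  · intro s D z z' x x' hD hx hx' hxx hz hz' hy hp k
    obtain ⟨v, hv0, hv⟩ := hlinex (x k) (z.1 k - z'.1 k)
    obtain ⟨h1, h2⟩ := hd D z z' x hD hz hz' hy hp k (sg s * τ) (hsτ s).le
    have h3 := h1 v hv hv0
    have hv0D : ‖v 0‖ ≤ D := hv0 ▸ hy k
    have h4 : ‖v (sg s * τ)‖ ≤ e * D :=
      (hvle _ v hv s).1.trans (mul_le_mul_of_nonneg_left hv0D he0.le)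
    have h5 := huc₁ (x' k) (hx' k) (ψ (sg s * τ) (x k)) (hyp.inv _ (hx k) _) (by
      rw [norm_sub_rev]; exact (hxx k).1.trans (min_le_left _ _))
    set w := (Φ (sg s * τ) z).1 k - (Φ (sg s * τ) z').1 k with hw
    have dec : ∀ A A' : Vec n →L[ℝ] Vec n, A w = A (w - v (sg s * τ)) +
        (A - A') (v (sg s * τ)) + A' (v (sg s * τ)) := fun A A' => by
      rw [map_sub A w, sub_apply]; abel
    have e1 : ∀ A : Vec n →L[ℝ] Vec n, ‖A‖ ≤ K → ‖A (w - v (sg s * τ))‖ ≤ 1 / (128 * μ) * D := by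
      intro A hA
      calc _ ≤ K * (η₁ * D) := (hop A K _ hA).trans (mul_le_mul_of_nonneg_left h3 hK0.le)
        _ = K * η₁ * D := by ring
        _ ≤ _ := mul_le_mul_of_nonneg_right hKη₁ hD
    have e2 : ∀ A : Vec n →L[ℝ] Vec n, ‖A‖ ≤ η₂ → ‖A (v (sg s * τ))‖ ≤ 1 / (128 * μ) * D := by
      intro A hA
      calc _ ≤ η₂ * (e * D) := (hop A η₂ _ hA).trans (mul_le_mul_of_nonneg_left h4 hη₂0.le)
        _ = η₂ * e * D := by ring
        _ = _ := by rw [hη₂e]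
    refine ⟨?_, ?_, ?_⟩
    · have e3 : ‖P s (ψ (sg s * τ) (x k)) (v (sg s * τ))‖ ≤ 1 / (64 * μ) * D :=
        (hyp.contract _ (hx k) v hv s τ hτ0.le).trans
          (mul_le_mul hτ hv0D (norm_nonneg _) (by positivity))
      change ‖P s (x' k) w‖ ≤ _
      rw [dec (P s (x' k)) (P s (ψ (sg s * τ) (x k)))]
      refine norm_add₃_le.trans ?_
      have := e1 _ (hyp.norm s _ (hx' k))
      have := e2 _ (h5.1 s)
      rw [h64] at e3
      calc _ ≤ 4 * (1 / (128 * μ)) * D := by linarith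
        _ = D / (128 * (K + 3)) * (1 / 2) := by rw [hμ]; field_simp; ring
        _ ≤ _ := by
          have : 0 ≤ D / (128 * (K + 3)) := by positivity
          linarith
    · have e3 : ‖P₀ (ψ (sg s * τ) (x k)) (v (sg s * τ))‖ ≤ K * D :=
        (hyp.neutral _ (hx k) v hv _).trans (mul_le_mul_of_nonneg_left hv0D hK0.le)
      change ‖P₀ (x' k) w‖ ≤ _
      rw [dec (P₀ (x' k)) (P₀ (ψ (sg s * τ) (x k)))]
      refine norm_add₃_le.trans ?_
      have := e1 _ (hyp.norm₀ _ (hx' k))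
      have := e2 _ h5.2
      have := mul_le_mul_of_nonneg_right hsmall hD
      linarith
    · have h6 : 3 * L * e * τ * D = D / κ := by rw [hκ]; field_simp
      rw [h6] at h2
      have := norm_le_norm_add_norm_sub' ((Φ (sg s * τ) z).2 k - (Φ (sg s * τ) z').2 k)
        (z.2 k - z'.2 k)
      have := hp k
      rw [mul_div_assoc]
      linarith
  -- The linearized image `u` is fixed by `P s` at the image point, while the true image `w` is
  -- annihilated by `P s (x' k)`. Hence `u` is bounded by the linearization error and the small
  -- variation of the projections. Flowing back yields `D ≤ D / 2`, so `D = 0`.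
  · intro s z z' x x' hx hx' hxx hz hz' hfix hp hker
    set D := ‖z.1 - z'.1‖ with hD
    have hD0 : 0 ≤ D := norm_nonneg _
    have hDk : ∀ k, ‖z.1 k - z'.1 k‖ ≤ D := fun k => LInf.apply_le (z.1 - z'.1) k
    have hle : ∀ k, ‖z.1 k - z'.1 k‖ ≤ D / 2 := by
      intro k
      obtain ⟨v, hv0, hv⟩ := hlinex (x k) (z.1 k - z'.1 k)
      obtain ⟨h1, -⟩ := hd D z z' x hD0 hz hz' hDk (fun k => by
        rw [hp, sub_self, norm_zero]; positivity) k (sg s * τ) (hsτ s).le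
      have h3 := h1 v hv hv0
      have h5 := huc₁ (x' k) (hx' k) (ψ (sg s * τ) (x k)) (hyp.inv _ (hx k) _) (by
        rw [norm_sub_rev]; exact (hxx k).1.trans (min_le_left _ _))
      have h6 := hyp.fix _ (hx k) v hv s (sg s * τ) (by rw [hv0]; exact hfix k)
      set w := (Φ (sg s * τ) z).1 k - (Φ (sg s * τ) z').1 k with hw
      set u := v (sg s * τ) with hu
      have hker' : P s (x' k) w = 0 := hker k
      have h7 : u = -(P s (x' k) (w - u)) - (P s (x' k) - P s (ψ (sg s * τ) (x k))) u := by
        rw [map_sub, hker', sub_apply, h6]; abel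
      have h8 : ‖u‖ ≤ K * (η₁ * D) + η₂ * ‖u‖ := by
        calc ‖u‖ = ‖-(P s (x' k) (w - u)) - (P s (x' k) - P s (ψ (sg s * τ) (x k))) u‖ := by
              rw [← h7]
          _ ≤ _ := (norm_sub_le _ _).trans (by
            rw [norm_neg]
            exact add_le_add ((hop _ K _ (hyp.norm s _ (hx' k))).trans
              (mul_le_mul_of_nonneg_left h3 hK0.le)) (hop _ η₂ _ (h5.1 s)))
      have hη₂1 : η₂ ≤ 1 / 2 := by
        have : η₂ ≤ η₂ * e := le_mul_of_one_le_right hη₂0.le he1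
        linarith
      have h9 : ‖u‖ ≤ 2 * (K * (η₁ * D)) := by
        have := mul_le_mul_of_nonneg_right hη₂1 (norm_nonneg u)
        linarith
      have h10 := (hvle _ v hv s).2
      rw [hv0] at h10
      calc _ ≤ e * (2 * (K * (η₁ * D))) := h10.trans (mul_le_mul_of_nonneg_left h9 he0.le)
        _ = 2 * (1 / (128 * μ)) * D := by rw [hη₁]; field_simp
        _ ≤ _ := by
          have := mul_le_mul_of_nonneg_right hsmall hD0
          linarith
    have hD' : D ≤ D / 2 := LInf.norm_le fun k => hle k
    have hD'' : ‖z.1 - z'.1‖ = 0 := by linarith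
    exact Prod.ext (sub_eq_zero.mp (norm_eq_zero.mp hD'')) hp
  · intro s z k x x' hxx hz
    have h1 := (hb z k x hz (sg s * τ) (hsτ s).le).1
    have h2 := hxx.1.trans (min_le_right _ _)
    have h3 := norm_sub_le_norm_sub_add_norm_sub ((Φ (sg s * τ) z).1 k) (ψ (sg s * τ) x) x'
    change ‖(Φ (sg s * τ) z).1 k - x'‖ ≤ R
    linarith
  · intro s z k x X hx hX hz
    obtain ⟨hw1, hw2⟩ := hb z k x hz (sg s * τ) (hsτ s).le
    obtain ⟨v, hv0, hv⟩ := hlinex x (z.1 k - x)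
    have hwv := hw2 v hv hv0
    change ∃ a, |a| ≤ _ ∧ near s x (X a) ∧ ‖P₀ (X a) ((Φ (sg s * τ) z).1 k - X a)‖ ≤ ρ / 100 ∧
      ‖P s (X a) ((Φ (sg s * τ) z).1 k - X a)‖ ≤ ρ / 100 ∧
      (P (!s) x (z.1 k - x) = 0 → ‖P (!s) (X a) ((Φ (sg s * τ) z).1 k - X a)‖ ≤ ρ / 100)
    set w := (Φ (sg s * τ) z).1 k with hw
    set xs := ψ (sg s * τ) x with hxs
    have hxsΛ : xs ∈ Λ := hyp.inv x hx _
    -- `φ • f xs` is the flow component of the error. The time shift is `sg s * φ`, since the path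
    -- runs along the reversed flow for `s = false`.
    obtain ⟨φ, hφ, hφle⟩ := hyp.range xs hxsΛ (w - xs)
    have hφ1 : |φ| ≤ 2 * K * e * ρ := by
      refine hφle.trans ((mul_le_mul_of_nonneg_left hw1 hK0.le).trans (le_of_eq ?_))
      ring
    have hφτ : |φ| ≤ τ := by linarith
    have habs : |sg s * φ| = |φ| := by rw [abs_mul, abs_sg, one_mul]
    obtain ⟨hXΛ, hXγ⟩ := hX (sg s * φ) (by rwa [habs])
    set y := X (sg s * φ) with hy
    have hψφ : ψ (sg s * (τ + sg s * φ)) x = ψ φ xs := by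
      rw [hxs, ← hψ.add]
      congr 1
      rw [mul_add, ← mul_assoc, sg_mul_sg, one_mul, add_comm]
    rw [hψφ] at hXγ
    have hE : ‖y - xs - φ • f xs‖ ≤ η₃ * ρ := by
      have h1 := hψ.norm_sub_sub_smul_le hf hL0.le xs φ
      have h2 : Real.exp (L * |φ|) * (L * ‖f xs‖ * |φ| * |φ|) ≤ c * ρ * ρ := by
        calc _ ≤ e * (L * K * (2 * K * e * ρ) * (2 * K * e * ρ)) := by
              refine mul_le_mul (Real.exp_le_exp.mpr (mul_le_mul_of_nonneg_left hφτ hL0.le)) ?_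
                (by positivity) he0.le
              refine mul_le_mul (mul_le_mul (mul_le_mul_of_nonneg_left (hyp.fnorm xs hxsΛ) hL0.le)
                hφ1 (abs_nonneg _) (by positivity)) hφ1 (abs_nonneg _) (by positivity)
          _ = c * ρ * ρ := by rw [hc]; ring
      have h3 : ‖y - xs - φ • f xs‖ ≤ ‖ψ φ xs - y‖ + ‖ψ φ xs - xs - φ • f xs‖ := by
        rw [norm_sub_rev (ψ φ xs) y]
        refine (norm_add_le _ _).trans' (le_of_eq ?_)
        congr 1; abel
      have h4 : c * ρ * ρ ≤ η₃ / 2 * ρ := mul_le_mul_of_nonneg_right (by linarith) hρ0.le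
      linarith
    have hyx : ‖y - xs‖ ≤ ρ * B := by
      have h1 : ‖y - xs‖ ≤ ‖y - xs - φ • f xs‖ + ‖φ • f xs‖ := by
        have := norm_add_le (y - xs - φ • f xs) (φ • f xs)
        rwa [sub_add_cancel] at this
      have h2 : ‖φ • f xs‖ ≤ 2 * K * e * ρ * K := by
        rw [norm_smul, Real.norm_eq_abs]
        exact mul_le_mul hφ1 (hyp.fnorm xs hxsΛ) (norm_nonneg _) (by positivity)
      have h3 : η₃ * ρ ≤ ρ := mul_le_of_le_one_left hρ0.le hη₃1
      calc _ ≤ ρ + 2 * K * e * ρ * K := by linarith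
        _ = ρ * B := by rw [hB]; ring
    have huc := huc₄ y hXΛ xs hxsΛ (hyx.trans r6)
    set u := w - xs - φ • f xs with hu
    have hwu : w - y = u - (y - xs - φ • f xs) := by rw [hu]; abel
    have hu1 : ‖u‖ ≤ 2 * e * (1 + K) * ρ := by
      have h1 : ‖u‖ ≤ ‖w - xs‖ + ‖P₀ xs (w - xs)‖ := by rw [hφ]; exact norm_sub_le _ _
      have h2 := hop _ K (w - xs) (hyp.norm₀ xs hxsΛ)
      have h3 := mul_le_mul_of_nonneg_left hw1 hK0.le
      calc _ ≤ 2 * e * ρ + K * (2 * e * ρ) := by linarith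
        _ = _ := by ring
    have hbd : ∀ A A' : Vec n →L[ℝ] Vec n, ‖A‖ ≤ K → ‖A - A'‖ ≤ η₄ → ‖A' u‖ ≤ ρ / 500 →
        ‖A (w - y)‖ ≤ ρ / 100 := by
      intro A A' hA hAA hAu
      have h1 : A (w - y) = (A - A') u + A' u - A (y - xs - φ • f xs) := by
        rw [hwu, map_sub, sub_apply]; abel
      have h2 : ‖(A - A') u‖ ≤ 1 / 1000 * ρ := by
        calc _ ≤ η₄ * (2 * e * (1 + K) * ρ) :=
              (hop _ η₄ _ hAA).trans (mul_le_mul_of_nonneg_left hu1 hη₄0.le)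
          _ = η₄ * (2 * e * (1 + K)) * ρ := by ring
          _ = _ := by rw [hη₄']
      have h3 : ‖A (y - xs - φ • f xs)‖ ≤ 1 / 1000 * ρ := by
        calc _ ≤ K * (η₃ * ρ) := (hop _ K _ hA).trans (mul_le_mul_of_nonneg_left hE hK0.le)
          _ = K * η₃ * ρ := by ring
          _ = _ := by rw [hKη₃]
      rw [h1]
      refine (norm_sub_le _ _).trans ?_
      have := norm_add_le ((A - A') u) (A' u)
      linarith
    have hP₀u : P₀ xs u = 0 := by
      have h1 : P₀ xs (P₀ xs (w - xs)) = P₀ xs (w - xs) := by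
        have := hyp.sum true xs hxsΛ (P₀ xs (w - xs))
        rw [hyp.cross₀ _ xs hxsΛ, hyp.cross₀ _ xs hxsΛ, zero_add, zero_add] at this
        exact this
      rw [hu, map_sub, ← hφ, h1, sub_self]
    have hPu : ∀ σ, P σ xs u = P σ xs (w - xs - v (sg s * τ)) + P σ xs (v (sg s * τ)) := by
      intro σ
      rw [hu, map_sub, ← hφ, hyp.cross₀ _ xs hxsΛ, sub_zero, ← map_add, sub_add_cancel]
    have hPu1 : ∀ σ, ‖P σ xs (w - xs - v (sg s * τ))‖ ≤ ρ / 1000 := by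
      intro σ
      calc _ ≤ K * (η₁ * ρ) :=
            (hop _ K _ (hyp.norm σ xs hxsΛ)).trans (mul_le_mul_of_nonneg_left hwv hK0.le)
        _ = K * η₁ * ρ := by ring
        _ ≤ 1 / 4096 * ρ := mul_le_mul_of_nonneg_right (hKη₁.trans hsmall) hρ0.le
        _ ≤ _ := by linarith
    refine ⟨sg s * φ, by rw [habs]; exact hφ1, ⟨?_, ?_⟩, ?_, ?_, fun hker => ?_⟩
    · rw [norm_sub_rev]
      refine hyx.trans (le_trans ?_ r7)
      exact mul_le_mul_of_nonneg_left (le_mul_of_one_le_right (by linarith) he1) hρ0.le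
    · have h1 := hψ.lip (-(sg s * τ)) y xs
      rw [hxs, hψ.neg_apply, abs_neg, hsτ] at h1
      refine h1.trans (le_trans ?_ r7)
      calc _ ≤ e * (ρ * B) := mul_le_mul_of_nonneg_left hyx he0.le
        _ = _ := by ring
    · refine hbd _ (P₀ xs) (hyp.norm₀ y hXΛ) huc.2 ?_
      rw [hP₀u, norm_zero]; positivity
    · refine hbd _ (P s xs) (hyp.norm s y hXΛ) (huc.1 s) ?_
      rw [hPu s]
      have h1 : ‖P s xs (v (sg s * τ))‖ ≤ 1 / (64 * μ) * ρ :=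
        (hyp.contract x hx v hv s τ hτ0.le).trans
          (mul_le_mul hτ (hv0 ▸ hz) (norm_nonneg _) (by positivity))
      have h2 := mul_le_mul_of_nonneg_right hsmall hρ0.le
      have := norm_add_le (P s xs (w - xs - v (sg s * τ))) (P s xs (v (sg s * τ)))
      have := hPu1 s
      rw [h64] at h1
      linarith
    · refine hbd _ (P (!s) xs) (hyp.norm (!s) y hXΛ) (huc.1 (!s)) ?_
      rw [hPu (!s)]
      have h1 : P (!s) xs (v (sg s * τ)) = 0 :=
        hyp.ker x hx v hv (!s) (sg s * τ) (by rw [hv0]; exact hker)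
      rw [h1, add_zero]
      exact (hPu1 _).trans (by linarith)

end LDS


/-! ### The boundary value problem on a finite time window. -/

namespace LDS

variable {n m : ℕ}

namespace HypData

variable {f : Vec n → Vec n} {ψ : ℝ → Vec n → Vec n} {Λ : Set (Vec n)}
  {P : Bool → Vec n → (Vec n →L[ℝ] Vec n)} {P₀ : Vec n → (Vec n →L[ℝ] Vec n)} {K lam : ℝ}

theorem idem₀ (h : HypData f ψ Λ P P₀ K lam) {x : Vec n} (hx : x ∈ Λ) (v : Vec n) :
    P₀ x (P₀ x v) = P₀ x v := by
  have := h.sum true x hx (P₀ x v)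
  rwa [h.cross₀ _ x hx, h.cross₀ _ x hx, zero_add, zero_add] at this

theorem cross₀' (h : HypData f ψ Λ P P₀ K lam) (s : Bool) {x : Vec n} (hx : x ∈ Λ) (v : Vec n) :
    P₀ x (P s x v) = 0 := by
  have := h.sum s x hx (P s x v)
  have h2 := h.cross (!s) x hx v
  rw [Bool.not_not] at h2
  rwa [h.idem _ x hx, h2, add_zero, add_eq_left] at this

end HypData

/-- The weighted norm on the state space of the lattice system. -/
noncomputable def wnorm (κ : ℝ) (z : LState n m) : ℝ := max ‖z.1‖ (κ * ‖z.2‖)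

theorem wnorm_le_iff {κ D : ℝ} (hκ : 0 < κ) {z : LState n m} :
    wnorm κ z ≤ D ↔ (∀ k, ‖z.1 k‖ ≤ D) ∧ ∀ k, ‖z.2 k‖ ≤ D / κ := by
  rw [wnorm, max_le_iff]
  have h : κ * ‖z.2‖ ≤ D ↔ ‖z.2‖ ≤ D / κ := by rw [le_div_iff₀ hκ, mul_comm]
  rw [h]
  exact ⟨fun h => ⟨fun k => (LInf.apply_le _ k).trans h.1, fun k => (LInf.apply_le _ k).trans h.2⟩,
    fun h => ⟨LInf.norm_le h.1, LInf.norm_le h.2⟩⟩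

theorem wnorm_sub_le_iff {κ D : ℝ} (hκ : 0 < κ) {z z' : LState n m} :
    wnorm κ (z - z') ≤ D ↔ (∀ k, ‖z.1 k - z'.1 k‖ ≤ D) ∧ ∀ k, ‖z.2 k - z'.2 k‖ ≤ D / κ :=
  wnorm_le_iff hκ

theorem continuous_wnorm (κ : ℝ) : Continuous (wnorm κ : LState n m → ℝ) := by
  unfold wnorm; fun_prop

theorem wnorm_add_le {κ : ℝ} (hκ : 0 < κ) (a b : LState n m) :
    wnorm κ (a + b) ≤ wnorm κ a + wnorm κ b := by
  have h1 : ‖a.1‖ ≤ wnorm κ a := le_max_left _ _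
  have h2 : ‖b.1‖ ≤ wnorm κ b := le_max_left _ _
  have h3 : κ * ‖a.2‖ ≤ wnorm κ a := le_max_right _ _
  have h4 : κ * ‖b.2‖ ≤ wnorm κ b := le_max_right _ _
  refine max_le ((norm_add_le _ _).trans (add_le_add h1 h2)) ?_
  have := mul_le_mul_of_nonneg_left (norm_add_le a.2 b.2) hκ.le
  change κ * ‖a.2 + b.2‖ ≤ _
  linarith

theorem wnorm_zero (κ : ℝ) : wnorm κ (0 : LState n m) = 0 := by simp [wnorm]

theorem wnorm_neg (κ : ℝ) (a : LState n m) : wnorm κ (-a) = wnorm κ a := by simp [wnorm]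

theorem mul_norm_le_wnorm {κ : ℝ} (hκ : 0 < κ) (hκ1 : κ ≤ 1) (z : LState n m) :
    κ * ‖z‖ ≤ wnorm κ z := by
  rw [Prod.norm_def, mul_max_of_nonneg _ _ hκ.le]
  exact max_le_max (mul_le_of_le_one_left (norm_nonneg _) hκ1) le_rfl

/-- The map whose fixed points are the solutions of the boundary value problem on the time window
`{-(J + 1), …, J + 1}`; the two halves of the time axis are indexed by `Bool`. -/
noncomputable def windowMap (Ψ : Bool → LState n m → LState n m)
    (P : Bool → Vec n → (Vec n →L[ℝ] Vec n)) (P₀ : Vec n → (Vec n →L[ℝ] Vec n))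
    (x : Bool → ℕ → ℤ → Vec n) (J : ℕ) (u₀ u : Bool × ℕ → LState n m) : Bool × ℕ → LState n m
  | (s, 0) => (seqOf fun k => x s 0 k +
      P true (x s 0 k) ((Ψ true (u (false, 1))).1 k - x s 0 k) +
      P false (x s 0 k) ((Ψ false (u (true, 1))).1 k - x s 0 k), 0)
  | (s, j + 1) => if j ≤ J then
      (seqOf fun k => x s (j + 1) k +
        (P s (x s (j + 1) k) ((Ψ s (u (s, j))).1 k - x s (j + 1) k) +
          P₀ (x s (j + 1) k) ((Ψ s (u (s, j))).1 k - x s (j + 1) k)) +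
        (if j < J then P (!s) (x s (j + 1) k) ((Ψ (!s) (u (s, j + 2))).1 k - x s (j + 1) k)
          else 0), (Ψ s (u (s, j))).2)
      else u₀ (s, j + 1)

/-- A solution of the boundary value problem on the time window `{-J, …, J}`, for the base points
`pt (q s j k)`. -/
structure WindowSol {Q : Type} (pt : Q → Vec n) (ok : Q → Prop)
    (P : Bool → Vec n → (Vec n →L[ℝ] Vec n)) (P₀ : Vec n → (Vec n →L[ℝ] Vec n))
    (near : Bool → Vec n → Vec n → Prop) (Ψ : Bool → LState n m → LState n m) (ρ : ℝ)
    (q₀ : ℤ → Q) (J : ℕ) (q : Bool → ℕ → ℤ → Q) (z : Bool → ℕ → LState n m) : Prop where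
  start : ∀ s, q s 0 = q₀
  compat : z true 0 = z false 0
  p_zero : ∀ s, (z s 0).2 = 0
  center : ∀ s k, P₀ (pt (q s 0 k)) ((z s 0).1 k - pt (q s 0 k)) = 0
  isOk : ∀ s j k, j ≤ J → ok (q s j k)
  isNear : ∀ s j k, j < J → near s (pt (q s j k)) (pt (q s (j + 1) k))
  orbit : ∀ s j, j < J → z s (j + 1) = Ψ s (z s j)
  boundary : ∀ s k, P (!s) (pt (q s J k)) ((z s J).1 k - pt (q s J k)) = 0
  size : ∀ s j k, j ≤ J → ‖(z s j).1 k - pt (q s j k)‖ ≤ ρ / 10 - ρ / 50 * (1 / 2) ^ (J - j)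

section Extension

variable {f : Vec n → Vec n} {ψ : ℝ → Vec n → Vec n} {τ : ℝ} {Λ : Set (Vec n)}
  {P : Bool → Vec n → (Vec n →L[ℝ] Vec n)} {P₀ : Vec n → (Vec n →L[ℝ] Vec n)}
  {near : Bool → Vec n → Vec n → Prop} {Ψ : Bool → LState n m → LState n m}
  {K lam κ R ρ γ α : ℝ}

/-- Boundedness of `Λ` and of the projections makes the family bounded in `k`, so `seqOf` takes its
intended value. The same reason applies to `windowMap_succ`. -/
theorem windowMap_zero (hyp : HypData f ψ Λ P P₀ K lam) {x : Bool → ℕ → ℤ → Vec n} {J : ℕ}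
    {s : Bool} (hx : ∀ k, x s 0 k ∈ Λ) (u₀ u : Bool × ℕ → LState n m) :
    (windowMap Ψ P P₀ x J u₀ u (s, 0)).2 = 0 ∧ ∀ k, (windowMap Ψ P P₀ x J u₀ u (s, 0)).1 k =
      x s 0 k + P true (x s 0 k) ((Ψ true (u (false, 1))).1 k - x s 0 k) +
      P false (x s 0 k) ((Ψ false (u (true, 1))).1 k - x s 0 k) := by
  refine ⟨rfl, fun k => ?_⟩
  obtain ⟨B, hB⟩ := hyp.compact.isBounded.exists_norm_le
  have hK : 0 ≤ K := by linarith [hyp.one_le]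
  refine seqOf_apply (C := B + K * (‖(Ψ true (u (false, 1))).1‖ + B) +
    K * (‖(Ψ false (u (true, 1))).1‖ + B)) (fun k => ?_) k
  have h1 : ∀ (σ : Bool) (w : LInf (Vec n)), ‖P σ (x s 0 k) (w k - x s 0 k)‖ ≤ K * (‖w‖ + B) := by
    intro σ w
    refine (ContinuousLinearMap.le_opNorm _ _).trans (mul_le_mul (hyp.norm σ _ (hx k)) ?_
      (norm_nonneg _) hK)
    exact (norm_sub_le _ _).trans (add_le_add (LInf.apply_le w k) (hB _ (hx k)))
  exact norm_add₃_le.trans (add_le_add (add_le_add (hB _ (hx k)) (h1 _ _)) (h1 _ _))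

theorem windowMap_succ (hyp : HypData f ψ Λ P P₀ K lam) {x : Bool → ℕ → ℤ → Vec n} {J j : ℕ}
    (hj : j ≤ J) {s : Bool} (hx : ∀ k, x s (j + 1) k ∈ Λ) (u₀ u : Bool × ℕ → LState n m) :
    (windowMap Ψ P P₀ x J u₀ u (s, j + 1)).2 = (Ψ s (u (s, j))).2 ∧
    ∀ k, (windowMap Ψ P P₀ x J u₀ u (s, j + 1)).1 k = x s (j + 1) k +
        (P s (x s (j + 1) k) ((Ψ s (u (s, j))).1 k - x s (j + 1) k) +
          P₀ (x s (j + 1) k) ((Ψ s (u (s, j))).1 k - x s (j + 1) k)) +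
        (if j < J then P (!s) (x s (j + 1) k) ((Ψ (!s) (u (s, j + 2))).1 k - x s (j + 1) k)
          else 0) := by
  rw [windowMap, if_pos hj]
  refine ⟨rfl, fun k => ?_⟩
  obtain ⟨B, hB⟩ := hyp.compact.isBounded.exists_norm_le
  have hK : 0 ≤ K := by linarith [hyp.one_le]
  refine seqOf_apply (C := B + (K * (‖(Ψ s (u (s, j))).1‖ + B) + K * (‖(Ψ s (u (s, j))).1‖ + B)) +
    K * (‖(Ψ (!s) (u (s, j + 2))).1‖ + B)) (fun k => ?_) k
  have hB0 : 0 ≤ B := (norm_nonneg _).trans (hB _ (hx k))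
  have h1 : ∀ (A : Vec n →L[ℝ] Vec n) (w : LInf (Vec n)), ‖A‖ ≤ K →
      ‖A (w k - x s (j + 1) k)‖ ≤ K * (‖w‖ + B) := by
    intro A w hA
    refine (ContinuousLinearMap.le_opNorm _ _).trans (mul_le_mul hA ?_ (norm_nonneg _) hK)
    exact (norm_sub_le _ _).trans (add_le_add (LInf.apply_le w k) (hB _ (hx k)))
  refine norm_add₃_le.trans (add_le_add (add_le_add (hB _ (hx k)) ((norm_add_le _ _).trans
    (add_le_add (h1 _ _ (hyp.norm _ _ (hx k))) (h1 _ _ (hyp.norm₀ _ (hx k)))))) ?_)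
  split_ifs
  · exact h1 _ _ (hyp.norm _ _ (hx k))
  · rw [norm_zero]; positivity

theorem windowMap_of_lt {x : Bool → ℕ → ℤ → Vec n} {J j : ℕ} (hj : J < j) (s : Bool)
    (u₀ u : Bool × ℕ → LState n m) :
    windowMap Ψ P P₀ x J u₀ u (s, j + 1) = u₀ (s, j + 1) := by
  rw [windowMap, if_neg (by omega)]

/-- A fixed point of `windowMap` is an orbit on the time window. -/
theorem orbit_of_windowMap_fixed (hyp : HypData f ψ Λ P P₀ K lam)
    (st : ShadowStep ψ τ Λ P P₀ near Ψ K κ R ρ γ α) {x : Bool → ℕ → ℤ → Vec n} {J : ℕ}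
    {u₀ u : Bool × ℕ → LState n m} (hx : ∀ s j k, j ≤ J + 1 → x s j k ∈ Λ)
    (hx0 : x true 0 = x false 0)
    (hnear : ∀ s j k, j < J + 1 → near s (x s j k) (x s (j + 1) k))
    (hsize : ∀ s j k, j ≤ J + 1 → ‖(u (s, j)).1 k - x s j k‖ ≤ ρ)
    (hfix : windowMap Ψ P P₀ x J u₀ u = u) :
    u (true, 0) = u (false, 0) ∧ (∀ s, (u (s, 0)).2 = 0) ∧
      (∀ s k, P₀ (x s 0 k) ((u (s, 0)).1 k - x s 0 k) = 0) ∧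
      (∀ s k, P (!s) (x s (J + 1) k) ((u (s, J + 1)).1 k - x s (J + 1) k) = 0) ∧
      ∀ s j, j < J + 1 → u (s, j + 1) = Ψ s (u (s, j)) := by
  have hz : ∀ s, (u (s, 0)).2 = 0 ∧ ∀ k, (u (s, 0)).1 k - x s 0 k =
      P true (x s 0 k) ((Ψ true (u (false, 1))).1 k - x s 0 k) +
      P false (x s 0 k) ((Ψ false (u (true, 1))).1 k - x s 0 k) := by
    intro s
    have h1 := windowMap_zero (Ψ := Ψ) (J := J) hyp (fun k => hx s 0 k (by omega)) u₀ u
    rw [hfix] at h1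
    exact ⟨h1.1, fun k => by rw [h1.2 k]; abel⟩
  have hs : ∀ s j, j ≤ J → (u (s, j + 1)).2 = (Ψ s (u (s, j))).2 ∧
      ∀ k, (u (s, j + 1)).1 k - x s (j + 1) k =
        (P s (x s (j + 1) k) ((Ψ s (u (s, j))).1 k - x s (j + 1) k) +
          P₀ (x s (j + 1) k) ((Ψ s (u (s, j))).1 k - x s (j + 1) k)) +
        (if j < J then P (!s) (x s (j + 1) k) ((Ψ (!s) (u (s, j + 2))).1 k - x s (j + 1) k)
          else 0) := by
    intro s j hj
    have h1 := windowMap_succ (Ψ := Ψ) hyp hj (fun k => hx s (j + 1) k (by omega)) u₀ u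
    rw [hfix] at h1
    exact ⟨h1.1, fun k => by rw [h1.2 k]; abel⟩
  have hcross : ∀ s, ∀ y ∈ Λ, ∀ v, P (!s) y (P s y v) = 0 := fun s y hy v => by
    have := hyp.cross (!s) y hy v
    rwa [Bool.not_not] at this
  refine ⟨?_, fun s => (hz s).1, fun s k => ?_, fun s k => ?_, fun s j hj => ?_⟩
  · refine Prod.ext (lp.ext (funext fun k => ?_)) ((hz true).1.trans (hz false).1.symm)
    have h1 := (hz true).2 k
    have h2 := (hz false).2 k
    rw [hx0] at h1
    rw [← h2] at h1
    exact sub_left_injective h1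
  · rw [(hz s).2 k, map_add, hyp.cross₀' _ (hx s 0 k (by omega)),
      hyp.cross₀' _ (hx s 0 k (by omega)), add_zero]
  · rw [(hs s J le_rfl).2 k, if_neg (lt_irrefl _), add_zero, map_add,
      hcross s _ (hx s (J + 1) k le_rfl), hyp.cross₀ _ _ (hx s (J + 1) k le_rfl), add_zero]
  · have hxj := fun k => hx s j k (by omega)
    have hxj1 := fun k => hx s (j + 1) k (by omega)
    -- The fixed point equation prescribes the components `P s`, `P₀` and `p` at `j + 1` by the
    -- image of the state at `j`, and the component `P (!s)` at `j` by the backward image of the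
    -- state at `j + 1`. So the difference of the two candidates at `j + 1` lies in the range of `P
    -- (!s)`, and its backward image has no component there: the situation of `unique` for the
    -- direction `!s`.
    refine st.unique (!s) (u (s, j + 1)) (Ψ s (u (s, j))) (x s (j + 1)) (x s j) hxj1 hxj
      (fun k => st.near_symm _ _ _ (hnear s j k hj))
      (fun k => (hsize s (j + 1) k (by omega)).trans st.ρ_le)
      (fun k => st.crude s (u (s, j)) k _ _ (hnear s j k hj) (hsize s j k (by omega)))
      (fun k => ?_) (hs s j (by omega)).1 (fun k => ?_)
    · have h1 := (hs s j (by omega)).2 k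
      set a := (u (s, j + 1)).1 k
      set b := (Ψ s (u (s, j))).1 k
      set y := x s (j + 1) k with hy
      have h2 : P s y (a - y) = P s y (b - y) := by
        rw [h1, map_add, map_add, hyp.idem _ _ (hxj1 k), hyp.cross₀ _ _ (hxj1 k)]
        split_ifs
        · rw [hyp.cross _ _ (hxj1 k), add_zero, add_zero]
        · rw [map_zero, add_zero, add_zero]
      have h3 : P₀ y (a - y) = P₀ y (b - y) := by
        rw [h1, map_add, map_add, hyp.idem₀ (hxj1 k), hyp.cross₀' _ (hxj1 k)]
        split_ifs
        · rw [hyp.cross₀' _ (hxj1 k), add_zero, zero_add]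
        · rw [map_zero, add_zero, zero_add]
      have h4 := hyp.sum s y (hxj1 k) (a - b)
      have h5 : a - b = (a - y) - (b - y) := by abel
      have h6 : P s y (a - b) = 0 := by rw [h5, map_sub, h2, sub_self]
      have h7 : P₀ y (a - b) = 0 := by rw [h5, map_sub, h3, sub_self]
      rwa [h6, h7, zero_add, add_zero] at h4
    · rw [st.inv]
      have h1 : P (!s) (x s j k) ((u (s, j)).1 k - x s j k) =
          P (!s) (x s j k) ((Ψ (!s) (u (s, j + 1))).1 k - x s j k) := by
        rcases j with _ | j
        · rw [(hz s).2 k, map_add]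
          cases s
          · rw [Bool.not_false, hyp.idem _ _ (hxj k)]
            have := hyp.cross true _ (hxj k)
            rw [Bool.not_true] at this
            rw [this, add_zero]
          · rw [Bool.not_true, hyp.idem _ _ (hxj k)]
            have := hyp.cross false _ (hxj k)
            rw [Bool.not_false] at this
            rw [this, zero_add]
        · rw [(hs s j (by omega)).2 k, if_pos (by omega), map_add, map_add,
            hcross s _ (hxj k), hyp.cross₀ _ _ (hxj k), hyp.idem _ _ (hxj k), zero_add, zero_add]
      rw [← sub_sub_sub_cancel_right _ _ (x s j k), map_sub, h1, sub_self]

/-- `windowMap` contracts the weighted norm. -/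
theorem windowMap_contract (hyp : HypData f ψ Λ P P₀ K lam)
    (st : ShadowStep ψ τ Λ P P₀ near Ψ K κ R ρ γ α) {x : Bool → ℕ → ℤ → Vec n} {J : ℕ}
    {u₀ u v : Bool × ℕ → LState n m} (hx : ∀ s j k, j ≤ J + 1 → x s j k ∈ Λ)
    (hx0 : x true 0 = x false 0)
    (hnear : ∀ s j k, j < J + 1 → near s (x s j k) (x s (j + 1) k))
    (hu : ∀ s j k, j ≤ J + 1 → ‖(u (s, j)).1 k - x s j k‖ ≤ R)
    (hv : ∀ s j k, j ≤ J + 1 → ‖(v (s, j)).1 k - x s j k‖ ≤ R) {d : ℝ} (hd : 0 ≤ d)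
    (huv : ∀ i : Bool × ℕ, wnorm κ (u i - v i) ≤ d * (8 * (K + 3)) ^ i.2) (i : Bool × ℕ) :
    wnorm κ (windowMap Ψ P P₀ x J u₀ u i - windowMap Ψ P P₀ x J u₀ v i) ≤
      d / 2 * (8 * (K + 3)) ^ i.2 := by
  have hκ := st.κ_pos
  have hK := hyp.one_le
  -- The contribution of the inner neighbour is measured with the smaller weight `μ ^ j`, which
  -- makes even the growth factors `K + 1` of `P₀` and `2` of `p` harmless. The contribution of the
  -- outer neighbour loses a factor `μ`, but only its contracted component is used, with the factor
  -- `1 / (16 μ)`.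
  set μ := 8 * (K + 3) with hμ
  have hμ0 : 0 < μ := by linarith
  have h128 : 128 * (K + 3) = 16 * μ := by rw [hμ]; ring
  -- estimates for the contributions of the two neighbours
  have inner : ∀ s j, j ≤ J → ∀ k,
      ‖P s (x s (j + 1) k) ((Ψ s (u (s, j))).1 k - (Ψ s (v (s, j))).1 k)‖ ≤
        d * μ ^ j / (16 * μ) ∧
      ‖P₀ (x s (j + 1) k) ((Ψ s (u (s, j))).1 k - (Ψ s (v (s, j))).1 k)‖ ≤
        (K + 1) * (d * μ ^ j) ∧
      ‖(Ψ s (u (s, j))).2 k - (Ψ s (v (s, j))).2 k‖ ≤ 2 * (d * μ ^ j) / κ := by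
    intro s j hj
    have h1 := (wnorm_sub_le_iff hκ).mp (huv (s, j))
    rw [← h128]
    exact st.lip s (d * μ ^ j) _ _ (x s j) (x s (j + 1)) (by positivity)
      (fun k => hx s j k (by omega)) (fun k => hx s (j + 1) k (by omega))
      (fun k => hnear s j k (by omega)) (fun k => hu s j k (by omega))
      (fun k => hv s j k (by omega)) h1.1 h1.2
  have outer : ∀ s j, j ≤ J → ∀ k,
      ‖P (!s) (x s j k) ((Ψ (!s) (u (s, j + 1))).1 k - (Ψ (!s) (v (s, j + 1))).1 k)‖ ≤
        d * μ ^ j / 16 := by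
    intro s j hj k
    have h1 := (wnorm_sub_le_iff hκ).mp (huv (s, j + 1))
    have := (st.lip (!s) (d * μ ^ (j + 1)) _ _ (x s (j + 1)) (x s j) (by positivity)
      (fun k => hx s (j + 1) k (by omega)) (fun k => hx s j k (by omega))
      (fun k => st.near_symm _ _ _ (hnear s j k (by omega)))
      (fun k => hu s (j + 1) k (by omega)) (fun k => hv s (j + 1) k (by omega)) h1.1 h1.2 k).1
    refine this.trans (le_of_eq ?_)
    rw [h128, pow_succ]
    field_simp
  obtain ⟨s, j⟩ := i
  rw [wnorm_sub_le_iff hκ]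
  rcases j with _ | j
  · have hxk := fun k => hx s 0 k (by omega)
    obtain ⟨hu1, hu2⟩ := windowMap_zero (Ψ := Ψ) (J := J) hyp hxk u₀ u
    obtain ⟨hv1, hv2⟩ := windowMap_zero (Ψ := Ψ) (J := J) hyp hxk u₀ v
    refine ⟨fun k => ?_, fun k => by rw [hu1, hv1, sub_self, norm_zero]; positivity⟩
    have e1 := outer false 0 (by omega) k
    have e2 := outer true 0 (by omega) k
    have hxs : ∀ σ, x σ 0 k = x s 0 k := by
      intro σ; cases σ <;> cases s <;> simp [hx0]
    rw [hxs, Bool.not_false] at e1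
    rw [hxs, Bool.not_true] at e2
    have e3 : (windowMap Ψ P P₀ x J u₀ u (s, 0)).1 k - (windowMap Ψ P P₀ x J u₀ v (s, 0)).1 k =
        P true (x s 0 k) ((Ψ true (u (false, 0 + 1))).1 k - (Ψ true (v (false, 0 + 1))).1 k) +
        P false (x s 0 k) ((Ψ false (u (true, 0 + 1))).1 k - (Ψ false (v (true, 0 + 1))).1 k) := by
      rw [hu2, hv2]
      simp only [map_sub]
      abel
    rw [e3]
    refine (norm_add_le _ _).trans ?_
    simp only [pow_zero, mul_one] at e1 e2 ⊢
    linarith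
  · rcases le_or_gt j J with hj | hj
    · have hxk := fun k => hx s (j + 1) k (by omega)
      obtain ⟨hu1, hu2⟩ := windowMap_succ (Ψ := Ψ) hyp hj hxk u₀ u
      obtain ⟨hv1, hv2⟩ := windowMap_succ (Ψ := Ψ) hyp hj hxk u₀ v
      have hpow : d * μ ^ j = d * μ ^ (j + 1) / μ := by rw [pow_succ]; field_simp
      set D := d * μ ^ (j + 1) with hD
      have hD0 : 0 ≤ D := by positivity
      have hDμ : D / μ ≤ D / 32 := div_le_div_of_nonneg_left hD0 (by norm_num) (by linarith)
      have hKμ : (K + 1) * (D / μ) ≤ D / 8 := by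
        rw [mul_div_assoc', div_le_div_iff₀ hμ0 (by norm_num)]
        nlinarith
      refine ⟨fun k => ?_, fun k => ?_⟩
      · obtain ⟨e1, e2, -⟩ := inner s j hj k
        rw [hpow] at e1 e2
        have e1' : D / μ / (16 * μ) ≤ D / 32 :=
          (div_le_self (by positivity) (by linarith)).trans hDμ
        have e3 : (windowMap Ψ P P₀ x J u₀ u (s, j + 1)).1 k -
            (windowMap Ψ P P₀ x J u₀ v (s, j + 1)).1 k =
            P s (x s (j + 1) k) ((Ψ s (u (s, j))).1 k - (Ψ s (v (s, j))).1 k) +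
            P₀ (x s (j + 1) k) ((Ψ s (u (s, j))).1 k - (Ψ s (v (s, j))).1 k) +
            (if j < J then P (!s) (x s (j + 1) k) ((Ψ (!s) (u (s, j + 1 + 1))).1 k -
              (Ψ (!s) (v (s, j + 1 + 1))).1 k) else 0) := by
          rw [hu2, hv2]
          split_ifs
          · simp only [map_sub]; abel
          · simp only [map_sub]; abel
        rw [e3]
        refine norm_add₃_le.trans ?_
        have e4 : ‖(if j < J then P (!s) (x s (j + 1) k) ((Ψ (!s) (u (s, j + 1 + 1))).1 k -
              (Ψ (!s) (v (s, j + 1 + 1))).1 k) else 0)‖ ≤ D / 16 := by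
          split_ifs with h
          · exact outer s (j + 1) (by omega) k
          · rw [norm_zero]; positivity
        have : d / 2 * μ ^ (j + 1) = D / 2 := by rw [hD]; ring
        change _ ≤ d / 2 * μ ^ (j + 1)
        rw [this]
        linarith
      · rw [hu1, hv1]
        refine ((inner s j hj k).2.2).trans ?_
        refine div_le_div_of_nonneg_right ?_ hκ.le
        rw [hpow]
        change _ ≤ d / 2 * μ ^ (j + 1)
        have : d / 2 * μ ^ (j + 1) = D / 2 := by rw [hD]; ring
        rw [this]
        linarith
    · rw [windowMap_of_lt hj, windowMap_of_lt hj]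
      exact ⟨fun k => by rw [sub_self, norm_zero]; positivity,
        fun k => by rw [sub_self, norm_zero]; positivity⟩

end Extension

end LDS


/-! ### Extension of windows, and controlled shadowing on the whole time axis. -/

namespace LDS

variable {n m : ℕ}

theorem add_sub_eq_neg_of_sum {E : Type*} [AddCommGroup E] {x w a b c : E}
    (h : a + b + c = w - x) : x + (a + c) - w = -b := by
  obtain rfl : w = x + (a + b + c) := by rw [h]; abel
  abel

theorem base_add_sub_of_sum {E : Type*} [NormedAddCommGroup E] [NormedSpace ℝ E]
    {A B : E →L[ℝ] E} {x z a b : E} (h : A (z - x) + B (z - x) = z - x) :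
    x + A (a - x) + B (b - x) - z = A (a - z) + B (b - z) := by
  have h1 : x + A (a - x) + B (b - x) - z = A (a - x) + B (b - x) - (z - x) := by abel
  rw [h1, ← h]
  simp only [map_sub]
  abel

theorem base_add_sub_of_sum₃ {E : Type*} [NormedAddCommGroup E] [NormedSpace ℝ E]
    {A B C : E →L[ℝ] E} {x z b : E} (h : A (z - x) + B (z - x) + C (z - x) = z - x) :
    x + (A (z - x) + C (z - x)) + B (b - x) - z = B (b - z) := by
  have h1 : x + (A (z - x) + C (z - x)) + B (b - x) - z =
      A (z - x) + C (z - x) + B (b - x) - (z - x) := by abel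
  rw [h1]
  nth_rw 3 [← h]
  simp only [map_sub]
  abel

section Extension

variable {f : Vec n → Vec n} {ψ : ℝ → Vec n → Vec n} {τ : ℝ} {Λ : Set (Vec n)}
  {P : Bool → Vec n → (Vec n →L[ℝ] Vec n)} {P₀ : Vec n → (Vec n →L[ℝ] Vec n)}
  {near : Bool → Vec n → Vec n → Prop} {Ψ : Bool → LState n m → LState n m}
  {K lam κ R ρ γ α : ℝ}

set_option maxHeartbeats 1000000 in
/-- A solution of the boundary value problem on a window extends to the next larger one, after a
correction that decays geometrically away from the ends of the window. -/
theorem WindowSol.exists_extension (hyp : HypData f ψ Λ P P₀ K lam)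
    (st : ShadowStep ψ τ Λ P P₀ near Ψ K κ R ρ γ α) {Q : Type} {pt : Q → Vec n}
    {ok : Q → Prop} (adv : Bool → ℕ → ℤ → Q → Vec m → ℝ → Q) (hok : ∀ q, ok q → pt q ∈ Λ)
    (hadv : ∀ s j k q p a, ok q → |a| ≤ τ → ok (adv s j k q p a) ∧
      ‖ψ (sg s * (τ + a)) (pt q) - pt (adv s j k q p a)‖ ≤ γ) (hατ : α ≤ τ)
    {q₀ : ℤ → Q} {J : ℕ} {q : Bool → ℕ → ℤ → Q} {z : Bool → ℕ → LState n m}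
    (h : WindowSol pt ok P P₀ near Ψ ρ q₀ J q z) :
    ∃ (q' : Bool → ℕ → ℤ → Q) (z' : Bool → ℕ → LState n m),
      WindowSol pt ok P P₀ near Ψ ρ q₀ (J + 1) q' z' ∧ (∀ s j, j ≤ J → q' s j = q s j) ∧
      (∀ s k, ∃ a, |a| ≤ α ∧ q' s (J + 1) k = adv s J k (q s J k) ((z s J).2 k) a) ∧
      ∀ s j, j ≤ J → wnorm κ (z' s j - z s j) ≤ ρ / 50 * (1 / 2) ^ (J + 1 - j) := by
  have hκ := st.κ_pos
  have hK := hyp.one_le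
  have hρ := st.ρ_pos
  have hρR := st.ρ_le
  have hzρ : ∀ s j k, j ≤ J → ‖(z s j).1 k - pt (q s j k)‖ ≤ ρ / 10 := fun s j k hj =>
    (h.size s j k hj).trans (by have : (0 : ℝ) ≤ ρ / 50 * (1 / 2) ^ (J - j) := by positivity
                                linarith)
  -- The boundary condition of the old window says that its end has no component `P (!s)`, which is
  -- just what `create` needs to bound this component, expanded in the direction `s`, after one more
  -- step.
  have hcr : ∀ s k, ∃ a, |a| ≤ α ∧
      near s (pt (q s J k)) (pt (adv s J k (q s J k) ((z s J).2 k) a)) ∧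
      ‖P₀ (pt (adv s J k (q s J k) ((z s J).2 k) a)) ((Ψ s (z s J)).1 k -
        pt (adv s J k (q s J k) ((z s J).2 k) a))‖ ≤ ρ / 100 ∧
      ‖P s (pt (adv s J k (q s J k) ((z s J).2 k) a)) ((Ψ s (z s J)).1 k -
        pt (adv s J k (q s J k) ((z s J).2 k) a))‖ ≤ ρ / 100 ∧
      ‖P (!s) (pt (adv s J k (q s J k) ((z s J).2 k) a)) ((Ψ s (z s J)).1 k -
        pt (adv s J k (q s J k) ((z s J).2 k) a))‖ ≤ ρ / 100 := by
    intro s k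
    have hq := h.isOk s J k le_rfl
    obtain ⟨a, h1, h2, h3, h4, h5⟩ := st.create s (z s J) k (pt (q s J k))
      (fun a => pt (adv s J k (q s J k) ((z s J).2 k) a)) (hok _ hq)
      (fun a ha => ⟨hok _ (hadv s J k _ _ a hq ha).1, (hadv s J k _ _ a hq ha).2⟩)
      ((hzρ s J k le_rfl).trans (by linarith))
    exact ⟨a, h1, h2, h3, h4, h5 (h.boundary s k)⟩
  choose a ha hanear ha0 has hans using hcr
  set q' : Bool → ℕ → ℤ → Q := fun s j k =>
    if j ≤ J then q s j k else adv s J k (q s J k) ((z s J).2 k) (a s k) with hq'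
  have hq'le : ∀ s j, j ≤ J → q' s j = q s j := fun s j hj => by
    funext k; rw [hq']; exact if_pos hj
  have hq'S : ∀ s k, q' s (J + 1) k = adv s J k (q s J k) ((z s J).2 k) (a s k) := fun s k => by
    rw [hq']; exact if_neg (by omega)
  have hq'ok : ∀ s j k, j ≤ J + 1 → ok (q' s j k) := by
    intro s j k hj
    rcases Nat.lt_or_ge J j with h1 | h1
    · obtain rfl : j = J + 1 := by omega
      rw [hq'S]
      exact (hadv s J k _ _ _ (h.isOk s J k le_rfl) ((ha s k).trans hατ)).1
    · rw [hq'le s j h1]; exact h.isOk s j k h1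
  set x : Bool → ℕ → ℤ → Vec n := fun s j k => pt (q' s j k) with hx
  have hxle : ∀ s j k, j ≤ J → x s j k = pt (q s j k) := fun s j k hj => by
    rw [hx]; simp only [hq'le s j hj]
  have hxS : ∀ s k, x s (J + 1) k = pt (adv s J k (q s J k) ((z s J).2 k) (a s k)) :=
    fun s k => by rw [hx]; simp only [hq'S]
  have hxΛ : ∀ s j k, j ≤ J + 1 → x s j k ∈ Λ := fun s j k hj => hok _ (hq'ok s j k hj)
  have hx0 : x true 0 = x false 0 := by
    funext k; rw [hxle _ _ _ (Nat.zero_le _), hxle _ _ _ (Nat.zero_le _), h.start, h.start]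
  have hnear : ∀ s j k, j < J + 1 → near s (x s j k) (x s (j + 1) k) := by
    intro s j k hj
    rcases Nat.lt_or_ge j J with h1 | h1
    · rw [hxle s j k h1.le, hxle s (j + 1) k h1]; exact h.isNear s j k h1
    · obtain rfl : j = J := by omega
      rw [hxle s j k le_rfl, hxS]; exact hanear s k
  simp only [← hxS] at ha0 has hans
  -- The initial guess is the old orbit, prolonged by its image without the component `P (!s)`,
  -- which gives the new boundary condition. At the index `J + 1` the map `windowMap` uses only the
  -- state at `J`, so any family that agrees with the old orbit there may be inserted in place of
  -- `ζ`.
  set ζ : Bool × ℕ → LState n m := fun i => z i.1 i.2 with hζ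
  set u₀ : Bool × ℕ → LState n m := fun i => if i.2 ≤ J then z i.1 i.2 else
    windowMap Ψ P P₀ x J ζ ζ (i.1, J + 1) with hu₀
  have hu₀le : ∀ s j, j ≤ J → u₀ (s, j) = z s j := fun s j hj => by rw [hu₀]; exact if_pos hj
  have hu₀S : ∀ s, u₀ (s, J + 1) = windowMap Ψ P P₀ x J ζ ζ (s, J + 1) := fun s => by
    rw [hu₀]; exact if_neg (by simp)
  have hu₀v : ∀ s, (u₀ (s, J + 1)).2 = (Ψ s (z s J)).2 ∧ ∀ k, (u₀ (s, J + 1)).1 k =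
      x s (J + 1) k + (P s (x s (J + 1) k) ((Ψ s (z s J)).1 k - x s (J + 1) k) +
          P₀ (x s (J + 1) k) ((Ψ s (z s J)).1 k - x s (J + 1) k)) := by
    intro s
    rw [hu₀S]
    have := windowMap_succ (Ψ := Ψ) (s := s) hyp (le_refl J) (fun k => hxΛ s (J + 1) k le_rfl) ζ ζ
    refine ⟨this.1, fun k => ?_⟩
    rw [this.2 k, if_neg (lt_irrefl _), add_zero]
  have hu₀x : ∀ s k, ‖(u₀ (s, J + 1)).1 k - x s (J + 1) k‖ ≤ ρ / 50 := by
    intro s k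
    rw [(hu₀v s).2 k, add_sub_cancel_left]
    refine (norm_add_le _ _).trans ?_
    linarith [has s k, ha0 s k]
  have hu₀w : ∀ s k, ‖(u₀ (s, J + 1)).1 k - (Ψ s (z s J)).1 k‖ ≤ ρ / 100 := by
    intro s k
    have h1 := hyp.sum s _ (hxΛ s (J + 1) k le_rfl) ((Ψ s (z s J)).1 k - x s (J + 1) k)
    have h2 : (u₀ (s, J + 1)).1 k - (Ψ s (z s J)).1 k =
        -P (!s) (x s (J + 1) k) ((Ψ s (z s J)).1 k - x s (J + 1) k) := by
      rw [(hu₀v s).2 k]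
      exact add_sub_eq_neg_of_sum h1
    rw [h2, norm_neg]
    exact hans s k
  set μ := 8 * (K + 3) with hμ
  have hμ0 : 0 < μ := by linarith
  have hμ2 : 2 ≤ μ := by linarith
  have h128 : 128 * (K + 3) = 16 * μ := by rw [hμ]; ring
  -- The initial guess violates the equations only at the indices `J`, where the backward image of
  -- the truncated end point is off by at most `(ρ / 100) / (16 μ)`. This equals `d * μ ^ J`. At the
  -- centre both halves may contribute, whence the bound `2 * d` below.
  set d := ρ / 1600 / μ ^ (J + 1) with hd
  have hd0 : 0 < d := by positivity
  have outer : ∀ s j, j ≤ J → ∀ k,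
      ‖P (!s) (x s j k) ((Ψ (!s) (u₀ (s, j + 1))).1 k - (z s j).1 k)‖ ≤ d * μ ^ j := by
    intro s j hj k
    rcases Nat.lt_or_ge j J with h1 | h1
    · rw [hu₀le s (j + 1) h1, h.orbit s j h1, st.inv, sub_self, map_zero, norm_zero]
      positivity
    · obtain rfl : j = J := by omega
      have h2 := (st.lip (!s) (ρ / 100) (u₀ (s, j + 1)) (Ψ s (z s j)) (x s (j + 1)) (x s j)
        (by positivity) (fun k => hxΛ s (j + 1) k le_rfl) (fun k => hxΛ s j k (by omega))
        (fun k => st.near_symm _ _ _ (hnear s j k (by omega)))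
        (fun k => (hu₀x s k).trans (by linarith))
        (fun k => st.crude s (z s j) k _ _ (hnear s j k (by omega))
          (by rw [hxle s j k le_rfl]; exact (hzρ s j k le_rfl).trans (by linarith)))
        (hu₀w s) (fun k => by rw [(hu₀v s).1, sub_self, norm_zero]; positivity) k).1
      rw [st.inv] at h2
      refine h2.trans (le_of_eq ?_)
      rw [h128, hd, pow_succ]
      field_simp
      norm_num
  have hpow : ∀ j, j ≤ J + 1 → 2 * (2 * d) * μ ^ j ≤ ρ / 400 * (1 / 2) ^ (J + 1 - j) := by
    intro j hj
    have h1 : μ ^ (J + 1) = μ ^ j * μ ^ (J + 1 - j) := by rw [← pow_add]; congr 1; omega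
    have h2 : 2 * (2 * d) * μ ^ j = ρ / 400 * (1 / μ) ^ (J + 1 - j) := by
      rw [hd, h1, one_div_pow]; field_simp; norm_num
    rw [h2]
    gcongr
  -- The size bound loosens from `ρ/10 - ρ/50 · 2^-(J-j)` to the same expression with `J + 1`. This
  -- leaves room `ρ/100 · 2^-(J-j)` for a correction of at most `ρ/800 · 2^-(J-j)`, so the bounds
  -- never exceed `ρ / 10`.
  have hsz : ∀ u : Bool × ℕ → LState n m, (∀ i, wnorm κ (u i - u₀ i) ≤ 2 * (2 * d) * μ ^ i.2) →
      ∀ s j k, j ≤ J + 1 →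
        ‖(u (s, j)).1 k - x s j k‖ ≤ ρ / 10 - ρ / 50 * (1 / 2) ^ (J + 1 - j) := by
    intro u hu s j k hj
    have h1 := ((wnorm_sub_le_iff hκ).mp ((hu (s, j)).trans (hpow j hj))).1 k
    have h2 := norm_sub_le_norm_sub_add_norm_sub ((u (s, j)).1 k) ((u₀ (s, j)).1 k) (x s j k)
    rcases Nat.lt_or_ge J j with h3 | h3
    · obtain rfl : j = J + 1 := by omega
      have := hu₀x s k
      simp only [Nat.sub_self, pow_zero, mul_one] at h1 ⊢
      linarith
    · have h4 := h.size s j k h3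
      rw [← hxle s j k h3] at h4
      rw [hu₀le s j h3] at h1 h2
      have h5 : ((1 : ℝ) / 2) ^ (J + 1 - j) = (1 / 2) ^ (J - j) * (1 / 2) := by
        rw [← pow_succ]; congr 1; omega
      have h6 : 0 < ρ * (1 / 2) ^ (J - j) := by positivity
      rw [h5] at h1 ⊢
      linarith
  have hszρ : ∀ u : Bool × ℕ → LState n m, (∀ i, wnorm κ (u i - u₀ i) ≤ 2 * (2 * d) * μ ^ i.2) →
      ∀ s j k, j ≤ J + 1 → ‖(u (s, j)).1 k - x s j k‖ ≤ ρ := fun u hu s j k hj =>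
    (hsz u hu s j k hj).trans (by
      have : (0 : ℝ) ≤ ρ / 50 * (1 / 2) ^ (J + 1 - j) := by positivity
      linarith)
  have hFP : ∃ u, True ∧ windowMap Ψ P P₀ x J u₀ u = u ∧
      ∀ i, wnorm κ (u i - u₀ i) ≤ 2 * (2 * d) * μ ^ i.2 := by
    refine exists_fixedPoint_weighted (wnorm κ) (wnorm_add_le hκ) (continuous_wnorm κ) κ hκ
      (mul_norm_le_wnorm hκ st.κ_le) (wnorm_zero κ) (wnorm_neg κ) (fun i => μ ^ i.2)
      (fun i => by positivity) (fun _ => True) (windowMap Ψ P P₀ x J u₀) u₀ (2 * d) (by positivity)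
      trivial (fun _ _ => trivial) (fun _ _ _ _ => trivial) ?_ ?_
    · rintro ⟨s, j⟩
      rw [wnorm_sub_le_iff hκ]
      rcases j with _ | j
      · obtain ⟨e1, e2⟩ := windowMap_zero (Ψ := Ψ) (s := s) (J := J) hyp
          (fun k => hxΛ s 0 k (by omega)) u₀ u₀
        have hz0 : ∀ σ, z σ 0 = z s 0 := by
          intro σ; cases σ <;> cases s <;> simp [h.compat]
        have hxs : ∀ σ k, x σ 0 k = x s 0 k := by
          intro σ k; cases σ <;> cases s <;> simp [hx0]
        refine ⟨fun k => ?_, fun k => ?_⟩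
        · have o1 := outer false 0 (Nat.zero_le _) k
          have o2 := outer true 0 (Nat.zero_le _) k
          rw [hxs, hz0, Bool.not_false] at o1
          rw [hxs, hz0, Bool.not_true] at o2
          have h1 := hyp.sum true _ (hxΛ s 0 k (by omega)) ((z s 0).1 k - x s 0 k)
          have h2 := h.center s k
          rw [← hxle s 0 k (Nat.zero_le _)] at h2
          rw [h2, add_zero, Bool.not_true] at h1
          have h3 : (windowMap Ψ P P₀ x J u₀ u₀ (s, 0)).1 k - (u₀ (s, 0)).1 k =
              P true (x s 0 k) ((Ψ true (u₀ (false, 0 + 1))).1 k - (z s 0).1 k) +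
              P false (x s 0 k) ((Ψ false (u₀ (true, 0 + 1))).1 k - (z s 0).1 k) := by
            rw [e2, hu₀le s 0 (Nat.zero_le _)]
            exact base_add_sub_of_sum h1
          rw [h3]
          refine (norm_add_le _ _).trans ?_
          simp only [pow_zero, mul_one] at o1 o2 ⊢
          linarith
        · rw [e1, hu₀le s 0 (Nat.zero_le _), h.p_zero, sub_self, norm_zero]
          positivity
      · rcases Nat.lt_trichotomy j J with hj | hj | hj
        · obtain ⟨e1, e2⟩ := windowMap_succ (Ψ := Ψ) (s := s) hyp hj.le
            (fun k => hxΛ s (j + 1) k (by omega)) u₀ u₀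
          rw [hu₀le s j hj.le, ← h.orbit s j hj] at e1 e2
          refine ⟨fun k => ?_, fun k => ?_⟩
          · have h1 := hyp.sum s _ (hxΛ s (j + 1) k (by omega)) ((z s (j + 1)).1 k - x s (j + 1) k)
            have h3 : (windowMap Ψ P P₀ x J u₀ u₀ (s, j + 1)).1 k - (u₀ (s, j + 1)).1 k =
                P (!s) (x s (j + 1) k) ((Ψ (!s) (u₀ (s, j + 1 + 1))).1 k - (z s (j + 1)).1 k) := by
              rw [e2, hu₀le s (j + 1) hj, if_pos hj]
              exact base_add_sub_of_sum₃ h1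
            rw [h3]
            refine (outer s (j + 1) hj k).trans ?_
            have : 0 ≤ d * μ ^ (j + 1) := by positivity
            simp only
            linarith
          · rw [e1, hu₀le s (j + 1) hj, sub_self, norm_zero]; positivity
        · subst hj
          obtain ⟨e1, e2⟩ := windowMap_succ (Ψ := Ψ) (s := s) hyp le_rfl
            (fun k => hxΛ s (j + 1) k (by omega)) u₀ u₀
          rw [hu₀le s j le_rfl] at e1 e2
          refine ⟨fun k => ?_, fun k => ?_⟩
          · rw [e2, (hu₀v s).2, if_neg (lt_irrefl _), add_zero, sub_self, norm_zero]; positivity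
          · rw [e1, (hu₀v s).1, sub_self, norm_zero]; positivity
        · rw [windowMap_of_lt hj]
          exact ⟨fun k => by rw [sub_self, norm_zero]; positivity,
            fun k => by rw [sub_self, norm_zero]; positivity⟩
    · intro u v _ _ hu hv e he huv i
      exact windowMap_contract hyp st hxΛ hx0 hnear
        (fun s j k hj => (hszρ u hu s j k hj).trans hρR)
        (fun s j k hj => (hszρ v hv s j k hj).trans hρR) he huv i
  obtain ⟨u, -, hfix, hu⟩ := hFP
  obtain ⟨o1, o2, o3, o4, o5⟩ := orbit_of_windowMap_fixed hyp st hxΛ hx0 hnear (hszρ u hu) hfix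
  refine ⟨q', fun s j => u (s, j), ⟨fun s => ?_, o1, o2, o3, hq'ok, hnear, o5, o4, hsz u hu⟩,
    hq'le, fun s k => ⟨a s k, ha s k, hq'S s k⟩, fun s j hj => ?_⟩
  · rw [hq'le s 0 (Nat.zero_le _), h.start]
  · have := (hu (s, j)).trans (hpow j (by omega))
    rw [hu₀le s j hj] at this
    refine this.trans (mul_le_mul_of_nonneg_right (by linarith) (by positivity))

theorem windowSol_zero (hyp : HypData f ψ Λ P P₀ K lam) (hρ : 0 < ρ) {Q : Type}
    {pt : Q → Vec n} {ok : Q → Prop} (hok : ∀ q, ok q → pt q ∈ Λ) {q₀ : ℤ → Q}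
    (hq₀ : ∀ k, ok (q₀ k)) :
    WindowSol pt ok P P₀ near Ψ ρ q₀ 0 (fun _ _ => q₀)
      (fun _ _ => (seqOf fun k => pt (q₀ k), 0)) := by
  obtain ⟨B, hB⟩ := hyp.compact.isBounded.exists_norm_le
  have h0 : ∀ k, (seqOf fun k => pt (q₀ k)) k - pt (q₀ k) = 0 := fun k => by
    rw [seqOf_apply (C := B) (fun k => hB _ (hok _ (hq₀ k))), sub_self]
  refine ⟨fun _ => rfl, rfl, fun _ => rfl, fun s k => ?_, fun s j k _ => hq₀ k,
    fun s j k hj => absurd hj (Nat.not_lt_zero j), fun s j hj => absurd hj (Nat.not_lt_zero j),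
    fun s k => ?_, fun s j k hj => ?_⟩
  · simp only [h0, map_zero]
  · simp only [h0, map_zero]
  · simp only [h0, norm_zero]
    rw [Nat.zero_sub, pow_zero]
    linarith

/-- Controlled shadowing: the base points of a pseudo-orbit may be chosen step by step, depending
on approximate values `p` of the second component of the orbit that is being constructed. -/
theorem exists_controlled_orbit (hyp : HypData f ψ Λ P P₀ K lam)
    (st : ShadowStep ψ τ Λ P P₀ near Ψ K κ R ρ γ α) {Q : Type} {pt : Q → Vec n}
    {ok : Q → Prop} (adv : Bool → ℕ → ℤ → Q → Vec m → ℝ → Q) (hok : ∀ q, ok q → pt q ∈ Λ)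
    (hadv : ∀ s j k q p a, ok q → |a| ≤ τ → ok (adv s j k q p a) ∧
      ‖ψ (sg s * (τ + a)) (pt q) - pt (adv s j k q p a)‖ ≤ γ) (hατ : α ≤ τ)
    (q₀ : ℤ → Q) (hq₀ : ∀ k, ok (q₀ k)) :
    ∃ (q : Bool → ℕ → ℤ → Q) (p : Bool → ℕ → ℤ → Vec m) (a : Bool → ℕ → ℤ → ℝ)
      (z : Bool → ℕ → LState n m),
      (∀ s, q s 0 = q₀) ∧ (∀ s j k, ok (q s j k)) ∧
      (∀ s j k, q s (j + 1) k = adv s j k (q s j k) (p s j k) (a s j k)) ∧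
      (∀ s j k, |a s j k| ≤ α) ∧ z true 0 = z false 0 ∧ (∀ s, (z s 0).2 = 0) ∧
      (∀ s j, z s (j + 1) = Ψ s (z s j)) ∧
      (∀ s j k, ‖(z s j).1 k - pt (q s j k)‖ ≤ ρ) ∧
      ∀ s j k, ‖(z s j).2 k - p s j k‖ ≤ ρ / κ := by
  have hκ := st.κ_pos
  have hρ := st.ρ_pos
  let Sol : ℕ → (Bool → ℕ → ℤ → Q) × (Bool → ℕ → LState n m) → Prop := fun J S =>
    WindowSol pt ok P P₀ near Ψ ρ q₀ J S.1 S.2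
  have hext : ∀ J (S : {S // Sol J S}), ∃ S' : {S' // Sol (J + 1) S'},
      (∀ s j, j ≤ J → S'.1.1 s j = S.1.1 s j) ∧
      (∀ s k, ∃ a, |a| ≤ α ∧
        S'.1.1 s (J + 1) k = adv s J k (S.1.1 s J k) ((S.1.2 s J).2 k) a) ∧
      ∀ s j, j ≤ J → wnorm κ (S'.1.2 s j - S.1.2 s j) ≤ ρ / 50 * (1 / 2) ^ (J + 1 - j) := by
    rintro J ⟨⟨q, z⟩, h⟩
    obtain ⟨q', z', h1, h2, h3, h4⟩ := WindowSol.exists_extension hyp st adv hok hadv hατ h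
    exact ⟨⟨(q', z'), h1⟩, h2, h3, h4⟩
  choose nx hnx1 hnx2 hnx3 using hext
  -- The window solutions are chosen successively. Base points of earlier indices are kept, while
  -- the states are corrected at each extension.
  let S : ∀ J, {S // Sol J S} := fun J =>
    Nat.rec ⟨(fun _ _ => q₀, fun _ _ => (seqOf fun k => pt (q₀ k), 0)),
      windowSol_zero hyp hρ hok hq₀⟩ (fun J S => nx J S) J
  have hS : ∀ J, S (J + 1) = nx J (S J) := fun J => rfl
  have hstab : ∀ s j i, (S (j + i)).1.1 s j = (S j).1.1 s j := by
    intro s j i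
    induction i with
    | zero => rfl
    | succ i ih => rw [← add_assoc, hS, hnx1 _ _ _ _ (by omega), ih]
  -- At the extension from `j + i` to `j + i + 1` the index `j` is `i + 1` steps away from the new
  -- ends, so its correction is geometrically small in `i`; dividing by `κ` passes from `wnorm` to
  -- the norm.
  have hgeo : ∀ s j i, dist ((S (j + i)).1.2 s j) ((S (j + (i + 1))).1.2 s j) ≤
      ρ / 100 / κ * (1 / 2) ^ i := by
    intro s j i
    have h1 := hnx3 (j + i) (S (j + i)) s j (by omega)
    have h2 := (mul_norm_le_wnorm hκ st.κ_le _).trans h1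
    rw [← hS, ← dist_eq_norm, dist_comm, show j + i + 1 - j = i + 1 by omega, pow_succ] at h2
    rw [div_mul_eq_mul_div, le_div_iff₀ hκ, mul_comm]
    refine h2.trans (le_of_eq (by ring))
  have hlim : ∀ s j, ∃ w, Filter.Tendsto (fun i => (S (j + i)).1.2 s j) Filter.atTop (nhds w) :=
    fun s j => cauchySeq_tendsto_of_complete
      (cauchySeq_of_le_geometric _ _ (by norm_num) (hgeo s j))
  choose z hz using hlim
  choose a ha haq using fun J s k => hnx2 J (S J) s k
  have hdist : ∀ s j, ‖z s j - (S j).1.2 s j‖ ≤ ρ / κ := by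
    intro s j
    have h1 := dist_le_of_le_geometric_of_tendsto₀ _ _ (by norm_num) (hgeo s j) (hz s j)
    rw [add_zero, dist_comm, dist_eq_norm] at h1
    refine h1.trans ?_
    rw [show ρ / 100 / κ / (1 - 1 / 2) = ρ / κ / 50 by field_simp; norm_num]
    exact div_le_self (by positivity) (by norm_num)
  -- The approximate value `p s j k` is the one in the window that ends at `j`, on which the choice
  -- of the next base point was based. All later corrections together change it by at most `ρ / κ`.
  refine ⟨fun s j => (S j).1.1 s j, fun s j k => ((S j).1.2 s j).2 k, fun s j k => a j s k, z,
    fun s => rfl, fun s j k => (S j).2.isOk s j k le_rfl, fun s j k => haq j s k,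
    fun s j k => ha j s k, ?_, fun s => ?_, fun s j => ?_, fun s j k => ?_, fun s j k => ?_⟩
  · refine tendsto_nhds_unique (hz true 0) ((hz false 0).congr fun i => ?_)
    exact (S (0 + i)).2.compat.symm
  · refine tendsto_nhds_unique ((continuous_snd.tendsto _).comp (hz s 0)) ?_
    refine tendsto_const_nhds.congr fun i => ?_
    exact ((S (0 + i)).2.p_zero s).symm
  · refine tendsto_nhds_unique (hz s (j + 1)) ?_
    have h1 := (((st.cont s).tendsto _).comp (hz s j)).comp (Filter.tendsto_add_atTop_nat 1)
    refine h1.congr fun i => ?_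
    have h2 := (S (j + 1 + i)).2.orbit s j (by omega)
    have h3 : j + (i + 1) = j + 1 + i := by omega
    simp only [Function.comp_apply]
    rw [h2, h3]
  · have h1 : Filter.Tendsto (fun i => ‖z s j - (S (j + i)).1.2 s j‖ + ρ) Filter.atTop
        (nhds (0 + ρ)) := by
      refine Filter.Tendsto.add_const _ ?_
      have := (tendsto_const_nhds (x := z s j)).sub (hz s j)
      rw [sub_self] at this
      simpa using this.norm
    rw [zero_add] at h1
    refine ge_of_tendsto' h1 fun i => ?_
    have h2 := (S (j + i)).2.size s j k (by omega)
    rw [hstab] at h2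
    have h3 : (0 : ℝ) ≤ ρ / 50 * (1 / 2) ^ (j + i - j) := by positivity
    have h4 := (LInf.apply_le (z s j - (S (j + i)).1.2 s j).1 k).trans (norm_fst_le _)
    have h5 := norm_sub_le_norm_sub_add_norm_sub ((z s j).1 k) (((S (j + i)).1.2 s j).1 k)
      (pt ((S j).1.1 s j k))
    refine h5.trans (add_le_add h4 (by linarith))
  · exact ((LInf.apply_le (z s j - (S j).1.2 s j).2 k).trans (norm_snd_le _)).trans (hdist s j)

end Extension

end LDS


/-! ### Pseudo-paths in the transitive set. -/

namespace LDS

variable {n : ℕ} {f : Vec n → Vec n} {L τ : ℝ} {ψ : ℝ → Vec n → Vec n} {Λ : Set (Vec n)}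

theorem IsGlobalFlow.lip_of_le {E : Type*} [NormedAddCommGroup E] [NormedSpace ℝ E] {V : E → E}
    {K : ℝ} {φ : ℝ → E → E} (h : IsGlobalFlow V K φ) (hK : 0 ≤ K) {t b : ℝ} (ht : |t| ≤ b)
    (x y : E) : ‖φ t x - φ t y‖ ≤ Real.exp (K * b) * ‖x - y‖ :=
  (h.lip t x y).trans (mul_le_mul_of_nonneg_right
    (Real.exp_le_exp.mpr (mul_le_mul_of_nonneg_left ht hK)) (norm_nonneg _))

theorem exists_forall_le_of_finite {ι : Type*} [Finite ι] (D : ι → ℝ) : ∃ M, ∀ i, D i ≤ M := by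
  obtain ⟨M, hM⟩ := (Set.finite_range D).bddAbove
  exact ⟨M, fun i => hM ⟨i, rfl⟩⟩

/-- On a transitive set, any two points are connected by an orbit segment, up to small errors. -/
theorem exists_connection (hψ : IsGlobalFlow f L ψ) (hinv : ∀ x ∈ Λ, ∀ t, ψ t x ∈ Λ)
    (htrans : IsFlowTransitive f Λ) {γ : ℝ} (hγ : 0 < γ) {a b : Vec n} (ha : a ∈ Λ) (hb : b ∈ Λ)
    (s : Bool) : ∃ c ∈ Λ, ∃ D, 0 < D ∧ ‖a - c‖ < γ ∧ ‖ψ (sg s * D) c - b‖ < γ := by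
  obtain ⟨y, hy, hyΛ, hyd⟩ := htrans
  have hyψ : ∀ t, y t = ψ t (y 0) := hψ.unique y hy
  -- Arbitrarily late tails of the dense orbit are dense too: density is applied to `ψ (-S) b` and
  -- carried forward by the homeomorphism `ψ S`. This permits the target to be met after the start;
  -- for `s = false` start and target are interchanged.
  have hlate : ∀ b ∈ Λ, ∀ S : ℝ, ∃ t, S ≤ t ∧ ‖b - y t‖ < γ := by
    intro b hb S
    have h1 : b ∈ closure (ψ S '' (y '' Set.Ici 0)) := by
      refine image_closure_subset_closure_image (hψ.continuous_right S) ?_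
      exact ⟨ψ (-S) b, hyd (hinv b hb _), hψ.apply_neg S b⟩
    obtain ⟨_, ⟨_, ⟨t, ht, rfl⟩, rfl⟩, h2⟩ := Metric.mem_closure_iff.mp h1 γ hγ
    refine ⟨S + t, by simpa using ht, ?_⟩
    rwa [hyψ t, ← hψ.add, ← hyψ, dist_eq_norm] at h2
  have hmain : ∀ a ∈ Λ, ∀ b ∈ Λ, ∃ t₁ t₂, t₁ < t₂ ∧ ‖a - y t₁‖ < γ ∧ ‖b - y t₂‖ < γ := by
    intro a ha b hb
    obtain ⟨t₁, -, h1⟩ := hlate a ha 0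
    obtain ⟨t₂, h2, h3⟩ := hlate b hb (t₁ + 1)
    exact ⟨t₁, t₂, by linarith, h1, h3⟩
  cases s
  · obtain ⟨t₁, t₂, h1, h2, h3⟩ := hmain b hb a ha
    refine ⟨y t₂, hyΛ _, t₂ - t₁, by linarith, h3, ?_⟩
    rw [hyψ t₂, ← hψ.add, sg_false, show -1 * (t₂ - t₁) + t₂ = t₁ by ring, ← hyψ, norm_sub_rev]
    exact h2
  · obtain ⟨t₁, t₂, h1, h2, h3⟩ := hmain a ha b hb
    refine ⟨y t₁, hyΛ _, t₂ - t₁, by linarith, h2, ?_⟩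
    rw [hyψ t₁, ← hψ.add, sg_true, show 1 * (t₂ - t₁) + t₁ = t₂ by ring, ← hyψ, norm_sub_rev]
    exact h3

/-- The connecting times of `exists_connection` are uniformly bounded. -/
theorem exists_connection_uniform (hψ : IsGlobalFlow f L ψ) (hΛ : IsCompact Λ)
    (hinv : ∀ x ∈ Λ, ∀ t, ψ t x ∈ Λ) (htrans : IsFlowTransitive f Λ) {γ : ℝ} (hγ : 0 < γ)
    {b : Vec n} (hb : b ∈ Λ) (s : Bool) : ∃ M, ∀ a ∈ Λ, ∃ c ∈ Λ, ∃ D, 0 < D ∧ D ≤ M ∧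
      ‖a - c‖ ≤ γ ∧ ‖ψ (sg s * D) c - b‖ ≤ γ := by
  refine hΛ.induction_on (p := fun S => ∃ M, ∀ a ∈ S, ∃ c ∈ Λ, ∃ D, 0 < D ∧ D ≤ M ∧
      ‖a - c‖ ≤ γ ∧ ‖ψ (sg s * D) c - b‖ ≤ γ) ⟨0, fun _ h => h.elim⟩ ?_ ?_ ?_
  · rintro S S' hS ⟨M, hM⟩
    exact ⟨M, fun a ha => hM a (hS ha)⟩
  · rintro S S' ⟨M, hM⟩ ⟨M', hM'⟩
    refine ⟨max M M', ?_⟩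
    rintro a (ha | ha)
    · obtain ⟨c, hc, D, h1, h2, h3⟩ := hM a ha
      exact ⟨c, hc, D, h1, h2.trans (le_max_left _ _), h3⟩
    · obtain ⟨c, hc, D, h1, h2, h3⟩ := hM' a ha
      exact ⟨c, hc, D, h1, h2.trans (le_max_right _ _), h3⟩
  · intro a₀ ha₀
    obtain ⟨c, hc, D, h1, h2, h3⟩ := exists_connection hψ hinv htrans (half_pos hγ) ha₀ hb s
    refine ⟨Metric.ball a₀ (γ / 2), mem_nhdsWithin_of_mem_nhds (Metric.ball_mem_nhds _ (half_pos hγ)),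
      D, fun a ha => ⟨c, hc, D, h1, le_rfl, ?_, by linarith⟩⟩
    rw [Metric.mem_ball, dist_eq_norm] at ha
    have := norm_sub_le_norm_sub_add_norm_sub a a₀ c
    linarith

/-- A path in `Λ`, parametrized by `[0, ∞)`, that is a pseudo-orbit of the flow (of the reversed
flow if `s = false`) on time intervals of length `2 τ`. -/
def IsPseudoPath (ψ : ℝ → Vec n → Vec n) (Λ : Set (Vec n)) (τ : ℝ) (s : Bool) (γ : ℝ)
    (X : ℝ → Vec n) : Prop :=
  ∀ σ, 0 ≤ σ → X σ ∈ Λ ∧ ∀ t, 0 ≤ t → t ≤ 2 * τ → ‖ψ (sg s * t) (X σ) - X (σ + t)‖ ≤ γ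

theorem isPseudoPath_orbit (hψ : IsGlobalFlow f L ψ) {z : ℝ → Vec n} (hz : IsOrbit f z)
    (hzΛ : ∀ t, z t ∈ Λ) (s : Bool) : IsPseudoPath ψ Λ τ s 0 (fun σ => z (sg s * σ)) := by
  refine fun σ _ => ⟨hzΛ _, fun t _ _ => ?_⟩
  have hzψ : ∀ t, z t = ψ t (z 0) := hψ.unique z hz
  change ‖ψ (sg s * t) (z (sg s * σ)) - z (sg s * (σ + t))‖ ≤ 0
  rw [hzψ (sg s * σ), ← hψ.add, hzψ (sg s * (σ + t)), mul_add, add_comm, sub_self, norm_zero]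

/-- The path that follows the orbit of `c` during the time `D`, and then the path `X`. -/
noncomputable def consPath (ψ : ℝ → Vec n → Vec n) (s : Bool) (c : Vec n) (D : ℝ)
    (X : ℝ → Vec n) : ℝ → Vec n :=
  fun σ => if σ < D then ψ (sg s * σ) c else X (σ - D)

theorem consPath_of_lt {s : Bool} {c : Vec n} {D : ℝ} {X : ℝ → Vec n} {σ : ℝ} (h : σ < D) :
    consPath ψ s c D X σ = ψ (sg s * σ) c := if_pos h

theorem consPath_of_le {s : Bool} {c : Vec n} {D : ℝ} {X : ℝ → Vec n} {σ : ℝ} (h : D ≤ σ) :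
    consPath ψ s c D X σ = X (σ - D) := if_neg (not_lt.mpr h)

/-- A time interval of length at most `2 τ` that crosses the junction first meets the jump `γ'`,
amplified by at most `exp (2 L τ)`, and then the error of the remaining path. The errors add, so
several junctions in one interval do no harm. -/
theorem IsPseudoPath.cons (hψ : IsGlobalFlow f L ψ) (hL : 0 ≤ L)
    (hinv : ∀ x ∈ Λ, ∀ t, ψ t x ∈ Λ) {s : Bool} {γ γ' D : ℝ} {c : Vec n} {X : ℝ → Vec n}
    (hX : IsPseudoPath ψ Λ τ s γ X) (hγ : 0 ≤ γ) (hγ' : 0 ≤ γ') (hc : c ∈ Λ)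
    (hD : ‖ψ (sg s * D) c - X 0‖ ≤ γ') :
    IsPseudoPath ψ Λ τ s (γ + Real.exp (L * (2 * τ)) * γ') (consPath ψ s c D X) := by
  have he : 0 ≤ Real.exp (L * (2 * τ)) * γ' := by positivity
  intro σ hσ
  rcases lt_or_ge σ D with h1 | h1
  · rw [consPath_of_lt h1]
    refine ⟨hinv c hc _, fun t ht ht2 => ?_⟩
    rcases lt_or_ge (σ + t) D with h2 | h2
    · rw [consPath_of_lt h2, ← hψ.add, ← mul_add, add_comm t σ, sub_self, norm_zero]
      positivity
    · rw [consPath_of_le h2]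
      have h3 := (hX 0 le_rfl).2 (σ + t - D) (by linarith) (by linarith)
      rw [zero_add] at h3
      have h4 : ψ (sg s * t) (ψ (sg s * σ) c) = ψ (sg s * (σ + t - D)) (ψ (sg s * D) c) := by
        rw [← hψ.add, ← hψ.add]; congr 1; ring
      have h5 := hψ.lip_of_le hL (t := sg s * (σ + t - D)) (b := 2 * τ)
        (by rw [abs_mul, abs_sg, one_mul, abs_of_nonneg (by linarith)]; linarith)
        (ψ (sg s * D) c) (X 0)
      rw [h4]
      refine (norm_sub_le_norm_sub_add_norm_sub _ (ψ (sg s * (σ + t - D)) (X 0)) _).trans ?_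
      have h6 := mul_le_mul_of_nonneg_left hD (Real.exp_pos (L * (2 * τ))).le
      linarith
  · rw [consPath_of_le h1]
    obtain ⟨h2, h3⟩ := hX (σ - D) (by linarith)
    refine ⟨h2, fun t ht ht2 => ?_⟩
    rw [consPath_of_le (by linarith), show σ + t - D = σ - D + t by ring]
    exact (h3 t ht ht2).trans (by linarith)

/-- Pseudo-paths that start at a given point, follow a given periodic orbit `z e` during a fixed
time interval, and finally follow another given orbit `z i`. -/
theorem exists_pseudoPath (hψ : IsGlobalFlow f L ψ) (hL : 0 ≤ L) (hΛ : IsCompact Λ)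
    (hinv : ∀ x ∈ Λ, ∀ t, ψ t x ∈ Λ) (htrans : IsFlowTransitive f Λ) (hτ : 0 < τ) {ι : Type*}
    [Finite ι] {z : ι → ℝ → Vec n} (hz : ∀ i, IsOrbit f (z i)) (hzΛ : ∀ i t, z i t ∈ Λ) {γ : ℝ}
    (hγ : 0 < γ) : ∃ (j₀ : ℕ) (M : ℝ), ∀ s, ∀ x ∈ Λ, ∀ e i, ∃ X, X 0 = x ∧
      IsPseudoPath ψ Λ τ s γ X ∧
      (∀ σ, j₀ * τ / 2 ≤ σ → σ ≤ 3 * (j₀ * τ / 2) → X σ ∈ Set.range (z e)) ∧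
      ∃ D, 0 ≤ D ∧ D ≤ M ∧ ∀ σ, D ≤ σ → X σ = z i (sg s * (σ - D)) := by
  set E := Real.exp (L * (2 * τ)) with hE
  have hE0 : 0 < E := Real.exp_pos _
  -- The path has four junctions, each contributing `E * γ'`: start to connection, connection to `z
  -- e`, `z e` to the second connection, and that connection to `z i`.
  set γ' := γ / (4 * E) with hγ'
  have hγ'0 : 0 < γ' := by positivity
  choose M₀ hM₀ using fun q : Bool × ι =>
    exists_connection_uniform hψ hΛ hinv htrans hγ'0 (hzΛ q.2 0) q.1
  obtain ⟨M, hM⟩ := exists_forall_le_of_finite M₀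
  -- The path reaches `z e` before the time `1 + M ≤ s₁` and stays on it for the time `3 * s₁`, so
  -- it is there on all of `[s₁, 3 s₁]`. As a step advances the path by between `τ / 2` and `3 τ /
  -- 2`, this is where it stands after `j₀` steps, whatever the time shifts.
  obtain ⟨j₀, hj₀⟩ := exists_nat_ge (2 * (1 + M) / τ)
  set s₁ := j₀ * τ / 2 with hs₁
  have hs₁M : 1 + M ≤ s₁ := by
    rw [div_le_iff₀ hτ] at hj₀
    rw [hs₁]; linarith
  refine ⟨j₀, 1 + M + 3 * s₁ + M, fun s x hx e i => ?_⟩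
  obtain ⟨c₁, hc₁, D₁, hD₁, hD₁M, h1, h2⟩ := hM₀ (s, e) (ψ (sg s * 1) x) (hinv x hx _)
  obtain ⟨c₂, hc₂, D₂, hD₂, hD₂M, h3, h4⟩ :=
    hM₀ (s, i) (ψ (sg s * (3 * s₁)) (z e 0)) (hinv _ (hzΛ e 0) _)
  have hD₁M' := hD₁M.trans (hM (s, e))
  have hD₂M' := hD₂M.trans (hM (s, i))
  simp only at h2 h4
  set X₀ : ℝ → Vec n := fun σ => z i (sg s * σ) with hX₀
  set X₁ := consPath ψ s c₂ D₂ X₀ with hX₁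
  set X₂ := consPath ψ s (z e 0) (3 * s₁) X₁ with hX₂
  set X₃ := consPath ψ s c₁ D₁ X₂ with hX₃
  set X₄ := consPath ψ s x 1 X₃ with hX₄
  have hs₁0 : 0 < s₁ := by linarith
  have e1 : X₁ 0 = c₂ := by rw [hX₁, consPath_of_lt hD₂, mul_zero, hψ.zero]
  have e2 : X₂ 0 = z e 0 := by rw [hX₂, consPath_of_lt (by linarith), mul_zero, hψ.zero]
  have e3 : X₃ 0 = c₁ := by rw [hX₃, consPath_of_lt hD₁, mul_zero, hψ.zero]
  have e4 : X₄ 0 = x := by rw [hX₄, consPath_of_lt one_pos, mul_zero, hψ.zero]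
  have hEγ : 0 ≤ E * γ' := by positivity
  have p0 : IsPseudoPath ψ Λ τ s 0 X₀ := isPseudoPath_orbit hψ (hz i) (hzΛ i) s
  have p1 := p0.cons hψ hL hinv le_rfl hγ'0.le hc₂ (by rw [hX₀]; simpa using h4)
  have p2 := p1.cons hψ hL hinv (by linarith) hγ'0.le (hzΛ e 0)
    (D := 3 * s₁) (by rw [← hX₁, e1]; exact h3)
  have p3 := p2.cons hψ hL hinv (by linarith) hγ'0.le hc₁
    (D := D₁) (by rw [← hX₁, ← hX₂, e2]; exact h2)
  have p4 := p3.cons hψ hL hinv (by linarith) hγ'0.le hx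
    (D := 1) (by rw [← hX₁, ← hX₂, ← hX₃, e3]; exact h1)
  have hsum : 0 + E * γ' + E * γ' + E * γ' + E * γ' = γ := by
    have : E * γ' = γ / 4 := by rw [hγ']; field_simp
    linarith
  rw [← hX₁, ← hX₂, ← hX₃, ← hX₄, ← hE, hsum] at p4
  refine ⟨X₄, e4, p4, fun σ h5 h6 => ?_, 1 + D₁ + 3 * s₁ + D₂, by linarith, by linarith,
    fun σ hσ => ?_⟩
  · rw [hX₄, consPath_of_le (by linarith), hX₃, consPath_of_le (by linarith), hX₂,
      consPath_of_lt (by linarith), ← hψ.unique (z e) (hz e)]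
    exact ⟨_, rfl⟩
  · rw [hX₄, consPath_of_le (by linarith), hX₃, consPath_of_le (by linarith), hX₂,
      consPath_of_le (by linarith), hX₁, consPath_of_le (by linarith), hX₀]
    simp only
    congr 2
    ring

end LDS


/-! ### Means over periodic orbits, and feedback control by the vertices of a simplex. -/

namespace LDS

variable {n m : ℕ} {f : Vec n → Vec n} {g : Vec n → Vec m} {L : ℝ} {ψ : ℝ → Vec n → Vec n}

/-- The primitive of `g - mean` along a periodic orbit is bounded. -/
theorem exists_bounded_primitive (hg : Continuous g) {z : ℝ → Vec n} (hz : Continuous z) {T : ℝ}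
    (hT : 0 < T) (hper : Function.Periodic z T) : ∃ (H : ℝ → Vec m) (B : ℝ),
      (∀ t, HasDerivAt H (g (z t) - orbitMean g z T) t) ∧ ∀ t, ‖H t‖ ≤ B := by
  set u : ℝ → Vec m := fun t => g (z t) - orbitMean g z T with hu
  have huc : Continuous u := by fun_prop
  set H : ℝ → Vec m := fun t => ∫ s in (0 : ℝ)..t, u s with hH
  have hHd : ∀ t, HasDerivAt H (u t) t := fun t =>
    intervalIntegral.integral_hasDerivAt_right (huc.intervalIntegrable _ _)
      huc.aestronglyMeasurable.stronglyMeasurableAtFilter huc.continuousAt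
  have hup : Function.Periodic u T := fun t => by simp only [hu, hper t]
  have h0 : ∫ s in (0 : ℝ)..T, u s = 0 := by
    rw [hu, intervalIntegral.integral_sub ((by fun_prop : Continuous fun t => g (z t)).intervalIntegrable _ _)
      (continuous_const.intervalIntegrable _ _), intervalIntegral.integral_const, orbitMean, sub_zero, smul_smul, mul_one_div_cancel hT.ne',
      one_smul, sub_self]
  have hHp : Function.Periodic H T := by
    intro t
    have h1 := intervalIntegral.integral_add_adjacent_intervals (huc.intervalIntegrable 0 t)
      (huc.intervalIntegrable t (t + T) (μ := MeasureTheory.volume))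
    rw [hup.intervalIntegral_add_eq t 0, zero_add, h0, add_zero] at h1
    exact h1.symm
  have hHc : Continuous H := continuous_iff_continuousAt.mpr fun t => (hHd t).continuousAt
  obtain ⟨B, hB⟩ := (hHp.compact_of_continuous hT.ne' hHc).isBounded.exists_norm_le
  exact ⟨H, B, hHd, fun t => hB _ ⟨t, rfl⟩⟩

/-- Two periodic orbits with different means are disjoint. -/
theorem disjoint_range_of_orbitMean_ne (hψ : IsGlobalFlow f L ψ) (hg : Continuous g)
    {z z' : ℝ → Vec n} (hz : IsOrbit f z) (hz' : IsOrbit f z') {T T' : ℝ} (hT : 0 < T)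
    (hT' : 0 < T') (hper : Function.Periodic z T) (hper' : Function.Periodic z' T')
    (hne : orbitMean g z T ≠ orbitMean g z' T') : Disjoint (Set.range z) (Set.range z') := by
  have hcont : ∀ z, IsOrbit f z → Continuous z := fun z hz =>
    continuous_iff_continuousAt.mpr fun t => (hz t).continuousAt
  rw [Set.disjoint_left]
  rintro _ ⟨t₀, rfl⟩ ⟨t₁, h01⟩
  -- Orbits with a common point are time shifts of each other. Then `H' (t + c) - H t - t (b - b')`
  -- is constant although `H` and `H'` are bounded, which forces `b = b'`.
  have hshift : ∀ t, z' (t + (t₁ - t₀)) = z t := by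
    intro t
    rw [hψ.unique z hz, hψ.unique z' hz', show t + (t₁ - t₀) = (t - t₀) + t₁ by ring, hψ.add,
      ← hψ.unique z' hz', h01, hψ.unique z hz t₀, ← hψ.add, sub_add_cancel]
  obtain ⟨H, B, hH, hHB⟩ := exists_bounded_primitive hg (hcont z hz) hT hper
  obtain ⟨H', B', hH', hHB'⟩ := exists_bounded_primitive hg (hcont z' hz') hT' hper'
  set b := orbitMean g z T
  set b' := orbitMean g z' T'
  set c := t₁ - t₀
  have hd : ∀ t, HasDerivAt (fun t => H' (t + c) - H t - t • (b - b')) 0 t := by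
    intro t
    have h1 := (hH' (t + c)).scomp t ((hasDerivAt_id t).add_const c)
    rw [one_smul, hshift] at h1
    refine ((h1.sub (hH t)).sub ((hasDerivAt_id t).smul_const (b - b'))).congr_deriv ?_
    rw [one_smul]; abel
  have hconst : ∀ t, H' (t + c) - H t - t • (b - b') = H' (0 + c) - H 0 - (0 : ℝ) • (b - b') :=
    fun t => is_const_of_deriv_eq_zero (fun t => (hd t).differentiableAt) (fun t => (hd t).deriv)
      t 0
  have hb : 0 < ‖b - b'‖ := norm_pos_iff.mpr (sub_ne_zero.mpr hne)
  have hB := hHB 0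
  have hB' := hHB' (0 + c)
  set t := (2 * (B + B') + 1) / ‖b - b'‖ with ht
  have h2 : t • (b - b') = H' (t + c) - H t - (H' (0 + c) - H 0) := by
    have := hconst t
    rw [zero_smul, sub_zero] at this
    rw [← this]; abel
  have h3 : ‖t • (b - b')‖ ≤ (B' + B) + (B' + B) := by
    rw [h2]
    exact (norm_sub_le _ _).trans (add_le_add
      ((norm_sub_le _ _).trans (add_le_add (hHB' _) (hHB _)))
      ((norm_sub_le _ _).trans (add_le_add hB' hB)))
  have h4 : t * ‖b - b'‖ = 2 * (B + B') + 1 := div_mul_cancel₀ _ hb.ne'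
  have h5 := mul_le_mul_of_nonneg_right (le_abs_self t) hb.le
  rw [norm_smul, Real.norm_eq_abs] at h3
  linarith

/-- Disjoint periodic orbits have a positive distance. -/
theorem exists_pos_dist_of_disjoint {z z' : ℝ → Vec n} (hz : Continuous z) (hz' : Continuous z')
    {T T' : ℝ} (hT : 0 < T) (hT' : 0 < T') (hper : Function.Periodic z T)
    (hper' : Function.Periodic z' T') (hd : Disjoint (Set.range z) (Set.range z')) :
    ∃ δ > 0, ∀ t t', δ ≤ ‖z t - z' t'‖ := by
  obtain ⟨δ, hδ, h⟩ := Metric.exists_pos_forall_lt_edist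
    (hper.compact_of_continuous hT.ne' hz)
    (hper'.compact_of_continuous hT'.ne' hz').isClosed hd
  refine ⟨δ, by exact_mod_cast hδ, fun t t' => ?_⟩
  have h1 := h _ ⟨t, rfl⟩ _ ⟨t', rfl⟩
  rw [edist_nndist] at h1
  have h2 : δ < nndist (z t) (z' t') := by exact_mod_cast h1
  rw [← dist_eq_norm, ← coe_nndist]
  exact_mod_cast h2.le

/-- A point in the interior of a convex hull can be controlled: some vertex pushes every deviation
towards that point. -/
theorem exists_inner_le_of_mem_interior_convexHull {E ι : Type*} [NormedAddCommGroup E]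
    [InnerProductSpace ℝ E] [Nonempty ι] {b : ι → E} {v : E}
    (hv : v ∈ interior (convexHull ℝ (Set.range b))) :
    ∃ c > 0, ∀ d : E, ∃ i, inner ℝ (b i - v) d ≤ -c * ‖d‖ := by
  obtain ⟨r, hr, hball⟩ := Metric.isOpen_iff.mp isOpen_interior v hv
  refine ⟨r / 2, by positivity, fun d => ?_⟩
  rcases eq_or_ne d 0 with rfl | hd
  · exact ⟨Classical.arbitrary ι, by simp⟩
  by_contra! hcon
  have hd' : 0 < ‖d‖ := norm_pos_iff.mpr hd
  -- `w` still lies in the convex hull. If no vertex satisfied the inequality, the hull would lie in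
  -- an open half-space that has `w` on its boundary.
  set w := v - (r / 2 / ‖d‖) • d with hw
  have hwmem : w ∈ convexHull ℝ (Set.range b) := by
    refine interior_subset (hball ?_)
    rw [Metric.mem_ball, dist_eq_norm, hw, sub_sub_cancel_left, norm_neg, norm_smul,
      Real.norm_of_nonneg (by positivity), div_mul_cancel₀ _ hd'.ne']
    linarith
  have hconv : Convex ℝ {x : E | -(r / 2) * ‖d‖ + inner ℝ v d < inner ℝ x d} := by
    have := convex_halfSpace_gt (𝕜 := ℝ) (f := fun x : E => inner ℝ x d)
      ⟨fun x y => inner_add_left _ _ _, fun c x => real_inner_smul_left _ _ _⟩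
      (-(r / 2) * ‖d‖ + inner ℝ v d)
    exact this
  have hsub : convexHull ℝ (Set.range b) ⊆ {x : E | -(r / 2) * ‖d‖ + inner ℝ v d < inner ℝ x d} := by
    refine convexHull_min ?_ hconv
    rintro _ ⟨i, rfl⟩
    have := hcon i
    rw [inner_sub_left] at this
    rw [Set.mem_ofPred_eq]
    linarith
  have h1 := hsub hwmem
  rw [Set.mem_ofPred_eq, hw, inner_sub_left, real_inner_smul_left, real_inner_self_eq_norm_sq] at h1
  have h2 : r / 2 / ‖d‖ * ‖d‖ ^ 2 = r / 2 * ‖d‖ := by field_simp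
  linarith

/-- A control that pushes every large deviation back keeps the deviations bounded. -/
theorem norm_add_smul_add_le {E : Type*} [NormedAddCommGroup E] [InnerProductSpace ℝ E]
    {d d' w e : E} {c M S θ η r : ℝ} (hc : 0 < c) (hS : 0 < S) (hw : ‖w‖ ≤ M)
    (hwd : inner ℝ w d' ≤ -c * ‖d'‖) (hd' : ‖d - d'‖ ≤ θ) (he : ‖e‖ ≤ η)
    (hη : η + 2 * θ ≤ S * c / 2) (hr : S * (M ^ 2 / c + c) + S * M + η + 2 * θ ≤ r)
    (hd : ‖d‖ ≤ r) : ‖d + S • w + e‖ ≤ r := by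
  have hM : 0 ≤ M := (norm_nonneg _).trans hw
  have h1 : ‖d + S • w + e‖ ≤ ‖d - d'‖ + ‖d' + S • w‖ + ‖e‖ := by
    have : d + S • w + e = (d - d') + (d' + S • w) + e := by abel
    rw [this]; exact norm_add₃_le
  -- Below the threshold a single step cannot leave the ball of radius `r`. Above it the quadratic
  -- term `S² M²` is dominated and the norm drops by at least `S c / 2`, which pays for the noise
  -- `η` and, twice, for the discrepancy `θ` between the true deviation and the one used for the
  -- choice.
  rcases le_total ‖d'‖ (S * (M ^ 2 / c + c)) with h2 | h2
  · have h3 : ‖d' + S • w‖ ≤ ‖d'‖ + S * M := (norm_add_le _ _).trans (add_le_add le_rfl (by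
      rw [norm_smul, Real.norm_of_nonneg hS.le]; exact mul_le_mul_of_nonneg_left hw hS.le))
    have := (norm_nonneg _).trans hd'
    linarith
  · have h3 : ‖d' + S • w‖ ≤ ‖d'‖ - S * c / 2 := by
      have h4 : 0 ≤ S * (M ^ 2 / c) := by positivity
      have hSc : 0 < S * c := by positivity
      refine abs_le_of_sq_le_sq' ?_ (by nlinarith) |>.2
      have h5 : ‖d' + S • w‖ ^ 2 = ‖d'‖ ^ 2 + 2 * (S * inner ℝ w d') + S ^ 2 * ‖w‖ ^ 2 := by
        rw [norm_add_sq_real, real_inner_smul_right, real_inner_comm, norm_smul,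
          Real.norm_of_nonneg hS.le]
        ring
      have h6 : S * inner ℝ w d' ≤ S * (-c * ‖d'‖) := mul_le_mul_of_nonneg_left hwd hS.le
      have h7 : S ^ 2 * ‖w‖ ^ 2 ≤ S ^ 2 * M ^ 2 := by gcongr
      have h8 : S * c * (S * (M ^ 2 / c)) ≤ S * c * ‖d'‖ := by
        refine mul_le_mul_of_nonneg_left ?_ hSc.le
        nlinarith
      have h9 : S * c * (S * (M ^ 2 / c)) = S ^ 2 * M ^ 2 := by field_simp
      rw [h5]
      nlinarith [sq_nonneg (S * c)]
    have h10 : ‖d'‖ ≤ ‖d‖ + θ := by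
      have := norm_sub_norm_le d' d
      rw [norm_sub_rev] at this
      linarith
    linarith

end LDS


/-! ### The drift of `p` along shadowing orbits. -/

namespace LDS

variable {n m : ℕ} {f : Vec n → Vec n} {g : Vec n → Vec m} {L ε : ℝ}
  {F : LInf (Vec n) × LInf (Vec m) → LInf (Vec n)}
  {G : LInf (Vec n) × LInf (Vec m) → LInf (Vec m)} {Φ : ℝ → LState n m → LState n m}
  {ψ : ℝ → Vec n → Vec n}

theorem IsLatticeFlow.dist_base_le_of_le (h : IsLatticeFlow f g L ε F G Φ)
    (hψ : IsGlobalFlow f L ψ) {z : LState n m} {k : ℤ} {x : Vec n} {ρ τ t : ℝ}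
    (hz : ‖z.1 k - x‖ ≤ ρ) (ht : |t| ≤ τ) :
    ‖(Φ t z).1 k - ψ t x‖ ≤ Real.exp (L * τ) * (ρ + |ε| * L * τ) := by
  have hL : 0 ≤ L := by linarith [h.one_le]
  refine (h.dist_base_le hψ z k x t).trans ?_
  gcongr

/-- The second component follows the primitive of `g` along an orbit that is close to the first
component. -/
theorem IsLatticeFlow.snd_sub_le (h : IsLatticeFlow f g L ε F G Φ)
    (hψ : IsGlobalFlow f L ψ) {z : LState n m} {k : ℤ} {x : Vec n} {ρ τ t : ℝ}
    (hz : ‖z.1 k - x‖ ≤ ρ) (ht : |t| ≤ τ) {H : ℝ → Vec m} {b : Vec m}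
    (hH : ∀ t, HasDerivAt H (g (ψ t x) - b) t) :
    ‖(Φ t z).2 k - z.2 k - t • b - (H t - H 0)‖ ≤
      (L * (Real.exp (L * τ) * (ρ + |ε| * L * τ)) + |ε| * L) * τ := by
  have hL : 0 ≤ L := by linarith [h.one_le]
  have hρ := (norm_nonneg _).trans hz
  have hτ := (abs_nonneg _).trans ht
  have h1 := norm_le_exp_mul_of_norm_deriv_le (K := 0) (τ := τ)
    (η := L * (Real.exp (L * τ) * (ρ + |ε| * L * τ)) + |ε| * L)
    (w := fun t => (Φ t z).2 k - z.2 k - t • b - (H t - H 0)) le_rfl (by positivity)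
    (fun u _ => (((h.hasDerivAt_snd z k u).sub_const (z.2 k)).sub
      ((hasDerivAt_id u).smul_const b)).sub ((hH u).sub_const (H 0))) (fun u hu => ?_) ht
  · have h0 : Φ 0 z = z := h.flow.zero z
    simp only [h0, sub_self, zero_smul, zero_mul, Real.exp_zero, one_mul, norm_zero,
      zero_add] at h1
    exact h1.trans (mul_le_mul_of_nonneg_left ht (by positivity))
  · have h2 := h.hg.lip ((Φ u z).1 k) (ψ u x)
    have h3 := mul_le_mul_of_nonneg_left (h.dist_base_le_of_le hψ hz hu) hL
    have h4 : ‖ε • G (Φ u z) k‖ ≤ |ε| * L := by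
      rw [norm_smul, Real.norm_eq_abs]
      exact mul_le_mul_of_nonneg_left ((LInf.apply_le _ k).trans (h.Gbd _)) (abs_nonneg _)
    rw [zero_mul, zero_add, one_smul]
    have h5 : g ((Φ u z).1 k) + ε • G (Φ u z) k - b - (g (ψ u x) - b) =
        (g ((Φ u z).1 k) - g (ψ u x)) + ε • G (Φ u z) k := by abel
    rw [h5]
    exact (norm_add_le _ _).trans (add_le_add (h2.trans h3) h4)

theorem IsLatticeFlow.snd_sub_le_of_bound (h : IsLatticeFlow f g L ε F G Φ)
    (hψ : IsGlobalFlow f L ψ) {z : LState n m} {k : ℤ} {x : Vec n} {ρ τ t C : ℝ}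
    (hz : ‖z.1 k - x‖ ≤ ρ) (ht : |t| ≤ τ) (hC : ∀ t, ‖g (ψ t x)‖ ≤ C) :
    ‖(Φ t z).2 k - z.2 k‖ ≤
      (C + L * (Real.exp (L * τ) * (ρ + |ε| * L * τ)) + |ε| * L) * τ := by
  have hL : 0 ≤ L := by linarith [h.one_le]
  have hρ := (norm_nonneg _).trans hz
  have hτ := (abs_nonneg _).trans ht
  have hC0 := (norm_nonneg _).trans (hC 0)
  have h1 := norm_le_exp_mul_of_norm_deriv_le (K := 0) (τ := τ)
    (η := C + L * (Real.exp (L * τ) * (ρ + |ε| * L * τ)) + |ε| * L)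
    (w := fun t => (Φ t z).2 k - z.2 k) le_rfl (by positivity)
    (fun u _ => (h.hasDerivAt_snd z k u).sub_const (z.2 k)) (fun u hu => ?_) ht
  · have h0 : Φ 0 z = z := h.flow.zero z
    simp only [h0, sub_self, zero_mul, Real.exp_zero, one_mul, norm_zero, zero_add] at h1
    exact h1.trans (mul_le_mul_of_nonneg_left ht (by positivity))
  · have h2 := h.hg.lip ((Φ u z).1 k) (ψ u x)
    have h3 := mul_le_mul_of_nonneg_left (h.dist_base_le_of_le hψ hz hu) hL
    have h4 : ‖ε • G (Φ u z) k‖ ≤ |ε| * L := by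
      rw [norm_smul, Real.norm_eq_abs]
      exact mul_le_mul_of_nonneg_left ((LInf.apply_le _ k).trans (h.Gbd _)) (abs_nonneg _)
    rw [zero_mul, zero_add]
    have h5 : g ((Φ u z).1 k) + ε • G (Φ u z) k =
        g (ψ u x) + (g ((Φ u z).1 k) - g (ψ u x)) + ε • G (Φ u z) k := by abel
    rw [h5]
    exact norm_add₃_le.trans (add_le_add (add_le_add (hC u) (h2.trans h3)) h4)

/-- Summation of increments that are bounded in the beginning, and later equal to a constant and
the increment of a bounded function, up to small errors. -/
theorem norm_sub_sub_smul_le_of_increments {E : Type*} [NormedAddCommGroup E] [NormedSpace ℝ E]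
    {p h : ℕ → E} {c : E} {N N₀ : ℕ} {C B η : ℝ} (hc : ‖c‖ ≤ C)
    (hC : ∀ l < N, ‖p (l + 1) - p l‖ ≤ C) (hB : ∀ l, ‖h l‖ ≤ B) (hη : 0 ≤ η)
    (hp : ∀ l < N, N₀ ≤ l → ‖p (l + 1) - p l - c - (h (l + 1) - h l)‖ ≤ η) :
    ‖p N - p 0 - (N : ℝ) • c‖ ≤ 2 * N₀ * C + 2 * B + N * η := by
  have hC0 := (norm_nonneg _).trans hc
  have hB0 := (norm_nonneg _).trans (hB 0)
  have h1 : ∀ l ≤ N, ‖p l - p 0 - (l : ℝ) • c‖ ≤ 2 * l * C := by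
    intro l hl
    induction l with
    | zero => simp
    | succ l ih =>
      have h2 : p (l + 1) - p 0 - ((l + 1 : ℕ) : ℝ) • c =
          (p l - p 0 - (l : ℝ) • c) + ((p (l + 1) - p l) - c) := by
        push_cast; rw [add_smul, one_smul]; abel
      have h3 := (norm_sub_le (p (l + 1) - p l) c).trans (add_le_add (hC l hl) hc)
      rw [h2]
      refine (norm_add_le _ _).trans ?_
      push_cast
      linarith [ih (by omega)]
  have h2 : ∀ i, N₀ + i ≤ N → ‖p (N₀ + i) - p 0 - ((N₀ + i : ℕ) : ℝ) • c -
      (p N₀ - p 0 - (N₀ : ℝ) • c) - (h (N₀ + i) - h N₀)‖ ≤ i * η := by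
    intro i hi
    induction i with
    | zero => simp
    | succ i ih =>
      have h3 := hp (N₀ + i) (by omega) (by omega)
      have h4 : p (N₀ + (i + 1)) - p 0 - ((N₀ + (i + 1) : ℕ) : ℝ) • c -
          (p N₀ - p 0 - (N₀ : ℝ) • c) - (h (N₀ + (i + 1)) - h N₀) =
          (p (N₀ + i) - p 0 - ((N₀ + i : ℕ) : ℝ) • c - (p N₀ - p 0 - (N₀ : ℝ) • c) -
            (h (N₀ + i) - h N₀)) +
          (p (N₀ + i + 1) - p (N₀ + i) - c - (h (N₀ + i + 1) - h (N₀ + i))) := by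
        rw [← add_assoc]
        push_cast; simp only [add_smul, one_smul]; abel
      rw [h4]
      refine (norm_add_le _ _).trans ((add_le_add (ih (by omega)) h3).trans (le_of_eq ?_))
      push_cast
      ring
  rcases le_total N N₀ with h3 | h3
  · refine (h1 N le_rfl).trans ?_
    have h4 : (N : ℝ) * C ≤ N₀ * C :=
      mul_le_mul_of_nonneg_right (by exact_mod_cast h3) hC0
    have : 0 ≤ N * η := by positivity
    linarith
  · obtain ⟨i, rfl⟩ := Nat.exists_eq_add_of_le h3
    have h4 := h2 i le_rfl
    have h5 := h1 N₀ h3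
    have h6 := norm_sub_le (h (N₀ + i)) (h N₀)
    have h7 : p (N₀ + i) - p 0 - ((N₀ + i : ℕ) : ℝ) • c =
        (p (N₀ + i) - p 0 - ((N₀ + i : ℕ) : ℝ) • c - (p N₀ - p 0 - (N₀ : ℝ) • c) -
          (h (N₀ + i) - h N₀)) + (p N₀ - p 0 - (N₀ : ℝ) • c) + (h (N₀ + i) - h N₀) := by abel
    rw [h7]
    refine norm_add₃_le.trans ?_
    have h8 : (i : ℝ) * η ≤ ((N₀ + i : ℕ) : ℝ) * η := by
      refine mul_le_mul_of_nonneg_right ?_ hη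
      push_cast
      linarith [(Nat.cast_nonneg N₀ : (0 : ℝ) ≤ N₀)]
    linarith [hB (N₀ + i), hB N₀]

end LDS


/-! ### Orbits coded by symbols and controlled block by block. -/

namespace LDS

variable {n m : ℕ} {f : Vec n → Vec n} {g : Vec n → Vec m} {L ε : ℝ}
  {F : LInf (Vec n) × LInf (Vec m) → LInf (Vec n)}
  {G : LInf (Vec n) × LInf (Vec m) → LInf (Vec m)} {Φ : ℝ → LState n m → LState n m}
  {ψ : ℝ → Vec n → Vec n} {τ : ℝ} {Λ : Set (Vec n)}
  {P : Bool → Vec n → (Vec n →L[ℝ] Vec n)} {P₀ : Vec n → (Vec n →L[ℝ] Vec n)}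
  {near : Bool → Vec n → Vec n → Prop} {K lam κ R ρ γ α : ℝ}

set_option maxHeartbeats 1000000 in
/-- Controlled shadowing by blocks of `b` steps: the orbits follow, during the block `l` at the
site `k`, a pseudo-path that passes along the orbit `zo (ω l k)` at the step `j₀` of the block, and
whose second half is chosen so that `p - t v` remains bounded. -/
theorem exists_coded_orbit (hψ : IsGlobalFlow f L ψ) (hyp : HypData f ψ Λ P P₀ K lam)
    (h : IsLatticeFlow f g L ε F G Φ)
    (st : ShadowStep ψ τ Λ P P₀ near (fun s => Φ (sg s * τ)) K κ R ρ γ α)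
    (hτ : 0 < τ) (hα : 0 ≤ α) (hατ : α ≤ τ / 2) {ι : Type*} {zo : ι → ℝ → Vec n}
    (hzo : ∀ i, IsOrbit f (zo i)) (hzoΛ : ∀ i t, zo i t ∈ Λ) {bm : ι → Vec m}
    {H : ι → ℝ → Vec m} {B : ℝ} (hH : ∀ i t, HasDerivAt (H i) (g (zo i t) - bm i) t)
    (hHB : ∀ i t, ‖H i t‖ ≤ B) {Cg : ℝ} (hCg : ∀ x ∈ Λ, ‖g x‖ ≤ Cg) (hbm : ∀ i, ‖bm i‖ ≤ Cg)
    {j₀ : ℕ} {M : ℝ} (hpath : ∀ s, ∀ x ∈ Λ, ∀ e i, ∃ X, X 0 = x ∧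
      IsPseudoPath ψ Λ τ s γ X ∧
      (∀ σ, j₀ * τ / 2 ≤ σ → σ ≤ 3 * (j₀ * τ / 2) → X σ ∈ Set.range (zo e)) ∧
      ∃ D, 0 ≤ D ∧ D ≤ M ∧ ∀ σ, D ≤ σ → X σ = zo i (sg s * (σ - D)))
    {v : Vec m} {c Mv : ℝ} (hc : 0 < c) (hctl : ∀ d : Vec m, ∃ i, inner ℝ (bm i - v) d ≤ -c * ‖d‖)
    (hMv : ∀ i, ‖bm i - v‖ ≤ Mv) {η C r : ℝ} {N₀ b : ℕ}
    (hη : (L * (Real.exp (L * τ) * (ρ + |ε| * L * τ)) + |ε| * L) * τ + 2 * Cg * α ≤ η)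
    (hC : (Cg + L * (Real.exp (L * τ) * (ρ + |ε| * L * τ)) + |ε| * L) * τ ≤ C)
    (hN₀ : M ≤ N₀ * τ / 2) (hb : 0 < b) (hj₀ : j₀ ≤ b)
    (hbη : 2 * N₀ * C + 2 * B + b * η + 2 * (ρ / κ) ≤ b * τ * c / 2)
    (hr : b * τ * (Mv ^ 2 / c + c) + b * τ * Mv + (2 * N₀ * C + 2 * B + b * η) + 2 * (ρ / κ) ≤ r)
    (ω : ℕ → ℤ → ι) :
    ∃ z₀ : LState n m,
      (∀ t k, ∃ x ∈ Λ, ‖(Φ t z₀).1 k - x‖ ≤ Real.exp (L * τ) * (ρ + |ε| * L * τ)) ∧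
      (∀ t k, ‖(Φ t z₀).2 k - t • v‖ ≤ r + (b + 1) * (C + τ * ‖v‖)) ∧
      ∀ l k, ∃ x ∈ Set.range (zo (ω l k)), ‖(Φ ((l * b + j₀ : ℕ) * τ) z₀).1 k - x‖ ≤ ρ := by
  have hL : 0 ≤ L := by linarith [h.one_le]
  have hκ := st.κ_pos
  have hρ := st.ρ_pos
  have hE0 : 0 ≤ Real.exp (L * τ) * (ρ + |ε| * L * τ) := by positivity
  have hCg0 : 0 ≤ Cg := (norm_nonneg _).trans (hbm (ω 0 0))
  have hB0 : 0 ≤ B := (norm_nonneg _).trans (hHB (ω 0 0) 0)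
  have hη0 : 0 ≤ η := by
    refine le_trans ?_ hη
    positivity
  have hC0 : 0 ≤ C := by
    refine le_trans ?_ hC
    positivity
  have hτC : τ * Cg ≤ C := by
    refine le_trans ?_ hC
    have : 0 ≤ (L * (Real.exp (L * τ) * (ρ + |ε| * L * τ)) + |ε| * L) * τ := by positivity
    linarith
  choose! path hpath0 hpathP hpathE D hD0 hDM hpathD using hpath
  choose ctl hctl using hctl
  -- the controller
  let pt : Bool × (ℝ → Vec n) × ℝ → Vec n := fun q => q.2.1 q.2.2
  let ok : Bool × (ℝ → Vec n) × ℝ → Prop := fun q => 0 ≤ q.2.2 ∧ IsPseudoPath ψ Λ τ q.1 γ q.2.1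
  -- The sign makes both directions of time alike: a step adds `τ • (bm i - v)` to the deviation
  -- also when time runs backwards, so one feedback rule serves both.
  let dev : Bool → ℕ → Vec m → Vec m := fun s j p => sg s • (p - (sg s * (j * τ)) • v)
  -- At the beginning of a block a new path is chosen from the symbol and the present deviation;
  -- otherwise the current path is pursued. The alternative `q.1 ≠ s` only ensures that admissible
  -- states remain admissible for every input; along the orbit the direction is right, and the first
  -- step restarts anyway as `b ∣ 0`.
  let adv : Bool → ℕ → ℤ → Bool × (ℝ → Vec n) × ℝ → Vec m → ℝ → Bool × (ℝ → Vec n) × ℝ :=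
    fun s j k q p a => if b ∣ j ∨ q.1 ≠ s then
      (s, path s (pt q) (ω (j / b) k) (ctl (dev s j p)), τ + a) else (s, q.2.1, q.2.2 + (τ + a))
  have hok : ∀ q, ok q → pt q ∈ Λ := fun q hq => (hq.2 _ hq.1).1
  have hadv : ∀ s j k q p a, ok q → |a| ≤ τ → ok (adv s j k q p a) ∧
      ‖ψ (sg s * (τ + a)) (pt q) - pt (adv s j k q p a)‖ ≤ γ := by
    intro s j k q p a hq ha
    obtain ⟨ha1, ha2⟩ := abs_le.mp ha
    by_cases hcase : b ∣ j ∨ q.1 ≠ s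
    · simp only [adv, if_pos hcase]
      have h1 := hpathP s (pt q) (hok q hq) (ω (j / b) k) (ctl (dev s j p))
      refine ⟨⟨by change 0 ≤ τ + a; linarith, h1⟩, ?_⟩
      have h2 := (h1 0 le_rfl).2 (τ + a) (by linarith) (by linarith)
      rw [hpath0 s (pt q) (hok q hq), zero_add] at h2
      exact h2
    · simp only [adv, if_neg hcase]
      push Not at hcase
      have h1 := hq.2
      rw [hcase.2] at h1
      exact ⟨⟨by change 0 ≤ q.2.2 + (τ + a); linarith [hq.1], h1⟩,
        (h1 _ hq.1).2 (τ + a) (by linarith) (by linarith)⟩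
  obtain ⟨q, ph, a, z, hq0, hqok, hqS, ha, hz00, hzp, hzS, hzq, hzph⟩ :=
    exists_controlled_orbit hyp st adv hok hadv (by linarith)
      (fun _ => (true, path true (zo (ω 0 0) 0) (ω 0 0) (ω 0 0), 0))
      (fun _ => ⟨le_rfl, hpathP true _ (hzoΛ _ _) _ _⟩)
  have hzΦ : ∀ s j, z s j = Φ (sg s * (j * τ)) (z true 0) := by
    intro s j
    induction j with
    | zero =>
      rw [Nat.cast_zero, zero_mul, mul_zero, h.flow.zero]
      cases s
      · exact hz00.symm
      · rfl
    | succ j ih =>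
      rw [hzS, ih]
      rw [← h.flow.add]
      congr 1
      push_cast; ring
  have hptΛ : ∀ s j k, pt (q s j k) ∈ Λ := fun s j k => hok _ (hqok s j k)
  have hstep : ∀ s j k u, |u| ≤ τ → ‖(Φ u (z s j)).2 k - (z s j).2 k‖ ≤ C := fun s j k u hu =>
    (h.snd_sub_le_of_bound hψ (hzq s j k) hu fun t => hCg _ (hyp.inv _ (hptΛ s j k) t)).trans hC
  have hsτ : ∀ s, |sg s * τ| ≤ τ := fun s => by rw [abs_mul, abs_sg, one_mul, abs_of_pos hτ]
  have hstep1 : ∀ s j k, ‖(z s (j + 1)).2 k - (z s j).2 k‖ ≤ C := fun s j k => by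
    rw [hzS]; exact hstep s j k _ (hsτ s)
  -- the structure of a block
  have hblock : ∀ s l k, ∃ σ : ℕ → ℝ, σ 0 = 0 ∧
      (∀ i < b, σ (i + 1) = σ i + (τ + a s (l * b + i) k)) ∧
      ∀ i ≤ b, pt (q s (l * b + i) k) = path s (pt (q s (l * b) k)) (ω l k)
        (ctl (dev s (l * b) (ph s (l * b) k))) (σ i) := by
    intro s l k
    set Y := path s (pt (q s (l * b) k)) (ω l k) (ctl (dev s (l * b) (ph s (l * b) k))) with hY
    let σ : ℕ → ℝ := fun i => ∑ i' ∈ Finset.range i, (τ + a s (l * b + i') k)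
    have hσS : ∀ i, σ (i + 1) = σ i + (τ + a s (l * b + i) k) := fun i => Finset.sum_range_succ _ _
    have hσ0 : σ 0 = 0 := Finset.sum_range_zero _
    have h1 : ∀ i < b, q s (l * b + (i + 1)) k = (s, Y, σ (i + 1)) := by
      intro i hi
      rw [← add_assoc, hqS]
      induction i with
      | zero =>
        rw [add_zero, hσS, hσ0, zero_add, add_zero]
        simp only [adv]
        rw [if_pos (Or.inl (dvd_mul_left b l)), Nat.mul_div_cancel _ hb]
      | succ i ih =>
        have h2 := ih (by omega)
        rw [← hqS, add_assoc] at h2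
        rw [h2]
        have h3 : ¬ (b ∣ l * b + (i + 1) ∨ s ≠ s) := by
          rintro (h3 | h3)
          · rw [Nat.dvd_add_right (dvd_mul_left b l)] at h3
            exact absurd (Nat.le_of_dvd (by omega) h3) (by omega)
          · exact h3 rfl
        simp only [adv]
        rw [if_neg h3, hσS (i + 1)]
    refine ⟨σ, hσ0, fun i _ => hσS i, fun i hi => ?_⟩
    rcases i with _ | i
    · rw [hσ0, hY, hpath0 s _ (hptΛ _ _ _), add_zero]
    · rw [h1 i (by omega)]
  have hσbd : ∀ s l k, ∀ σ : ℕ → ℝ, σ 0 = 0 →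
      (∀ i < b, σ (i + 1) = σ i + (τ + a s (l * b + i) k)) →
      ∀ i ≤ b, i * τ / 2 ≤ σ i ∧ σ i ≤ 3 * (i * τ / 2) := by
    intro s l k σ hσ0 hσS i hi
    induction i with
    | zero => simp [hσ0]
    | succ i ih =>
      obtain ⟨h1, h2⟩ := ih (by omega)
      obtain ⟨h3, h4⟩ := abs_le.mp (ha s (l * b + i) k)
      rw [hσS i hi]
      push_cast
      constructor <;> linarith
  -- the displacement in a block
  have hdisp : ∀ s l k, ‖(z s (l * b + b)).2 k - (z s (l * b)).2 k -
      (b : ℝ) • ((sg s * τ) • bm (ctl (dev s (l * b) (ph s (l * b) k))))‖ ≤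
      2 * N₀ * C + 2 * B + b * η := by
    intro s l k
    obtain ⟨σ, hσ0, hσS, hσ⟩ := hblock s l k
    set x := pt (q s (l * b) k) with hx
    have hxΛ : x ∈ Λ := hptΛ _ _ _
    set i := ctl (dev s (l * b) (ph s (l * b) k)) with hi
    set D' := D s x (ω l k) i with hD'
    have := norm_sub_sub_smul_le_of_increments (p := fun i => (z s (l * b + i)).2 k)
      (h := fun j => H i (sg s * (σ j - D'))) (c := (sg s * τ) • bm i) (N := b) (N₀ := N₀)
      (C := C) (B := B) (η := η) ?_ (fun j _ => hstep1 s (l * b + j) k) (fun j => hHB _ _) hη0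
      (fun j hj hjN => ?_)
    · simpa using this
    · rw [norm_smul, Real.norm_eq_abs]
      exact (mul_le_mul (hsτ s) (hbm i) (norm_nonneg _) hτ.le).trans hτC
    · have hσj := (hσbd s l k σ hσ0 hσS j hj.le).1
      have hDσ : D' ≤ σ j := by
        refine (hDM s x hxΛ (ω l k) i).trans (hN₀.trans (le_trans ?_ hσj))
        have : (N₀ : ℝ) ≤ j := by exact_mod_cast hjN
        gcongr
      set θ := sg s * (σ j - D') with hθ
      have hxj : pt (q s (l * b + j) k) = zo i θ := by
        rw [hσ j hj.le, hpathD s x hxΛ (ω l k) i _ hDσ]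
      have hzoψ : ∀ t, zo i (θ + t) = ψ t (pt (q s (l * b + j) k)) := fun t => by
        rw [hxj, hψ.unique _ (hzo i), hψ.unique _ (hzo i) θ, ← hψ.add, add_comm]
      have h1 := h.snd_sub_le hψ (hzq s (l * b + j) k) (hsτ s) (H := fun t => H i (θ + t))
        (b := bm i) (fun t => by
          have := (hH i (θ + t)).scomp t ((hasDerivAt_id t).const_add θ)
          rw [one_smul, hzoψ] at this
          exact this)
      -- The base point advances by `τ + a` while the lattice flow advances by `τ`. The discrepancy
      -- in the primitive is at most `2 * Cg * α`, as the derivative of `H i` is bounded by `2 *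
      -- Cg`.
      have h2 : ‖H i (sg s * (σ (j + 1) - D')) - H i (θ + sg s * τ)‖ ≤ 2 * Cg * α := by
        have h3 := Convex.norm_image_sub_le_of_norm_hasDerivWithin_le (f := H i)
          (f' := fun t => g (zo i t) - bm i) (s := Set.univ) (C := 2 * Cg)
          (x := θ + sg s * τ) (y := sg s * (σ (j + 1) - D'))
          (fun t _ => (hH i t).hasDerivWithinAt)
          (fun t _ => (norm_sub_le _ _).trans (by linarith [hCg _ (hzoΛ i t), hbm i]))
          convex_univ (Set.mem_univ _) (Set.mem_univ _)
        refine h3.trans (mul_le_mul_of_nonneg_left ?_ (by positivity))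
        rw [hσS j hj, hθ, show sg s * (σ j + (τ + a s (l * b + j) k) - D') -
          (sg s * (σ j - D') + sg s * τ) = sg s * a s (l * b + j) k by ring, norm_mul,
          Real.norm_eq_abs, abs_sg, one_mul]
        exact ha s _ k
      have h4 : (z s (l * b + (j + 1))).2 k - (z s (l * b + j)).2 k - (sg s * τ) • bm i -
          (H i (sg s * (σ (j + 1) - D')) - H i θ) =
          ((Φ (sg s * τ) (z s (l * b + j))).2 k - (z s (l * b + j)).2 k - (sg s * τ) • bm i -
            (H i (θ + sg s * τ) - H i (θ + 0))) -
          (H i (sg s * (σ (j + 1) - D')) - H i (θ + sg s * τ)) := by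
        rw [← add_assoc, hzS, add_zero]; abel
      simp only
      rw [h4]
      exact (norm_sub_le _ _).trans ((add_le_add h1 h2).trans hη)
  -- the deviations at the ends of the blocks
  have hr0 : 0 ≤ r := by
    have hMv0 := (norm_nonneg _).trans (hMv (ω 0 0))
    refine le_trans ?_ hr
    positivity
  have hdev : ∀ s l k, ‖dev s (l * b) ((z s (l * b)).2 k)‖ ≤ r := by
    intro s l k
    induction l with
    | zero =>
      simp only [dev, zero_mul, Nat.cast_zero, mul_zero, zero_smul, hzp]
      simpa using hr0
    | succ l ih =>
      set d := dev s (l * b) ((z s (l * b)).2 k) with hd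
      set d' := dev s (l * b) (ph s (l * b) k) with hd'
      have h1 : dev s ((l + 1) * b) ((z s ((l + 1) * b)).2 k) = d + (b * τ) • (bm (ctl d') - v) +
          sg s • ((z s (l * b + b)).2 k - (z s (l * b)).2 k - (b : ℝ) • ((sg s * τ) • bm (ctl d')))
          := by
        simp only [hd, dev]
        rw [show (l + 1) * b = l * b + b by ring]
        push_cast
        rcases (show sg s = 1 ∨ sg s = -1 by cases s <;> simp) with hs | hs
        · simp only [hs]; module
        · simp only [hs]; module
      rw [h1]
      refine norm_add_smul_add_le hc (by positivity) (hMv _) (hctl d') (θ := ρ / κ) ?_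
        (η := 2 * N₀ * C + 2 * B + b * η) ?_ hbη hr ih
      · have h2 : d - d' = sg s • ((z s (l * b)).2 k - ph s (l * b) k) := by
          simp only [hd, hd', dev]
          rw [← smul_sub]; congr 1; abel
        rw [h2, norm_smul, Real.norm_eq_abs, abs_sg, one_mul]
        exact hzph s _ k
      · rw [norm_smul, Real.norm_eq_abs, abs_sg, one_mul]
        exact hdisp s l k
  -- all times
  have htime : ∀ t : ℝ, ∃ (s : Bool) (j : ℕ) (u : ℝ), |u| ≤ τ ∧
      t = sg s * (j * τ) + u ∧ Φ t (z true 0) = Φ u (z s j) := by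
    intro t
    set j := ⌊|t| / τ⌋₊ with hj
    have h1 : (j : ℝ) * τ ≤ |t| := by
      rw [← le_div_iff₀ hτ]; exact Nat.floor_le (by positivity)
    have h2 : |t| < (j + 1) * τ := by
      rw [← div_lt_iff₀ hτ]; exact Nat.lt_floor_add_one _
    have h3 : ∃ s, t = sg s * |t| := by
      rcases le_total 0 t with h3 | h3
      · exact ⟨true, by rw [sg_true, one_mul, abs_of_nonneg h3]⟩
      · exact ⟨false, by rw [sg_false, abs_of_nonpos h3]; ring⟩
    obtain ⟨s, hs⟩ := h3
    refine ⟨s, j, sg s * (|t| - j * τ), ?_, ?_, ?_⟩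
    · rw [abs_mul, abs_sg, one_mul, abs_of_nonneg (by linarith)]; linarith
    · nth_rw 1 [hs]; ring
    · rw [hzΦ s j, ← h.flow.add]; congr 1; nth_rw 1 [hs]; ring
  refine ⟨z true 0, fun t k => ?_, fun t k => ?_, fun l k => ?_⟩
  · obtain ⟨s, j, u, hu, -, hΦ⟩ := htime t
    rw [hΦ]
    exact ⟨ψ u (pt (q s j k)), hyp.inv _ (hptΛ s j k) _, h.dist_base_le_of_le hψ (hzq s j k) hu⟩
  · obtain ⟨s, j, u, hu, htu, hΦ⟩ := htime t
    rw [hΦ]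
    set l := j / b with hl
    obtain ⟨i, hi, hji⟩ : ∃ i ≤ b, j = l * b + i :=
      ⟨j % b, (Nat.mod_lt _ hb).le, by rw [hl, mul_comm]; exact (Nat.div_add_mod j b).symm⟩
    have h1 : ∀ i, ‖(z s (l * b + i)).2 k - (z s (l * b)).2 k‖ ≤ i * C := by
      intro i
      induction i with
      | zero => simp
      | succ i ih =>
        have h2 := hstep1 s (l * b + i) k
        have h3 := norm_sub_le_norm_sub_add_norm_sub ((z s (l * b + (i + 1))).2 k)
          ((z s (l * b + i)).2 k) ((z s (l * b)).2 k)
        rw [← add_assoc] at h3 ⊢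
        push_cast
        linarith
    have h2 := hdev s l k
    simp only [dev] at h2
    rw [norm_smul, Real.norm_eq_abs, abs_sg, one_mul] at h2
    have h3 := hstep s j k u hu
    have h4 := h1 i
    rw [← hji] at h4
    have h5 : (i : ℝ) * C ≤ b * C := by gcongr
    have h6 : ‖(sg s * (i * τ) + u) • v‖ ≤ (b + 1) * (τ * ‖v‖) := by
      rw [norm_smul, Real.norm_eq_abs, ← mul_assoc (b + 1 : ℝ)]
      refine mul_le_mul_of_nonneg_right ?_ (norm_nonneg _)
      refine (abs_add_le _ _).trans ?_
      rw [abs_mul, abs_sg, one_mul, abs_of_nonneg (by positivity)]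
      have : (i : ℝ) * τ ≤ b * τ := by gcongr
      linarith
    have h7 : (Φ u (z s j)).2 k - t • v = ((Φ u (z s j)).2 k - (z s j).2 k) +
        ((z s j).2 k - (z s (l * b)).2 k) +
        ((z s (l * b)).2 k - (sg s * ((l * b : ℕ) * τ)) • v) - (sg s * (i * τ) + u) • v := by
      have h8 : t = sg s * ((l * b : ℕ) * τ) + (sg s * (i * τ) + u) := by
        rw [htu, hji]; push_cast; ring
      rw [h8, add_smul _ (sg s * (i * τ) + u)]
      abel
    rw [h7]
    refine (norm_sub_le _ _).trans ?_
    have h9 := norm_add₃_le (a := (Φ u (z s j)).2 k - (z s j).2 k)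
      (b := (z s j).2 k - (z s (l * b)).2 k)
      (c := (z s (l * b)).2 k - (sg s * ((l * b : ℕ) * τ)) • v)
    linarith
  -- Only the forward half is needed to recognize the symbols: after `j₀` steps of the block the
  -- path parameter lies in the interval spent on `zo (ω l k)`.
  · obtain ⟨σ, hσ0, hσS, hσ⟩ := hblock true l k
    obtain ⟨h1, h2⟩ := hσbd true l k σ hσ0 hσS j₀ hj₀
    refine ⟨pt (q true (l * b + j₀) k), ?_, ?_⟩
    · rw [hσ j₀ hj₀]
      exact hpathE true _ (hptΛ _ _ _) _ _ _ h1 h2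
    · have := hzΦ true (l * b + j₀)
      rw [sg_true, one_mul] at this
      rw [← this]
      exact hzq true _ k

end LDS


/-! ### Positive entropy, and the choice of the constants. -/

namespace LDS

section Entropy

variable {E : Type} [NormedAddCommGroup E]

/-- Two functions whose symbols differ somewhere in the window are more than `2 δ` apart there, so
no ball of radius `δ` contains both. Every pattern of symbols on the window thus needs its own ball.
-/
theorem two_pow_le_coveringNumber {K : Set (ℝ → ℤ → E)} {δ T : ℝ} {tm : ℕ → ℝ}
    {u : (ℕ → ℤ → Bool) → ℝ → ℤ → E} (hu : ∀ ω, u ω ∈ K)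
    (hsep : ∀ ω ω' l k, ω l k ≠ ω' l k → 2 * δ < ‖u ω (tm l) k - u ω' (tm l) k‖) {B N : ℕ}
    (htm : ∀ l < B, |tm l| ≤ T) :
    ((2 ^ (B * (2 * N + 1)) : ℕ) : ℕ∞) ≤ coveringNumber K δ T N := by
  refine le_sInf ?_
  rintro _ ⟨S, rfl, hS⟩
  let I := Fin B × Finset.Icc (-(N : ℤ)) N
  let ext : (I → Bool) → ℕ → ℤ → Bool := fun p l k =>
    if h : l < B ∧ k ∈ Finset.Icc (-(N : ℤ)) N then p (⟨l, h.1⟩, ⟨k, h.2⟩) else false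
  choose w hwS hw using fun p : I → Bool => hS (u (ext p)) (hu _)
  have hinj : Function.Injective w := by
    intro p p' hpp'
    funext i
    by_contra hne
    obtain ⟨⟨l, hl⟩, ⟨k, hk⟩⟩ := i
    have h1 := hsep (ext p) (ext p') l k (by
      simp only [ext]
      rwa [dif_pos ⟨hl, hk⟩, dif_pos ⟨hl, hk⟩])
    have hk' : |k| ≤ (N : ℤ) := by rw [Finset.mem_Icc] at hk; exact abs_le.mpr hk
    have h2 := hw p (tm l) (htm l hl) k hk'
    have h3 := hw p' (tm l) (htm l hl) k hk'
    rw [← hpp', norm_sub_rev] at h3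
    have h4 := norm_sub_le_norm_sub_add_norm_sub (u (ext p) (tm l) k) (w p (tm l) k)
      (u (ext p') (tm l) k)
    linarith
  have hcard : Fintype.card (I → Bool) = 2 ^ (B * (2 * N + 1)) := by
    simp only [I, Fintype.card_fun, Fintype.card_bool, Fintype.card_prod, Fintype.card_fin,
      Fintype.card_coe, Int.card_Icc]
    congr 2
    omega
  rw [← hcard, ← ENat.card_eq_coe_fintype_card]
  refine hinj.encard_range.trans ?_
  exact Set.encard_le_encard (by rintro _ ⟨p, rfl⟩; exact hwS p)

/-- A set of functions that contains, for every assignment of symbols to the sites and to the time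
intervals of length `θ`, a function in which the symbols can be recognized, has positive space-time
entropy. -/
theorem spaceTimeEntropy_pos {K : Set (ℝ → ℤ → E)} {δ θ : ℝ} (hδ : 0 < δ) (hθ : 0 < θ)
    {tm : ℕ → ℝ} (htm : ∀ l, 0 ≤ tm l ∧ tm l ≤ (l + 1) * θ)
    {u : (ℕ → ℤ → Bool) → ℝ → ℤ → E} (hu : ∀ ω, u ω ∈ K)
    (hsep : ∀ ω ω' l k, ω l k ≠ ω' l k → 2 * δ < ‖u ω (tm l) k - u ω' (tm l) k‖) :
    0 < spaceTimeEntropy K := by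
  have hlog2 : 0 < Real.log 2 := Real.log_pos one_lt_two
  have hc : (0 : EReal) < ((Real.log 2 / (4 * θ) : ℝ) : EReal) := by
    rw [EReal.coe_pos]; positivity
  refine hc.trans_le (le_iSup₂_of_le δ hδ ?_)
  refine Filter.le_limsup_of_frequently_le' (Filter.Eventually.frequently ?_)
  have h1 : ∀ᶠ q : ℝ × ℕ in Filter.atTop ×ˢ Filter.atTop, 2 * θ ≤ q.1 ∧ 1 ≤ q.2 :=
    (Filter.eventually_ge_atTop _).prod_mk (Filter.eventually_ge_atTop _)
  filter_upwards [h1] with ⟨T, N⟩ ⟨hT, hN⟩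
  simp only at hT hN ⊢
  set B := ⌊T / θ⌋₊ with hB
  have hT0 : 0 < T := by linarith
  have hB1 : (B : ℝ) * θ ≤ T := by
    rw [← le_div_iff₀ hθ]; exact Nat.floor_le (by positivity)
  have hB2 : T < (B + 1) * θ := by
    rw [← div_lt_iff₀ hθ]; exact Nat.lt_floor_add_one _
  have hN' : (1 : ℝ) ≤ N := by exact_mod_cast hN
  have hcov := two_pow_le_coveringNumber (K := K) (δ := δ) (T := T) (B := B) (N := N) hu hsep
    (fun l hl => by
      rw [abs_of_nonneg (htm l).1]
      refine (htm l).2.trans (le_trans ?_ hB1)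
      have : (l : ℝ) + 1 ≤ B := by exact_mod_cast hl
      gcongr)
  have hlog : ((((B * (2 * N + 1) : ℕ) : ℝ) * Real.log 2 : ℝ) : EReal) ≤
      ENNReal.log (coveringNumber K δ T N : ℝ≥0∞) := by
    have h2 : ENNReal.log (((2 ^ (B * (2 * N + 1)) : ℕ) : ℕ∞) : ℝ≥0∞) ≤
        ENNReal.log (coveringNumber K δ T N : ℝ≥0∞) :=
      ENNReal.log_monotone (by exact_mod_cast hcov)
    refine le_trans (le_of_eq ?_) h2
    rw [ENat.toENNReal_coe, Nat.cast_pow, ENNReal.log_pow, EReal.coe_mul]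
    congr 1
    rw [ENNReal.log_pos_real (by norm_num) (by norm_num)]
    simp
  have hden : (0 : ℝ) ≤ 4 * T * N := by positivity
  refine le_trans ?_ (EReal.div_le_div_right_of_nonneg (EReal.coe_nonneg.mpr hden) hlog)
  -- For `T ≥ 2 θ` the number `B` of blocks is at least `T / (2 θ)`, hence `B (2 N + 1) ≥ T N / θ`,
  -- and the rate is at least `log 2 / (4 θ)`.
  rw [← EReal.coe_div, EReal.coe_le_coe_iff, div_le_div_iff₀ (by positivity) (by positivity)]
  have h3 : T * N ≤ (B * (2 * N + 1) : ℕ) * θ := by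
    push_cast
    nlinarith
  nlinarith

end Entropy

theorem norm_orbitMean_le {n m : ℕ} {g : Vec n → Vec m} {z : ℝ → Vec n} {T C : ℝ} (hT : 0 < T)
    (hC : ∀ t, ‖g (z t)‖ ≤ C) : ‖orbitMean g z T‖ ≤ C := by
  have h1 := intervalIntegral.norm_integral_le_of_norm_le_const (a := 0) (b := T)
    (f := fun t => g (z t)) (C := C) (fun t _ => hC t)
  rw [sub_zero, abs_of_pos hT] at h1
  rw [orbitMean, norm_smul, Real.norm_of_nonneg (by positivity)]
  calc 1 / T * _ ≤ 1 / T * (C * T) := mul_le_mul_of_nonneg_left h1 (by positivity)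
    _ = C := by field_simp

/-- The convex hull of a single point has empty interior in a nontrivial space. Two different means
provide the two disjoint orbits that serve as symbols. -/
theorem exists_ne_of_interior_convexHull_nonempty {E ι : Type*} [NormedAddCommGroup E]
    [NormedSpace ℝ E] [Nontrivial E] [Nonempty ι] {b : ι → E} {v : E}
    (hv : v ∈ interior (convexHull ℝ (Set.range b))) : ∃ i j, b i ≠ b j := by
  by_contra! hcon
  have h1 : Set.range b = {b (Classical.arbitrary ι)} :=
    Set.Subset.antisymm (by rintro _ ⟨i, rfl⟩; exact hcon _ _) (by rintro _ rfl; exact ⟨_, rfl⟩)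
  rw [h1, convexHull_singleton] at hv
  have := Module.punctured_nhds_neBot ℝ E (b (Classical.arbitrary ι))
  rw [interior_singleton] at hv
  exact hv

set_option maxHeartbeats 1000000 in
/-- The family of coded orbits of the weakly coupled lattice system. -/
theorem exists_coded_solutions {n m r : ℕ} (hm : 1 ≤ m) (hr : 1 ≤ r)
    {f : Vec n → Vec n} {g : Vec n → Vec m} (hf : HasBoundedDerivs r f)
    (hg : HasBoundedDerivs r g) {Λ : Set (Vec n)} (hbdd : Bornology.IsBounded Λ)
    (hinv : IsFlowInvariant f Λ) (hhyp : IsUniformlyHyperbolic f Λ)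
    (htrans : IsFlowTransitive f Λ) (hmax : IsLocallyMaximal f Λ) {ι : Type*} [Finite ι]
    [Nonempty ι] {z : ι → ℝ → Vec n} {T : ι → ℝ} (hz : ∀ i, IsPeriodicOrbitIn f Λ (z i) (T i))
    {F : ℝ → LInf (Vec n) × LInf (Vec m) → LInf (Vec n)}
    {G : ℝ → LInf (Vec n) × LInf (Vec m) → LInf (Vec m)}
    {ε₁ C : ℝ} (hε₁ : 0 < ε₁) (hF : ∀ ε, |ε| ≤ ε₁ → IsCrBoundedBy r C (F ε))
    (hG : ∀ ε, |ε| ≤ ε₁ → IsCrBoundedBy r C (G ε)) {v : Vec m}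
    (hv : v ∈ interior (convexHull ℝ (Set.range fun i => orbitMean g (z i) (T i)))) :
    ∃ ε₀ > 0, ∃ R₀ : ℝ, ∃ δ > 0, ∃ θ > 0, ∃ tm : ℕ → ℝ, (∀ l, 0 ≤ tm l ∧ tm l ≤ (l + 1) * θ) ∧
      ∀ ε : ℝ, |ε| < ε₀ → ∃ u : (ℕ → ℤ → Bool) → (ℝ → LInf (Vec n)) × (ℝ → LInf (Vec m)),
        (∀ ω ω' l k, ω l k ≠ ω' l k → 2 * δ < ‖(u ω).1 (tm l) k - (u ω').1 (tm l) k‖) ∧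
        ∀ ω, IsLatticeSolution f g ε (F ε) (G ε) (u ω).1 (u ω).2 ∧
          ∀ t : ℝ, ‖(u ω).1 t‖ + ‖(u ω).2 t - t • constSeq v‖ ≤ R₀ := by
  have : Nonempty (Fin m) := ⟨⟨0, hm⟩⟩
  -- a common constant, the flow, and the hyperbolic structure
  obtain ⟨Lf, hLf⟩ := hf.exists_isC1Lip hr
  obtain ⟨Lg, hLg⟩ := hg.exists_isC1Lip hr
  obtain ⟨L, hL, hfL, hgL, hCL⟩ : ∃ L, 1 ≤ L ∧ IsC1Lip f L ∧ IsC1Lip g L ∧ C ≤ L :=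
    ⟨max 1 (max Lf (max Lg C)), le_max_left _ _, hLf.mono (by simp), hLg.mono (by simp),
      by simp⟩
  have hL0 : 0 < L := by linarith
  obtain ⟨ψ, hψ⟩ := exists_isGlobalFlow f L hL0 hfL.lip
  have hgc : Continuous g := hgL.diff.continuous
  have hzc : ∀ i, Continuous (z i) := fun i =>
    continuous_iff_continuousAt.mpr fun t => ((hz i).1 t).continuousAt
  obtain ⟨i₀, i₁, hne⟩ := exists_ne_of_interior_convexHull_nonempty hv
  have hdisj := disjoint_range_of_orbitMean_ne hψ hgc (hz i₀).1 (hz i₁).1 (hz i₀).2.2.1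
    (hz i₁).2.2.1 (hz i₀).2.2.2 (hz i₁).2.2.2 hne
  obtain ⟨δ, hδ, hdist⟩ := exists_pos_dist_of_disjoint (hzc i₀) (hzc i₁) (hz i₀).2.2.1
    (hz i₁).2.2.1 (hz i₀).2.2.2 (hz i₁).2.2.2 hdisj
  have hΛ : Λ.Nontrivial := by
    refine ⟨z i₀ 0, (hz i₀).2.1 0, z i₁ 0, (hz i₁).2.1 0, fun h => ?_⟩
    have := hdist 0 0
    rw [h, sub_self, norm_zero] at this
    linarith
  obtain ⟨P, P₀, K, lam, hyp⟩ := exists_hypData hL hfL hψ hbdd hinv hhyp htrans hmax hΛ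
  obtain ⟨BΛ, hBΛ⟩ := hyp.compact.isBounded.exists_norm_le
  obtain ⟨Cg, hCg⟩ := hyp.compact.exists_bound_of_continuousOn hgc.continuousOn
  have hCg0 : 0 ≤ Cg := (norm_nonneg _).trans (hCg _ ((hz i₀).2.1 0))
  have hbm : ∀ i, ‖orbitMean g (z i) (T i)‖ ≤ Cg := fun i =>
    norm_orbitMean_le (hz i).2.2.1 fun t => hCg _ ((hz i).2.1 t)
  choose H B' hH hHB' using fun i =>
    exists_bounded_primitive (m := m) hgc (hzc i) (hz i).2.2.1 (hz i).2.2.2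
  obtain ⟨B, hB⟩ := exists_forall_le_of_finite B'
  have hHB : ∀ i t, ‖H i t‖ ≤ B := fun i t => (hHB' i t).trans (hB i)
  obtain ⟨c, hc, hctl⟩ := exists_inner_le_of_mem_interior_convexHull hv
  -- the constants
  obtain ⟨τ, hτ1, κ, hκ, near, R, hstep⟩ := exists_shadowStep (m := m) (g := g) hL hfL hψ hyp
  have hτ : 0 < τ := by linarith
  set E := Real.exp (L * τ) with hE
  have hE0 : 0 < E := Real.exp_pos _
  set A := (L * (E * (1 + L * τ)) + L) * τ + 2 * Cg + 1 with hA
  have hA0 : 0 < A := by positivity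
  -- `A` collects the errors of one step relative to `ρ₁`, so the drift error per step is at most `τ
  -- c / 4`, half of the effect of the control, independently of the block length. The bound `δ / 8`
  -- keeps the two symbols distinguishable.
  set ρ₁ := min 1 (min (τ * c / 4 / A) (δ / 8)) with hρ₁
  have hρ₁0 : 0 < ρ₁ := by positivity
  have hρ₁1 : ρ₁ ≤ 1 := min_le_left _ _
  have hρ₁c : ρ₁ * A ≤ τ * c / 4 := by
    rw [← le_div_iff₀ hA0]; exact (min_le_right _ _).trans (min_le_left _ _)
  have hρ₁δ : ρ₁ ≤ δ / 8 := (min_le_right _ _).trans (min_le_right _ _)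
  obtain ⟨ρ, hρ, γ, hγ, α, hα, hρρ₁, hαρ₁, -, hατ, ε', hε', hshadow⟩ := hstep ρ₁ hρ₁0
  obtain ⟨j₀, M, hpath⟩ := exists_pseudoPath hψ hL0.le hyp.compact hyp.inv htrans hτ
    (fun i => (hz i).1) (fun i => (hz i).2.1) hγ
  obtain ⟨N₀, hN₀⟩ := exists_nat_ge (2 * M / τ)
  set Cp := (Cg + L * (E * (1 + L * τ)) + L) * τ with hCp
  set W := 2 * N₀ * Cp + 2 * B + 2 * (ρ / κ) with hW
  -- The block length is chosen last: the transient `N₀` depends on the path length `M`, hence on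
  -- `γ`. The costs `W` do not grow with `b`, so for large `b` they fit into the remaining half of
  -- the control, `b τ c / 4`; moreover the time `j₀` of recognition falls into the block.
  obtain ⟨b, hb⟩ := exists_nat_ge (max (j₀ + 1 : ℝ) (W / (τ * c / 4)))
  have hbj : j₀ + 1 ≤ b := by exact_mod_cast (le_max_left _ _).trans hb
  have hbW : W ≤ b * (τ * c / 4) := by
    rw [← div_le_iff₀ (by positivity)]; exact (le_max_right _ _).trans hb
  set η := τ * c / 4 with hη
  set Mv := Cg + ‖v‖ with hMv
  set r' := b * τ * (Mv ^ 2 / c + c) + b * τ * Mv + (2 * N₀ * Cp + 2 * B + b * η) +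
    2 * (ρ / κ) with hr'
  refine ⟨min ε₁ (min ε' ρ₁), by positivity,
    (BΛ + E * (1 + L * τ)) + (r' + (b + 1) * (Cp + τ * ‖v‖)), δ / 4, by positivity, b * τ,
    by have : (0 : ℝ) < b := by exact_mod_cast (by omega : 0 < b)
       positivity,
    fun l => ((l * b + j₀ : ℕ) : ℝ) * τ, fun l => ⟨by positivity, ?_⟩, fun ε hε => ?_⟩
  · have : (j₀ : ℝ) ≤ b := by exact_mod_cast (by omega : j₀ ≤ b)
    rw [← mul_assoc]
    refine mul_le_mul_of_nonneg_right ?_ hτ.le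
    push_cast
    linarith
  obtain ⟨hεε₁, hε2⟩ := lt_min_iff.mp hε
  obtain ⟨hεε', hερ₁⟩ := lt_min_iff.mp hε2
  have hFε := hF ε hεε₁.le
  have hGε := hG ε hεε₁.le
  obtain ⟨Φ, hΦ⟩ := exists_isLatticeFlow hL hfL hgL (hερ₁.le.trans hρ₁1)
    (fun a b => (hFε.lip hr a b).trans (mul_le_mul_of_nonneg_right hCL (norm_nonneg _)))
    (fun a b => (hGε.lip hr a b).trans (mul_le_mul_of_nonneg_right hCL (norm_nonneg _)))
    (fun a => (hFε.norm_le a).trans hCL) (fun a => (hGε.norm_le a).trans hCL)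
  have st := hshadow ε (F ε) (G ε) Φ hεε'.le hΦ
  have hEρ₁ : E * (ρ + |ε| * L * τ) ≤ ρ₁ * (E * (1 + L * τ)) := by
    have h1 : |ε| * L * τ ≤ ρ₁ * L * τ := by gcongr
    calc _ ≤ E * (ρ₁ + ρ₁ * L * τ) := by gcongr
      _ = _ := by ring
  have hE1 : E * (ρ + |ε| * L * τ) ≤ E * (1 + L * τ) :=
    hEρ₁.trans (mul_le_of_le_one_left (by positivity) hρ₁1)
  have hη' : (L * (E * (ρ + |ε| * L * τ)) + |ε| * L) * τ + 2 * Cg * α ≤ η := by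
    refine le_trans ?_ hρ₁c
    calc _ ≤ (L * (ρ₁ * (E * (1 + L * τ))) + ρ₁ * L) * τ + 2 * Cg * ρ₁ := by gcongr
      _ ≤ _ := by rw [hA]; linarith
  have hC' : (Cg + L * (E * (ρ + |ε| * L * τ)) + |ε| * L) * τ ≤ Cp := by
    have h1 : |ε| * L ≤ L := mul_le_of_le_one_left hL0.le (hερ₁.le.trans hρ₁1)
    rw [hCp]
    gcongr
  have hcode := fun ω : ℕ → ℤ → Bool => exists_coded_orbit hψ hyp hΦ st hτ hα.le hατ
    (fun i => (hz i).1) (fun i => (hz i).2.1) hH hHB hCg hbm hpath hc hctl (Mv := Mv) (η := η)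
    (C := Cp) (r := r') (N₀ := N₀) (b := b)
    (fun i => (norm_sub_le _ _).trans (add_le_add (hbm i) le_rfl)) hη' hC'
    (by rw [div_le_iff₀ hτ] at hN₀; linarith) (by omega) (by omega)
    (by rw [hW] at hbW; rw [hη] at hbW ⊢; linarith) le_rfl (fun l k => if ω l k then i₁ else i₀)
  choose z₀ hz₀y hz₀p hz₀c using hcode
  refine ⟨fun ω => (fun t => (Φ t (z₀ ω)).1, fun t => (Φ t (z₀ ω)).2), ?_,
    fun ω => ⟨hΦ.isLatticeSolution _, fun t => add_le_add ?_ ?_⟩⟩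
  · have hmain : ∀ ω ω' l k, ω l k = true → ω' l k = false → 2 * (δ / 4) <
        ‖(Φ ((l * b + j₀ : ℕ) * τ) (z₀ ω)).1 k - (Φ ((l * b + j₀ : ℕ) * τ) (z₀ ω')).1 k‖ := by
      intro ω ω' l k h1 h2
      obtain ⟨_, ⟨t, rfl⟩, h3⟩ := hz₀c ω l k
      obtain ⟨_, ⟨t', rfl⟩, h4⟩ := hz₀c ω' l k
      rw [h1] at h3
      rw [h2] at h4
      simp only [if_true, Bool.false_eq_true, if_false] at h3 h4
      -- Both lattice orbits are within `ρ ≤ δ / 8` of orbits at distance at least `δ`, which leaves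
      -- a separation of at least `3 δ / 4 > δ / 2`.
      have h5 := hdist t' t
      have h6 := norm_sub_le_norm_sub_add_norm_sub (z i₀ t')
        ((Φ ((l * b + j₀ : ℕ) * τ) (z₀ ω')).1 k) (z i₁ t)
      have h7 := norm_sub_le_norm_sub_add_norm_sub ((Φ ((l * b + j₀ : ℕ) * τ) (z₀ ω')).1 k)
        ((Φ ((l * b + j₀ : ℕ) * τ) (z₀ ω)).1 k) (z i₁ t)
      rw [norm_sub_rev (z i₀ t') ((Φ ((l * b + j₀ : ℕ) * τ) (z₀ ω')).1 k)] at h6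
      rw [norm_sub_rev _ ((Φ ((l * b + j₀ : ℕ) * τ) (z₀ ω)).1 k)] at h7
      linarith
    intro ω ω' l k hωω'
    cases h1 : ω l k
    · rw [norm_sub_rev]
      exact hmain ω' ω l k (by rw [h1] at hωω'; simpa using hωω'.symm) h1
    · exact hmain ω ω' l k h1 (by rw [h1] at hωω'; simpa using hωω'.symm)
  · refine LInf.norm_le fun k => ?_
    obtain ⟨x, hx, h1⟩ := hz₀y ω t k
    have h2 := norm_le_norm_add_norm_sub x ((Φ t (z₀ ω)).1 k)
    rw [norm_sub_rev] at h2
    linarith [hBΛ x hx]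
  · exact LInf.norm_le fun k => hz₀p ω t k

end LDS


theorem corollary1 {n m r : ℕ} (hm : 1 ≤ m) (hr : 1 ≤ r)
    (f : LDS.Vec n → LDS.Vec n) (g : LDS.Vec n → LDS.Vec m)
    (hf : LDS.HasBoundedDerivs r f) (hg : LDS.HasBoundedDerivs r g)
    (Λ : Set (LDS.Vec n)) (hbdd : Bornology.IsBounded Λ) (hinv : LDS.IsFlowInvariant f Λ)
    (hhyp : LDS.IsUniformlyHyperbolic f Λ) (htrans : LDS.IsFlowTransitive f Λ)
    (hmax : LDS.IsLocallyMaximal f Λ)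
    (z : Fin (m + 1) → ℝ → LDS.Vec n) (T : Fin (m + 1) → ℝ)
    (hz : ∀ i, LDS.IsPeriodicOrbitIn f Λ (z i) (T i))
    (F : ℝ → LDS.LInf (LDS.Vec n) × LDS.LInf (LDS.Vec m) → LDS.LInf (LDS.Vec n))
    (G : ℝ → LDS.LInf (LDS.Vec n) × LDS.LInf (LDS.Vec m) → LDS.LInf (LDS.Vec m))
    (ε₁ C : ℝ) (hε₁ : 0 < ε₁)
    (hF : ∀ ε, |ε| ≤ ε₁ → LDS.IsCrBoundedBy r C (F ε))
    (hG : ∀ ε, |ε| ≤ ε₁ → LDS.IsCrBoundedBy r C (G ε))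
    (v : LDS.Vec m)
    (hv : v ∈ interior (convexHull ℝ (Set.range fun i => LDS.orbitMean g (z i) (T i)))) :
    ∃ ε₀ > 0, ∃ R₀ : ℝ, ∀ ε : ℝ, |ε| < ε₀ →
      ∃ K : Set ((ℝ → LDS.LInf (LDS.Vec n)) × (ℝ → LDS.LInf (LDS.Vec m))),
        0 < LDS.spaceTimeEntropy (LDS.toField '' K) ∧
        ∀ u ∈ K, LDS.IsLatticeSolution f g ε (F ε) (G ε) u.1 u.2 ∧
          ∀ t : ℝ, ‖u.1 t‖ + ‖u.2 t - t • LDS.constSeq v‖ ≤ R₀ := by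
  obtain ⟨ε₀, hε₀, R₀, δ, hδ, θ, hθ, tm, htm, h⟩ := LDS.exists_coded_solutions hm hr hf hg hbdd hinv
    hhyp htrans hmax hz hε₁ hF hG hv
  refine ⟨ε₀, hε₀, R₀, fun ε hε => ?_⟩
  obtain ⟨u, hsep, hu⟩ := h ε hε
  refine ⟨Set.range u, LDS.spaceTimeEntropy_pos hδ hθ htm (u := fun ω => LDS.toField (u ω))
    (fun ω => ⟨u ω, ⟨ω, rfl⟩, rfl⟩) fun ω ω' l k hne => (hsep ω ω' l k hne).trans_le ?_, ?_⟩
  · exact norm_fst_le (LDS.toField (u ω) (tm l) k - LDS.toField (u ω') (tm l) k)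
  · rintro _ ⟨ω, rfl⟩
    exact hu ω
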